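/- For real $x>0$ let $$f(x)=\sum_{\rho}\frac{x^{\rho}}{\rho}:=\lim_{T\to\infty}\ \sum_{|\operatorname{Im}\rho|<T}\frac{x^{\rho}}{\rho},$$ where $\rho$ runs over the non-trivial zeros of the Riemann zeta function (those with $0<\operatorname{Re}\rho<1$), each counted with its multiplicity, and let $$X=\{\,f(x): x\in(1,\infty),\ x \text{ algebraic over } \mathbb{Q}\,\}.$$ Schanuel's conjecture is the assertion that, for every $n$ and all complex numbers $\alpha_1,\dots,\alpha_n$ that are linearly independent over $\mathbb{Q}$, the field $\mathbb{Q}(\alpha_1,\dots,\alpha_n,e^{\alpha_1},\dots,e^{\alpha_n})$ has transcendence degree at least $n$ over $\mathbb{Q}$. Theorem. For every real algebraic number $x>1$ the limit defining $f(x)$ exists. If Schanuel's conjecture is true, then $X$ has no algebraic element; that is, $f(x)$ is transcendental for every real algebraic number $x>1$. -/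

import Mathlib

open Filter Topology

/-- Schanuel's conjecture. -/
def SchanuelConjecture : Prop :=
  ∀ (n : ℕ) (α : Fin n → ℂ), LinearIndependent ℚ α →
    (n : Cardinal) ≤ Algebra.trdeg ℚ
      (IntermediateField.adjoin ℚ
        (Set.range α ∪ Set.range (fun i => Complex.exp (α i))))

/-- The non-trivial zeros `ρ` of the Riemann zeta function (those with `0 < Re ρ < 1`)
such that `|Im ρ| < T`. -/
def nontrivialZetaZeros (T : ℝ) : Set ℂ :=
  {ρ | riemannZeta ρ = 0 ∧ 0 < ρ.re ∧ ρ.re < 1 ∧ |ρ.im| < T}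

theorem finite_nontrivialZetaZeros (T : ℝ) : (nontrivialZetaZeros T).Finite := by
  have hK : IsCompact (Set.Icc (0 : ℝ) 1 ×ℂ Set.Icc (-T) T) :=
    isCompact_Icc.reProdIm isCompact_Icc
  refine hK.inter_riemannZetaZeros_finite.subset ?_
  rintro ρ ⟨h0, h1, h2, h3⟩
  rw [abs_lt] at h3
  exact ⟨⟨⟨h1.le, h2.le⟩, ⟨h3.1.le, h3.2.le⟩⟩, mem_riemannZetaZeros.2 h0⟩

/-- The truncated sum of `x ^ ρ / ρ` over the non-trivial zeros with `|Im ρ| < T`, each zero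
being repeated according to its multiplicity. -/
noncomputable def zetaZeroPartialSum (x T : ℝ) : ℂ :=
  ∑ ρ ∈ (finite_nontrivialZetaZeros T).toFinset,
    (analyticOrderNatAt riemannZeta ρ : ℂ) * ((x : ℂ) ^ ρ / ρ)

/-- `f x = ∑ x ^ ρ / ρ`, the limit of the truncated sums as `T → ∞`. -/
noncomputable def zetaZeroSum (x : ℝ) : ℂ :=
  limUnder atTop (fun T : ℝ => zetaZeroPartialSum x T)

/-- The set `X` of the values of `f` at the real algebraic numbers `x > 1`. -/
def zetaZeroSumValues : Set ℂ :=
  {z | ∃ x : ℝ, 1 < x ∧ IsAlgebraic ℚ x ∧ z = zetaZeroSum x}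

/-! The theorem rests on von Mangoldt's explicit formula: for real x > 1
(`tendsto_zetaZeroPartialSum`), f(x) = x - log(2π) - (1/2) log(1 - x⁻²) - ψ₀(x), where ψ₀ is
Chebyshev's function with its jumps halved. Hence exp(2(x - f(x))) = 4 (1 - x⁻²) exp(2ψ₀(x)) π².
Here exp(2ψ₀(x)) is a natural number, because exp(Λ(n)) is a prime or 1 and the doubled weights are
0, 1 or 2. If x and f(x) were both algebraic, then e^γ = βπ² with γ and β algebraic.

Schanuel's conjecture forbids this (`SchanuelConjecture.exp_ne_mul_pi_sq`). If γ ≠ 0, then γ and πi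
are linearly independent over ℚ, one being real and the other imaginary, while γ, πi, e^γ = βπ² and
e^{πi} = -1 are all algebraic over ℚ(π), so the transcendence degree is at most 1 instead of 2. If γ
= 0, then π would be algebraic, against the case n = 1 applied to πi.

For the explicit formula, -ζ'/ζ(s) x^s/s is integrated around [-(2K+1), 2] × [-T, T]. Perron's
formula identifies the limit of the right side with ψ₀; the residues give x, log(2π), the trivial
zeros and the sum over ρ. The other sides are killed by bounds on ζ'/ζ. To the left of the strip
these come from the functional equation and a crude bound for the digamma function. In the strip, a
Blaschke-product and Borel–Carathéodory argument (`exists_local_logDeriv_bound`) gives O(log T)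
zeros near height T and controls ζ'/ζ by them; the pigeonhole principle then yields a height in [T,
T+1] where ζ'/ζ = O(log² T). Moving from T to that height changes the sum by O(log T / T), so the
limit exists along all T. -/

/-! ### Rectangular contours and the residue theorem. -/

/-- The integral of `f` along the positively oriented boundary of `[a, b] × [c, d]`. -/
noncomputable def rectIntegral (f : ℂ → ℂ) (a b c d : ℝ) : ℂ :=
  (∫ x : ℝ in a..b, f (x + c * Complex.I)) - (∫ x : ℝ in a..b, f (x + d * Complex.I)) +
    Complex.I * (∫ y : ℝ in c..d, f (b + y * Complex.I)) -
    Complex.I * (∫ y : ℝ in c..d, f (a + y * Complex.I))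

theorem rectIntegral_eq_zero {f : ℂ → ℂ} {a b c d : ℝ} (hab : a ≤ b) (hcd : c ≤ d)
    (hf : ∀ s : ℂ, a ≤ s.re → s.re ≤ b → c ≤ s.im → s.im ≤ d → DifferentiableAt ℂ f s) :
    rectIntegral f a b c d = 0 := by
  have := Complex.integral_boundary_rect_eq_zero_of_differentiableOn f ⟨a, c⟩ ⟨b, d⟩ (by
    intro s hs
    simp only [Set.uIcc_of_le hab, Set.uIcc_of_le hcd, Complex.mem_reProdIm, Set.mem_Icc] at hs
    exact (hf s hs.1.1 hs.1.2 hs.2.1 hs.2.2).differentiableWithinAt)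
  simpa [rectIntegral] using this

theorem rectIntegral_add {f g : ℂ → ℂ} {a b c d : ℝ} (hab : a ≤ b) (hcd : c ≤ d)
    (hf : ∀ s : ℂ, a ≤ s.re → s.re ≤ b → c ≤ s.im → s.im ≤ d →
      (s.re = a ∨ s.re = b ∨ s.im = c ∨ s.im = d) → ContinuousAt f s)
    (hg : ∀ s : ℂ, a ≤ s.re → s.re ≤ b → c ≤ s.im → s.im ≤ d →
      (s.re = a ∨ s.re = b ∨ s.im = c ∨ s.im = d) → ContinuousAt g s) :
    rectIntegral (fun s => f s + g s) a b c d = rectIntegral f a b c d + rectIntegral g a b c d := by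
  have hor : ∀ h : ℂ → ℂ, (∀ s : ℂ, a ≤ s.re → s.re ≤ b → c ≤ s.im → s.im ≤ d →
      (s.re = a ∨ s.re = b ∨ s.im = c ∨ s.im = d) → ContinuousAt h s) → ∀ y : ℝ, (y = c ∨ y = d) →
      IntervalIntegrable (fun x : ℝ => h (x + y * Complex.I)) MeasureTheory.volume a b := by
    intro h hh y hy
    apply ContinuousOn.intervalIntegrable
    intro x hx
    rw [Set.uIcc_of_le hab] at hx
    apply ContinuousAt.continuousWithinAt
    apply ContinuousAt.comp (f := fun x : ℝ => (x + y * Complex.I : ℂ)) (g := h)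
    · apply hh <;> rcases hy with rfl | rfl <;> simp [hx.1, hx.2, hcd]
    · fun_prop
  have ver : ∀ h : ℂ → ℂ, (∀ s : ℂ, a ≤ s.re → s.re ≤ b → c ≤ s.im → s.im ≤ d →
      (s.re = a ∨ s.re = b ∨ s.im = c ∨ s.im = d) → ContinuousAt h s) → ∀ x : ℝ, (x = a ∨ x = b) →
      IntervalIntegrable (fun y : ℝ => h (x + y * Complex.I)) MeasureTheory.volume c d := by
    intro h hh x hx
    apply ContinuousOn.intervalIntegrable
    intro y hy
    rw [Set.uIcc_of_le hcd] at hy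
    apply ContinuousAt.continuousWithinAt
    apply ContinuousAt.comp (f := fun y : ℝ => (x + y * Complex.I : ℂ)) (g := h)
    · apply hh <;> rcases hx with rfl | rfl <;> simp [hy.1, hy.2, hab]
    · fun_prop
  unfold rectIntegral
  rw [intervalIntegral.integral_add (hor f hf c (Or.inl rfl)) (hor g hg c (Or.inl rfl)),
    intervalIntegral.integral_add (hor f hf d (Or.inr rfl)) (hor g hg d (Or.inr rfl)),
    intervalIntegral.integral_add (ver f hf a (Or.inl rfl)) (ver g hg a (Or.inl rfl)),
    intervalIntegral.integral_add (ver f hf b (Or.inr rfl)) (ver g hg b (Or.inr rfl))]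
  ring

theorem rectIntegral_const_mul (r : ℂ) (f : ℂ → ℂ) (a b c d : ℝ) :
    rectIntegral (fun s => r * f s) a b c d = r * rectIntegral f a b c d := by
  unfold rectIntegral
  simp only [intervalIntegral.integral_const_mul]
  ring

theorem rectIntegral_congr {f g : ℂ → ℂ} {a b c d : ℝ} (hab : a ≤ b) (hcd : c ≤ d)
    (h : ∀ s : ℂ, a ≤ s.re → s.re ≤ b → c ≤ s.im → s.im ≤ d →
      (s.re = a ∨ s.re = b ∨ s.im = c ∨ s.im = d) → f s = g s) :
    rectIntegral f a b c d = rectIntegral g a b c d := by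
  unfold rectIntegral
  have hor : ∀ y : ℝ, (y = c ∨ y = d) → ∫ x : ℝ in a..b, f (x + y * Complex.I) =
      ∫ x : ℝ in a..b, g (x + y * Complex.I) := by
    intro y hy
    apply intervalIntegral.integral_congr
    intro x hx
    rw [Set.uIcc_of_le hab] at hx
    apply h <;> rcases hy with rfl | rfl <;> simp [hx.1, hx.2, hcd]
  have ver : ∀ x : ℝ, (x = a ∨ x = b) → ∫ y : ℝ in c..d, f (x + y * Complex.I) =
      ∫ y : ℝ in c..d, g (x + y * Complex.I) := by
    intro x hx
    apply intervalIntegral.integral_congr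
    intro y hy
    rw [Set.uIcc_of_le hcd] at hy
    apply h <;> rcases hx with rfl | rfl <;> simp [hy.1, hy.2, hab]
  rw [hor c (Or.inl rfl), hor d (Or.inr rfl), ver a (Or.inl rfl), ver b (Or.inr rfl)]

theorem log_neg_of_im_pos {z : ℂ} (hz : 0 < z.im) :
    Complex.log (-z) = Complex.log z - Real.pi * Complex.I := by
  rw [Complex.log, Complex.log, Complex.arg_neg_eq_arg_sub_pi_of_im_pos hz]
  simp; ring

theorem log_neg_of_im_neg {z : ℂ} (hz : z.im < 0) :
    Complex.log (-z) = Complex.log z + Real.pi * Complex.I := by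
  rw [Complex.log, Complex.log, Complex.arg_neg_eq_arg_add_pi_of_im_neg hz]
  simp; ring

/-- The principal log(s - p) is an antiderivative on the right and horizontal sides. The left side
crosses its cut, so log(-(s - p)) is used there; the two branches differ by -πi at the top corner
and +πi at the bottom one, which adds up to 2πi. -/
theorem rectIntegral_inv_sub {a b c d : ℝ} {p : ℂ} (ha : a < p.re) (hb : p.re < b)
    (hc : c < p.im) (hd : p.im < d) :
    rectIntegral (fun s => (s - p)⁻¹) a b c d = 2 * Real.pi * Complex.I := by
  have hcd : c ≤ d := (hc.trans hd).le
  have hor : ∀ y : ℝ, y ≠ p.im → ∫ x : ℝ in a..b, ((x + y * Complex.I : ℂ) - p)⁻¹ =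
      Complex.log (b + y * Complex.I - p) - Complex.log (a + y * Complex.I - p) := by
    intro y hy
    have hsl : ∀ x : ℝ, (x + y * Complex.I - p : ℂ) ∈ Complex.slitPlane := by
      intro x
      right
      simpa [sub_eq_zero] using hy
    apply intervalIntegral.integral_eq_sub_of_hasDerivAt
      (f := fun x : ℝ => Complex.log (x + y * Complex.I - p))
    · intro x _
      have h1 : HasDerivAt (fun x : ℝ => (x + y * Complex.I - p : ℂ)) 1 x :=
        ((Complex.ofRealCLM.hasDerivAt (x := x)).add_const _).sub_const _
      simpa using h1.clog_real (hsl x)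
    · apply Continuous.intervalIntegrable
      apply Continuous.inv₀ (by fun_prop)
      exact fun x => Complex.slitPlane_ne_zero (hsl x)
  have hright : Complex.I * ∫ y : ℝ in c..d, ((b + y * Complex.I : ℂ) - p)⁻¹ =
      Complex.log (b + d * Complex.I - p) - Complex.log (b + c * Complex.I - p) := by
    have hsl : ∀ y : ℝ, (b + y * Complex.I - p : ℂ) ∈ Complex.slitPlane := by
      intro y
      left
      simpa using hb
    rw [← intervalIntegral.integral_const_mul]
    apply intervalIntegral.integral_eq_sub_of_hasDerivAt
      (f := fun y : ℝ => Complex.log (b + y * Complex.I - p))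
    · intro y _
      have h1 : HasDerivAt (fun y : ℝ => (b + y * Complex.I - p : ℂ)) (1 * Complex.I) y :=
        (((Complex.ofRealCLM.hasDerivAt (x := y)).mul_const _).const_add _).sub_const _
      simpa [div_eq_mul_inv] using h1.clog_real (hsl y)
    · apply Continuous.intervalIntegrable
      apply Continuous.mul continuous_const
      apply Continuous.inv₀ (by fun_prop)
      exact fun x => Complex.slitPlane_ne_zero (hsl x)
  have hleft : Complex.I * ∫ y : ℝ in c..d, ((a + y * Complex.I : ℂ) - p)⁻¹ =
      Complex.log (-(a + d * Complex.I - p)) - Complex.log (-(a + c * Complex.I - p)) := by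
    have hsl : ∀ y : ℝ, (-(a + y * Complex.I - p) : ℂ) ∈ Complex.slitPlane := by
      intro y
      left
      simpa using ha
    rw [← intervalIntegral.integral_const_mul]
    apply intervalIntegral.integral_eq_sub_of_hasDerivAt
      (f := fun y : ℝ => Complex.log (-(a + y * Complex.I - p)))
    · intro y _
      have h1 : HasDerivAt (fun y : ℝ => (-(a + y * Complex.I - p) : ℂ)) (-(1 * Complex.I)) y :=
        ((((Complex.ofRealCLM.hasDerivAt (x := y)).mul_const _).const_add _).sub_const _).neg
      have h2 := h1.clog_real (hsl y)
      rwa [one_mul, neg_div_neg_eq, div_eq_mul_inv] at h2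
    · apply Continuous.intervalIntegrable
      apply Continuous.mul continuous_const
      apply Continuous.inv₀ (by fun_prop)
      exact fun x h => Complex.slitPlane_ne_zero (hsl x) (by rw [h, neg_zero])
  unfold rectIntegral
  rw [hor c hc.ne, hor d hd.ne', hright, hleft, log_neg_of_im_pos (by simpa using hd),
    log_neg_of_im_neg (by simpa using hc)]
  ring

/-- The residue theorem on a rectangle, for finitely many simple poles in its interior. -/
theorem rectIntegral_eq_sum_residues {a b c d : ℝ} (hab : a ≤ b) (hcd : c ≤ d) (r : ℂ → ℂ)
    (S : Finset ℂ) : ∀ (f : ℂ → ℂ),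
    (∀ p ∈ S, a < p.re ∧ p.re < b ∧ c < p.im ∧ p.im < d) →
    (∀ s : ℂ, a ≤ s.re → s.re ≤ b → c ≤ s.im → s.im ≤ d → s ∉ S → DifferentiableAt ℂ f s) →
    (∀ p ∈ S, ∃ g : ℂ → ℂ, AnalyticAt ℂ g p ∧ ∀ᶠ s in 𝓝[≠] p, f s = g s + r p * (s - p)⁻¹) →
    rectIntegral f a b c d = 2 * Real.pi * Complex.I * ∑ p ∈ S, r p := by
  classical
  induction S using Finset.induction_on with
  | empty =>
    intro f _ hf _
    rw [rectIntegral_eq_zero hab hcd (fun s h1 h2 h3 h4 => hf s h1 h2 h3 h4 (by simp))]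
    simp
  | insert p S hp ih =>
    intro f hS hf hr
    obtain ⟨hpa, hpb, hpc, hpd⟩ := hS p (Finset.mem_insert_self _ _)
    obtain ⟨g, hg, hgf⟩ := hr p (Finset.mem_insert_self _ _)
    -- Subtract the principal part at p and fill in the removable singularity: `f₁` agrees with `g`
    -- near p, so the induction hypothesis applies to it with one pole fewer.
    set f₁ : ℂ → ℂ := fun s => if s = p then g p else f s - r p * (s - p)⁻¹ with hf₁
    have hloc : ∀ q : ℂ, q ≠ p → f₁ =ᶠ[𝓝 q] fun s => f s - r p * (s - p)⁻¹ := by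
      intro q hq
      filter_upwards [isOpen_ne.mem_nhds hq] with s hs
      have hs' : s ≠ p := hs
      simp [hf₁, hs']
    have hinv : ∀ q : ℂ, q ≠ p → AnalyticAt ℂ (fun s => r p * (s - p)⁻¹) q := by
      intro q hq
      have : q - p ≠ 0 := sub_ne_zero.2 hq
      fun_prop (disch := assumption)
    have hf₁p : AnalyticAt ℂ f₁ p := by
      refine hg.congr ?_
      rw [eventually_nhdsWithin_iff] at hgf
      filter_upwards [hgf] with s hs
      by_cases h : s = p
      · simp [hf₁, h]
      · simp only [hf₁, h, if_false]
        rw [hs h]; ring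
    have hd₁ : ∀ s : ℂ, a ≤ s.re → s.re ≤ b → c ≤ s.im → s.im ≤ d → s ∉ S →
        DifferentiableAt ℂ f₁ s := by
      intro s h1 h2 h3 h4 hs
      by_cases h : s = p
      · rw [h]; exact hf₁p.differentiableAt
      · refine DifferentiableAt.congr_of_eventuallyEq ?_ (hloc s h)
        exact (hf s h1 h2 h3 h4 (by simp [h, hs])).sub (hinv s h).differentiableAt
    have h1 := ih f₁ (fun q hq => hS q (Finset.mem_insert_of_mem hq)) hd₁ (by
      intro q hq
      obtain ⟨g', hg', hgf'⟩ := hr q (Finset.mem_insert_of_mem hq)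
      have hqp : q ≠ p := fun h => hp (h ▸ hq)
      refine ⟨fun s => g' s - r p * (s - p)⁻¹, hg'.sub (hinv q hqp), ?_⟩
      filter_upwards [hgf', (hloc q hqp).filter_mono nhdsWithin_le_nhds] with s h1 h2
      rw [h2, h1]; ring)
    have hbd : ∀ s : ℂ, (s.re = a ∨ s.re = b ∨ s.im = c ∨ s.im = d) → s ≠ p ∧ s ∉ S := by
      intro s hs
      have : ∀ q ∈ insert p S, s ≠ q := by
        rintro q hq rfl
        obtain ⟨h1, h2, h3, h4⟩ := hS _ hq
        rcases hs with h | h | h | h <;> linarith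
      exact ⟨this p (Finset.mem_insert_self _ _), fun h => this s (Finset.mem_insert_of_mem h) rfl⟩
    have h2 : rectIntegral f a b c d =
        rectIntegral (fun s => f₁ s + r p * (s - p)⁻¹) a b c d := by
      apply rectIntegral_congr hab hcd
      intro s _ _ _ _ hs
      simp [hf₁, (hbd s hs).1]
    rw [h2, rectIntegral_add hab hcd, h1, rectIntegral_const_mul,
      rectIntegral_inv_sub hpa hpb hpc hpd, Finset.sum_insert hp]
    · ring
    · intro s h1 h2 h3 h4 hs
      exact (hd₁ s h1 h2 h3 h4 (hbd s hs).2).continuousAt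
    · intro s h1 h2 h3 h4 hs
      exact (hinv s (hbd s hs).1).continuousAt

/-! ### Logarithmic derivatives and local zero counts for analytic functions. -/

/-- Near a zero of finite order `n`, the logarithmic derivative is analytic up to `n / (s - p)`. -/
theorem AnalyticAt.exists_logDeriv_eq {f : ℂ → ℂ} {p : ℂ} (hf : AnalyticAt ℂ f p)
    (h : analyticOrderAt f p ≠ ⊤) :
    ∃ g : ℂ → ℂ, AnalyticAt ℂ g p ∧
      ∀ᶠ s in 𝓝[≠] p, f s ≠ 0 ∧ logDeriv f s = g s + analyticOrderNatAt f p * (s - p)⁻¹ := by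
  obtain ⟨g, hg, hg0, hfg⟩ := hf.analyticOrderAt_ne_top.1 h
  refine ⟨logDeriv g, hg.deriv.div hg hg0, ?_⟩
  have h1 := hfg.eventually_nhds
  have h2 := hg.eventually_analyticAt
  have h3 := hg.continuousAt.eventually_ne hg0
  filter_upwards [h1.filter_mono nhdsWithin_le_nhds, h2.filter_mono nhdsWithin_le_nhds,
    h3.filter_mono nhdsWithin_le_nhds, self_mem_nhdsWithin] with s h1 h2 h3 h4
  have h5 : s - p ≠ 0 := sub_ne_zero.2 h4
  refine ⟨by rw [h1.self_of_nhds]; simp [h3, h5], ?_⟩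
  have h6 : f =ᶠ[𝓝 s] fun z => (z - p) ^ analyticOrderNatAt f p * g z := by
    filter_upwards [h1] with z hz using by simpa using hz
  rw [logDeriv_apply, h6.deriv_eq, h6.self_of_nhds, ← logDeriv_apply,
    logDeriv_mul _ (by simp [h5]) h3 (by fun_prop) h2.differentiableAt]
  rw [add_comm]
  congr 1
  have : (fun z : ℂ => (z - p) ^ analyticOrderNatAt f p) =
    fun z => ((fun z => z - p) z) ^ analyticOrderNatAt f p := rfl
  rw [logDeriv_fun_pow (by fun_prop)]
  simp [logDeriv_apply]

/-- The zeros are divided out one at a time. Factors already removed do not vanish at the next point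
p, so the quotient still has there the order of `f`. -/
theorem exists_eq_prod_pow_mul {U : Set ℂ} (hU : IsOpen U) {f : ℂ → ℂ}
    (hf : DifferentiableOn ℂ f U) (Z : Finset ℂ) (hZ : ∀ p ∈ Z, p ∈ U)
    (ho : ∀ p ∈ Z, analyticOrderAt f p ≠ ⊤) :
    ∃ h : ℂ → ℂ, DifferentiableOn ℂ h U ∧
      (∀ s ∈ U, f s = (∏ p ∈ Z, (s - p) ^ analyticOrderNatAt f p) * h s) ∧ ∀ p ∈ Z, h p ≠ 0 := by
  classical
  induction Z using Finset.induction_on with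
  | empty => exact ⟨f, hf, by simp, by simp⟩
  | insert p Z hp ih =>
    obtain ⟨h, hh, hfh, hne⟩ := ih (fun q hq => hZ q (Finset.mem_insert_of_mem hq))
      (fun q hq => ho q (Finset.mem_insert_of_mem hq))
    have hpU := hZ p (Finset.mem_insert_self _ _)
    have hpo := ho p (Finset.mem_insert_self _ _)
    have hha : AnalyticAt ℂ h p := hh.analyticAt (hU.mem_nhds hpU)
    set P : ℂ → ℂ := fun s => ∏ q ∈ Z, (s - q) ^ analyticOrderNatAt f q with hP
    have hPa : AnalyticAt ℂ P p := by
      apply Finset.analyticAt_fun_prod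
      intro q _
      fun_prop
    have hPp : P p ≠ 0 := by
      rw [hP]
      refine Finset.prod_ne_zero_iff.2 fun q hq => pow_ne_zero _ (sub_ne_zero.2 ?_)
      rintro rfl
      exact hp hq
    have hord : analyticOrderAt h p = analyticOrderAt f p := by
      have h1 : f =ᶠ[𝓝 p] P * h := by
        filter_upwards [hU.mem_nhds hpU] with s hs using hfh s hs
      rw [analyticOrderAt_congr h1, analyticOrderAt_mul hPa hha,
        hPa.analyticOrderAt_eq_zero.2 hPp, zero_add]
    obtain ⟨g, hg, hg0, hgh⟩ := hha.analyticOrderAt_ne_top.1 (hord ▸ hpo)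
    have hn : analyticOrderNatAt h p = analyticOrderNatAt f p := by
      rw [analyticOrderNatAt, hord, ← analyticOrderNatAt]
    rw [hn] at hgh
    set n := analyticOrderNatAt f p with hn'
    set h₁ : ℂ → ℂ := fun s => if s = p then g p else h s / (s - p) ^ n with hh₁
    have e1 : h₁ =ᶠ[𝓝 p] g := by
      filter_upwards [hgh] with s hs
      by_cases hsp : s = p
      · simp [hh₁, hsp]
      · have : (s - p) ^ n ≠ 0 := pow_ne_zero _ (sub_ne_zero.2 hsp)
        simp only [hh₁, hsp, if_false]
        rw [hs, smul_eq_mul]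
        field_simp
    refine ⟨h₁, ?_, ?_, ?_⟩
    · intro s hs
      apply DifferentiableAt.differentiableWithinAt
      by_cases hsp : s = p
      · rw [hsp]
        exact hg.differentiableAt.congr_of_eventuallyEq e1
      · have e2 : h₁ =ᶠ[𝓝 s] fun s => h s / (s - p) ^ n := by
          filter_upwards [isOpen_ne.mem_nhds hsp] with z hz
          have hz' : z ≠ p := hz
          simp [hh₁, hz']
        refine DifferentiableAt.congr_of_eventuallyEq ?_ e2
        exact (hh.differentiableAt (hU.mem_nhds hs)).fun_div (by fun_prop)
          (pow_ne_zero _ (sub_ne_zero.2 hsp))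
    · intro s hs
      rw [Finset.prod_insert hp, hfh s hs]
      by_cases hsp : s = p
      · rw [hsp] at *
        rw [hgh.self_of_nhds]
        simp [hh₁]
        ring
      · have : (s - p) ^ n ≠ 0 := pow_ne_zero _ (sub_ne_zero.2 hsp)
        simp only [hh₁, hsp, if_false]
        rw [← hn']
        field_simp
    · intro q hq
      by_cases hqp : q = p
      · simp [hh₁, hqp, hg0]
      · simp only [hh₁, hqp, if_false]
        exact div_ne_zero (hne q (Finset.mem_of_mem_insert_of_ne hq hqp))
          (pow_ne_zero _ (sub_ne_zero.2 hqp))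

/-- Borel–Carathéodory for the logarithmic derivative of a nonvanishing function. -/
theorem norm_logDeriv_le_of_ne_zero {r₁ r₂ A : ℝ} {c : ℂ} {H : ℂ → ℂ} (h0 : 0 < r₁) (h12 : r₁ < r₂)
    (hA : 0 < A) (hH : DifferentiableOn ℂ H (Metric.ball c r₂))
    (hne : ∀ s ∈ Metric.ball c r₂, H s ≠ 0)
    (hb : ∀ s ∈ Metric.ball c r₂, Real.log (‖H s‖ / ‖H c‖) ≤ A) :
    ∀ s ∈ Metric.closedBall c r₁, ‖logDeriv H s‖ ≤
      2 * A * ((r₁ + r₂) / 2) / (r₂ - (r₁ + r₂) / 2) / ((r₁ + r₂) / 2 - r₁) := by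
  -- An intermediate radius: Borel–Carathéodory bounds the logarithm on the disc of radius m, and
  -- Cauchy's estimate on circles of radius m - r₁ then bounds its derivative.
  set m := (r₁ + r₂) / 2 with hm
  have hm1 : r₁ < m := by rw [hm]; linarith
  have hm2 : m < r₂ := by rw [hm]; linarith
  have hopen : IsOpen (Metric.ball c r₂) := Metric.isOpen_ball
  have hcmem : c ∈ Metric.ball c r₂ := Metric.mem_ball_self (h0.trans h12)
  have hLd : DifferentiableOn ℂ (fun s => deriv H s / H s) (Metric.ball c r₂) :=
    (hH.deriv hopen).fun_div hH hne
  -- A primitive of H'/H vanishing at c, that is, a logarithm of H/H(c); the hypothesis `hb` says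
  -- that its real part is at most A.
  obtain ⟨L, hLc, hL⟩ := hLd.isExactOn_ball.with_val_at c 0
  have hLdiff : DifferentiableOn ℂ L (Metric.ball c r₂) :=
    fun s hs => (hL s hs).differentiableAt.differentiableWithinAt
  have hconst : ∀ s ∈ Metric.ball c r₂, H s = H c * Complex.exp (L s) := by
    intro s hs
    have hD : ∀ z ∈ Metric.ball c r₂, HasDerivAt (fun z => H z * Complex.exp (-L z)) 0 z := by
      intro z hz
      have h1 := (hH.differentiableAt (hopen.mem_nhds hz)).hasDerivAt
      refine (h1.fun_mul (hL z hz).fun_neg.cexp).congr_deriv ?_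
      rw [mul_neg, mul_neg, mul_left_comm, mul_div_cancel₀ _ (hne z hz)]
      ring
    have h2 := hopen.is_const_of_deriv_eq_zero (convex_ball c r₂).isPreconnected
      (fun z hz => (hD z hz).differentiableAt.differentiableWithinAt)
      (fun z hz => (hD z hz).deriv) hs hcmem
    simp only [hLc, neg_zero, Complex.exp_zero, mul_one] at h2
    rw [← h2, mul_assoc, ← Complex.exp_add]
    simp
  have hre : ∀ s ∈ Metric.ball c r₂, (L s).re ≤ A := by
    intro s hs
    have h1 := hb s hs
    rw [hconst s hs, norm_mul, Complex.norm_exp,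
      mul_div_cancel_left₀ _ (norm_ne_zero_iff.2 (hne c hcmem)), Real.log_exp] at h1
    exact h1
  have hLb : ∀ s ∈ Metric.closedBall c m, ‖L s‖ ≤ 2 * A * m / (r₂ - m) := by
    intro s hs
    have hs' : ‖s - c‖ ≤ m := by simpa [dist_eq_norm] using hs
    have hmaps : Set.MapsTo (fun z : ℂ => c + z) (Metric.ball 0 r₂) (Metric.ball c r₂) := by
      intro z hz
      simpa [dist_eq_norm] using hz
    have := Complex.borelCaratheodory_zero (f := fun z => L (c + z)) (z := s - c) hA
      (hLdiff.comp (by fun_prop) hmaps) (fun z hz => hre _ (hmaps hz)) (h0.trans h12)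
      (by simp [dist_eq_norm]; linarith) (by simpa using hLc)
    simp only [add_sub_cancel] at this
    refine this.trans ?_
    have : 0 < r₂ - m := by linarith
    have : 0 < m := by linarith
    gcongr
  intro s hs
  have hs' : dist s c ≤ r₁ := hs
  have hsm : s ∈ Metric.ball c r₂ := by
    rw [Metric.mem_ball]; linarith
  have hsub : Metric.closedBall s (m - r₁) ⊆ Metric.closedBall c m := by
    apply Metric.closedBall_subset_closedBall'
    linarith
  rw [logDeriv_apply, ← (hL s hsm).deriv]
  apply Complex.norm_deriv_le_of_forall_mem_sphere_norm_le (by linarith)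
  · have : DifferentiableOn ℂ L (Metric.closedBall s (m - r₁)) :=
      hLdiff.mono (hsub.trans (Metric.closedBall_subset_ball hm2))
    exact (this.mono (Metric.closure_ball_subset_closedBall)).diffContOnCl
  · intro z hz
    exact hLb z (hsub (Metric.sphere_subset_closedBall hz))

/-- On the circle R² is z times its conjugate. This is why Blaschke factors are unimodular there. -/
theorem norm_sq_sub_conj_mul {w z : ℂ} {R : ℝ} (hz : ‖z‖ = R) :
    ‖(R : ℂ) ^ 2 - (starRingEnd ℂ) w * z‖ = R * ‖z - w‖ := by
  have h : (R : ℂ) ^ 2 = (starRingEnd ℂ) z * z := by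
    rw [← hz, Complex.conj_mul', ]
  rw [h, ← sub_mul, norm_mul, ← map_sub, Complex.norm_conj, hz, mul_comm]

/-- The number of zeros of `f` in a disc, and the logarithmic derivative of `f` away from these
zeros, are controlled by the growth of `f` on a larger disc. -/
theorem exists_local_logDeriv_bound {r₁ r₂ R : ℝ} (h0 : 0 < r₁) (h12 : r₁ < r₂) (h2R : r₂ < R) :
    ∃ C : ℝ, 0 < C ∧ ∀ (f : ℂ → ℂ) (c : ℂ) (M : ℝ) (Z : Finset ℂ),
      AnalyticOnNhd ℂ f (Metric.closedBall c R) → f c ≠ 0 → ‖f c‖ < M →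
      (∀ s ∈ Metric.closedBall c R, ‖f s‖ ≤ M) →
      (∀ p, p ∈ Z ↔ p ∈ Metric.closedBall c r₂ ∧ f p = 0) →
      (∑ p ∈ Z, (analyticOrderNatAt f p : ℝ)) ≤ C * Real.log (M / ‖f c‖) ∧
      ∀ s ∈ Metric.closedBall c r₁, f s ≠ 0 →
        ‖logDeriv f s - ∑ p ∈ Z, analyticOrderNatAt f p * (s - p)⁻¹‖ ≤
          C * Real.log (M / ‖f c‖) := by
  have hr₂ : 0 < r₂ := h0.trans h12
  have hR : 0 < R := hr₂.trans h2R
  have hlog : 0 < Real.log (R / r₂) := Real.log_pos ((one_lt_div hr₂).2 h2R)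
  set m := (r₁ + r₂) / 2 with hm
  have hm1 : r₁ < m := by rw [hm]; linarith
  have hm2 : m < r₂ := by rw [hm]; linarith
  -- `C₁` comes from Jensen's count of zeros, `C₂` bounds the logarithmic derivative of one Blaschke
  -- denominator, and `C₃` is the Borel–Carathéodory constant divided by A.
  set C₁ := 1 / Real.log (R / r₂) with hC₁
  set C₂ := r₂ / (R ^ 2 - r₂ * R) with hC₂
  set C₃ := 2 * m / (r₂ - m) / (m - r₁) with hC₃
  have hC₁p : 0 < C₁ := by positivity
  have hden : 0 < R ^ 2 - r₂ * R := by nlinarith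
  have hC₂p : 0 < C₂ := by positivity
  have hC₃p : 0 < C₃ := by
    have := sub_pos.2 hm1
    have := sub_pos.2 hm2
    positivity
  refine ⟨C₁ + C₁ * C₂ + C₃, by positivity, ?_⟩
  intro f c M Z hf hfc hM hfM hZ
  have hfc' : 0 < ‖f c‖ := norm_pos_iff.2 hfc
  have hMp : 0 < M := hfc'.trans hM
  set A := Real.log (M / ‖f c‖) with hA
  have hAp : 0 < A := Real.log_pos ((one_lt_div hfc').2 hM)
  have hcR : c ∈ Metric.closedBall c R := Metric.mem_closedBall_self hR.le
  have hsub : Metric.closedBall c r₂ ⊆ Metric.closedBall c R :=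
    Metric.closedBall_subset_closedBall h2R.le
  have hord : ∀ p ∈ Metric.closedBall c R, analyticOrderAt f p ≠ ⊤ := by
    intro p hp
    apply hf.analyticOrderAt_ne_top_of_isPreconnected (convex_closedBall c R).isPreconnected hcR hp
    rw [(hf c hcR).analyticOrderAt_eq_zero.2 hfc]
    simp
  set U : Set ℂ := {s | AnalyticAt ℂ f s} with hU
  have hUo : IsOpen U := isOpen_analyticAt ℂ f
  obtain ⟨h, hh, hfh, hhZ⟩ := exists_eq_prod_pow_mul hUo
    (fun s hs => (AnalyticAt.differentiableAt hs).differentiableWithinAt) Z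
    (fun p hp => hf p (hsub ((hZ p).1 hp).1)) (fun p hp => hord p (hsub ((hZ p).1 hp).1))
  set n : ℂ → ℕ := fun p => analyticOrderNatAt f p with hn
  set P : ℂ → ℂ := fun s => ∏ p ∈ Z, (s - p) ^ n p with hP
  -- On |s - c| = R this has the modulus of s - p, but it has no zero in the disc. Replacing each s
  -- - p by it turns `f` into `H`, zero-free on the disc of radius r₂ and still bounded by M by the
  -- maximum principle.
  set b : ℂ → ℂ → ℂ := fun p s => ((R : ℂ) ^ 2 - (starRingEnd ℂ) (p - c) * (s - c)) / R with hb
  set B : ℂ → ℂ := fun s => ∏ p ∈ Z, b p s ^ n p with hB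
  set H : ℂ → ℂ := fun s => h s * B s with hH
  have hRc : (R : ℂ) ≠ 0 := by exact_mod_cast hR.ne'
  have hZr : ∀ p ∈ Z, ‖p - c‖ ≤ r₂ := by
    intro p hp
    simpa [dist_eq_norm] using ((hZ p).1 hp).1
  have hnum : ∀ p ∈ Z, ∀ s ∈ Metric.closedBall c R,
      R ^ 2 - r₂ * R ≤ ‖(R : ℂ) ^ 2 - (starRingEnd ℂ) (p - c) * (s - c)‖ := by
    intro p hp s hs
    have hs' : ‖s - c‖ ≤ R := by simpa [dist_eq_norm] using hs
    have h1 := norm_sub_norm_le ((R : ℂ) ^ 2) ((starRingEnd ℂ) (p - c) * (s - c))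
    rw [norm_mul, Complex.norm_conj, norm_pow, Complex.norm_real, Real.norm_of_nonneg hR.le] at h1
    have h2 : ‖p - c‖ * ‖s - c‖ ≤ r₂ * R := mul_le_mul (hZr p hp) hs' (norm_nonneg _) hr₂.le
    linarith
  have hb0 : ∀ p ∈ Z, ∀ s ∈ Metric.closedBall c R, b p s ≠ 0 := by
    intro p hp s hs
    exact div_ne_zero (norm_pos_iff.1 (hden.trans_le (hnum p hp s hs))) hRc
  have hB0 : ∀ s ∈ Metric.closedBall c R, B s ≠ 0 := fun s hs =>
    Finset.prod_ne_zero_iff.2 fun p hp => pow_ne_zero _ (hb0 p hp s hs)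
  have hbd : ∀ p, Differentiable ℂ (b p) := by
    intro p; rw [hb]; fun_prop
  have hBd : Differentiable ℂ B := by
    rw [hB]
    exact Differentiable.fun_finsetProd fun p _ => (hbd p).fun_pow _
  have hHd : DifferentiableOn ℂ H U := hh.fun_mul hBd.differentiableOn
  have hfPh : ∀ s ∈ U, f s = P s * h s := hfh
  have hsphere : ∀ s ∈ Metric.sphere c R, ‖H s‖ ≤ M := by
    intro s hs
    have hs' : ‖s - c‖ = R := by simpa [dist_eq_norm] using hs
    have hsR := Metric.sphere_subset_closedBall hs
    have : ‖B s‖ = ‖P s‖ := by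
      simp only [hB, hP, norm_prod, norm_pow]
      refine Finset.prod_congr rfl fun p _ => ?_
      rw [hb]
      simp only [norm_div]
      rw [norm_sq_sub_conj_mul hs', Complex.norm_real, Real.norm_of_nonneg hR.le]
      congr 1
      field_simp
      congr 1
      ring
    rw [hH, norm_mul, this, mul_comm, ← norm_mul, ← hfPh s (hf s hsR)]
    exact hfM s hsR
  have hHM : ∀ s ∈ Metric.closedBall c R, ‖H s‖ ≤ M := by
    intro s hs
    apply Complex.norm_le_of_forall_mem_frontier_norm_le (Metric.isBounded_ball (x := c) (r := R))
    · apply DifferentiableOn.diffContOnCl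
      rw [closure_ball c hR.ne']
      exact hHd.mono hf
    · rw [frontier_ball c hR.ne']
      exact hsphere
    · rwa [closure_ball c hR.ne']
  have hprod : ∀ t : ℝ, ∏ p ∈ Z, t ^ n p = t ^ (∑ p ∈ Z, n p) := fun t =>
    Finset.prod_pow_eq_pow_sum _ _ _
  set N := ∑ p ∈ Z, n p with hN
  -- Jensen's inequality: at the centre each replaced factor gains at least R/r₂, so N zeros force
  -- log(M/|f(c)|) ≥ N log(R/r₂).
  have hHc : ‖f c‖ * (R / r₂) ^ N ≤ ‖H c‖ := by
    have h1 : ‖B c‖ = R ^ N := by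
      rw [← hprod, hB, norm_prod]
      refine Finset.prod_congr rfl fun p _ => ?_
      rw [norm_pow, hb]
      simp only [sub_self, mul_zero, sub_zero, norm_div, norm_pow, Complex.norm_real,
        Real.norm_of_nonneg hR.le]
      congr 1
      field_simp
    have h2 : ‖P c‖ ≤ r₂ ^ N := by
      rw [← hprod, hP, norm_prod]
      refine Finset.prod_le_prod (fun _ _ => norm_nonneg _) fun p hp => ?_
      rw [norm_pow, norm_sub_rev]
      exact pow_le_pow_left₀ (norm_nonneg _) (hZr p hp) _
    rw [hfPh c (hf c hcR), hH, norm_mul, norm_mul, h1, div_pow]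
    rw [mul_div_assoc', div_le_iff₀ (by positivity)]
    calc ‖P c‖ * ‖h c‖ * R ^ N ≤ r₂ ^ N * ‖h c‖ * R ^ N := by gcongr
      _ = _ := by ring
  have hNA : (N : ℝ) * Real.log (R / r₂) ≤ A := by
    rw [← Real.log_pow, hA]
    apply Real.log_le_log (by positivity)
    rw [le_div_iff₀ hfc', mul_comm]
    exact hHc.trans (hHM c hcR)
  have hNC : (N : ℝ) ≤ C₁ * A := by
    rw [hC₁, one_div, inv_mul_eq_div, le_div_iff₀ hlog]
    exact hNA
  have hNsum : (∑ p ∈ Z, (n p : ℝ)) = N := by rw [hN]; push_cast; rfl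
  have hHc0 : ‖f c‖ ≤ ‖H c‖ := by
    refine le_trans ?_ hHc
    exact le_mul_of_one_le_right hfc'.le (one_le_pow₀ ((one_lt_div hr₂).2 h2R).le)
  constructor
  · rw [hNsum]
    refine hNC.trans ?_
    rw [add_mul, add_mul]
    have : 0 ≤ C₁ * C₂ * A := by positivity
    have : 0 ≤ C₃ * A := by positivity
    linarith
  have hballU : Metric.ball c r₂ ⊆ Metric.closedBall c R := Metric.ball_subset_closedBall.trans hsub
  have hh0 : ∀ s ∈ Metric.closedBall c r₂, h s ≠ 0 := by
    intro s hs hs0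
    by_cases hsZ : s ∈ Z
    · exact hhZ s hsZ hs0
    · rw [hZ] at hsZ
      exact hsZ ⟨hs, by rw [hfPh s (hf s (hsub hs)), hs0, mul_zero]⟩
  have hkey := norm_logDeriv_le_of_ne_zero (H := H) h0 h12 hAp
    (hHd.mono (fun s hs => hf s (hballU hs)))
    (fun s hs => mul_ne_zero (hh0 s (Metric.ball_subset_closedBall hs)) (hB0 s (hballU hs))) (by
      intro s hs
      have h1 : 0 < ‖H s‖ := norm_pos_iff.2
        (mul_ne_zero (hh0 s (Metric.ball_subset_closedBall hs)) (hB0 s (hballU hs)))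
      have h2 : 0 < ‖H c‖ := hfc'.trans_le hHc0
      apply Real.log_le_log (by positivity)
      exact div_le_div₀ hMp.le (hHM s (hballU hs)) hfc' hHc0)
  intro s hs hs0
  have hs2 : s ∈ Metric.closedBall c r₂ := Metric.closedBall_subset_closedBall h12.le hs
  have hsR := hsub hs2
  have hsU : s ∈ U := hf s hsR
  have hP0 : P s ≠ 0 := fun h => hs0 (by rw [hfPh s hsU, h, zero_mul])
  have hPd : DifferentiableAt ℂ P s := by
    rw [hP]
    exact (Differentiable.fun_finsetProd fun p _ => by fun_prop) s
  have hhd : DifferentiableAt ℂ h s := hh.differentiableAt (hUo.mem_nhds hsU)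
  have e1 : logDeriv f s = logDeriv P s + logDeriv h s := by
    have : f =ᶠ[𝓝 s] fun z => P z * h z := by
      filter_upwards [hUo.mem_nhds hsU] with z hz using hfPh z hz
    rw [logDeriv_apply, this.deriv_eq, this.self_of_nhds, ← logDeriv_apply,
      logDeriv_mul s hP0 (hh0 s hs2) hPd hhd]
  have e2 : logDeriv H s = logDeriv h s + logDeriv B s :=
    logDeriv_mul s (hh0 s hs2) (hB0 s hsR) hhd (hBd s)
  have e3 : logDeriv P s = ∑ p ∈ Z, n p * (s - p)⁻¹ := by
    have hsp : ∀ p ∈ Z, s - p ≠ 0 := by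
      intro p hp h
      rw [sub_eq_zero] at h
      exact hs0 (h ▸ ((hZ p).1 hp).2)
    rw [hP, logDeriv_prod]
    · refine Finset.sum_congr rfl fun p _ => ?_
      rw [logDeriv_fun_pow (by fun_prop)]
      simp [logDeriv_apply]
    · exact fun p hp => pow_ne_zero _ (hsp p hp)
    · intro p _; fun_prop
  have e4 : logDeriv B s = ∑ p ∈ Z, n p * logDeriv (b p) s := by
    rw [hB, logDeriv_prod]
    · refine Finset.sum_congr rfl fun p _ => ?_
      rw [logDeriv_fun_pow (hbd p s)]
    · exact fun p hp => pow_ne_zero _ (hb0 p hp s hsR)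
    · intro p _; exact ((hbd p).fun_pow _) s
  have e5 : ∀ p ∈ Z, ‖logDeriv (b p) s‖ ≤ C₂ := by
    intro p hp
    have h1 : deriv (b p) s = -(starRingEnd ℂ) (p - c) / R := by
      rw [hb]
      simp
    rw [logDeriv_apply, h1, hb]
    simp only [div_div_div_cancel_right₀ hRc]
    rw [norm_div, norm_neg, Complex.norm_conj]
    exact div_le_div₀ hr₂.le (hZr p hp) hden (hnum p hp s hsR)
  have e6 : ‖logDeriv B s‖ ≤ C₁ * C₂ * A := by
    rw [e4]
    calc _ ≤ ∑ p ∈ Z, ‖(n p : ℂ) * logDeriv (b p) s‖ := norm_sum_le _ _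
      _ ≤ ∑ p ∈ Z, (n p : ℝ) * C₂ := by
        refine Finset.sum_le_sum fun p hp => ?_
        rw [norm_mul, Complex.norm_natCast]
        exact mul_le_mul_of_nonneg_left (e5 p hp) (Nat.cast_nonneg _)
      _ = N * C₂ := by rw [← Finset.sum_mul, hNsum]
      _ ≤ C₁ * A * C₂ := by gcongr
      _ = _ := by ring
  have e7 : ‖logDeriv H s‖ ≤ C₃ * A := by
    refine (hkey s hs).trans (le_of_eq ?_)
    rw [hC₃]
    ring
  have e8 : logDeriv f s - ∑ p ∈ Z, n p * (s - p)⁻¹ = logDeriv H s - logDeriv B s := by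
    rw [e1, e2, e3]; ring
  rw [e8]
  calc _ ≤ ‖logDeriv H s‖ + ‖logDeriv B s‖ := norm_sub_le _ _
    _ ≤ C₃ * A + C₁ * C₂ * A := add_le_add e7 e6
    _ ≤ _ := by
      have : 0 ≤ C₁ * A := by positivity
      linarith

/-! ### Growth of ζ by Euler–Maclaurin summation, and its zeros at a given height. -/

/-- The error in the trapezoidal rule for `u ↦ u ^ (-s)` on `[n, n + 1]`. -/
noncomputable def zetaTrapezoidError (s : ℂ) (n : ℕ) : ℂ :=
  ((n : ℂ) ^ (-s) + ((n + 1 : ℕ) : ℂ) ^ (-s)) / 2 -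
    (((n + 1 : ℕ) : ℂ) ^ (1 - s) - (n : ℂ) ^ (1 - s)) / (1 - s)

/-- Twice the error is the integral over [n, n+1] of (u - n)(n + 1 - u) times the second derivative
of u^(-s), and the weight is at most 1. The decay n^(-Re s - 2) is summable for Re s > -1, which
carries ζ past the critical strip. -/
theorem norm_zetaTrapezoidError_le {s : ℂ} (hs : -2 < s.re) (hs1 : s ≠ 1) {n : ℕ} (hn : 0 < n) :
    ‖zetaTrapezoidError s n‖ ≤ ‖s‖ * ‖s + 1‖ * (n : ℝ) ^ (-s.re - 2) := by
  have h1s : 1 - s ≠ 0 := sub_ne_zero.2 hs1.symm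
  have hn' : (0 : ℝ) < n := by exact_mod_cast hn
  -- With w = (u - n)(n + 1 - u) and φ = u^(-s), two integrations by parts and w'' = -2 give the
  -- antiderivative wφ' - w'φ - 2∫φ of wφ''.
  set G : ℝ → ℂ := fun u => ((u - n) * (n + 1 - u) : ℂ) * (-s * (u : ℂ) ^ (-s - 1)) -
    (2 * n + 1 - 2 * u : ℂ) * (u : ℂ) ^ (-s) - 2 * ((u : ℂ) ^ (1 - s) / (1 - s)) with hG
  have hder : ∀ u : ℝ, 0 < u → HasDerivAt G
      (((u - n) * (n + 1 - u) : ℂ) * (s * (s + 1) * (u : ℂ) ^ (-s - 2))) u := by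
    intro u hu
    have hid : HasDerivAt (fun u : ℝ => (u : ℂ)) 1 u := Complex.ofRealCLM.hasDerivAt
    have hpow : ∀ a : ℂ, HasDerivAt (fun u : ℝ => (u : ℂ) ^ a) (a * (u : ℂ) ^ (a - 1)) u := by
      intro a
      have := ((hasDerivAt_id (u : ℂ)).cpow_const (c := a)
        (Complex.ofReal_mem_slitPlane.2 hu)).comp_ofReal
      simpa using this
    have h1 := ((hid.sub_const (n : ℂ)).fun_mul (hid.const_sub ((n : ℂ) + 1))).fun_mul
      ((hpow (-s - 1)).const_mul (-s))
    have h2 := ((hid.const_mul 2).const_sub ((2 * n + 1 : ℂ))).fun_mul (hpow (-s))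
    have h3 := ((hpow (1 - s)).div_const (1 - s)).const_mul 2
    refine ((h1.fun_sub h2).fun_sub h3).congr_deriv ?_
    rw [show (-s - 1 - 1) = -s - 2 by ring, show (1 - s - 1) = -s by ring]
    field_simp
    ring
  have hval : G (n + 1 : ℕ) - G n = 2 * zetaTrapezoidError s n := by
    simp only [hG, zetaTrapezoidError, Complex.ofReal_natCast]
    push_cast
    ring
  have h := norm_image_sub_le_of_norm_deriv_le_segment' (f := G) (a := n) (b := (n + 1 : ℕ))
    (C := ‖s‖ * ‖s + 1‖ * (n : ℝ) ^ (-s.re - 2))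
    (fun u hu => (hder u (hn'.trans_le hu.1)).hasDerivWithinAt) (by
      intro u hu
      have hu0 : 0 < u := hn'.trans_le hu.1
      have hu1 : u < n + 1 := by exact_mod_cast hu.2
      have hw : ‖((u - n) * (n + 1 - u) : ℂ)‖ ≤ 1 := by
        have : ((u - n) * (n + 1 - u) : ℂ) = (((u - n) * (n + 1 - u) : ℝ) : ℂ) := by push_cast; ring
        rw [this, Complex.norm_real, Real.norm_eq_abs, abs_le]
        constructor <;> nlinarith [hu.1]
      rw [norm_mul, norm_mul (s * (s + 1)), norm_mul s, Complex.norm_cpow_eq_rpow_re_of_pos hu0]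
      have hp : u ^ (-s - 2).re ≤ (n : ℝ) ^ (-s.re - 2) := by
        have : (-s - 2).re = -s.re - 2 := by simp
        rw [this]
        exact Real.rpow_le_rpow_of_nonpos hn' hu.1 (by linarith)
      calc _ ≤ 1 * (‖s‖ * ‖s + 1‖ * u ^ (-s - 2).re) := by gcongr
        _ ≤ _ := by rw [one_mul]; gcongr)
    (n + 1 : ℕ) (by simp)
  rw [hval, norm_mul] at h
  have h2 : (((n + 1 : ℕ) : ℝ) - n) = 1 := by push_cast; ring
  rw [h2, mul_one] at h
  have : ‖(2 : ℂ)‖ = 2 := by simp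
  rw [this] at h
  linarith [norm_nonneg (zetaTrapezoidError s n)]

/-- The two endpoint series are ζ(s) and ζ(s) - 1, and the integral terms telescope, with n^(1-s) →
0. -/
theorem tsum_zetaTrapezoidError_of_one_lt {s : ℂ} (hs : 1 < s.re)
    (hsum : Summable fun n : ℕ => zetaTrapezoidError s (n + 1)) :
    ∑' n : ℕ, zetaTrapezoidError s (n + 1) = riemannZeta s - 1 / 2 - 1 / (s - 1) := by
  have hs1 : s ≠ 1 := by rintro rfl; simp at hs
  have h1s : 1 - s ≠ 0 := sub_ne_zero.2 hs1.symm
  have hz : HasSum (fun n : ℕ => ((n + 1 : ℕ) : ℂ) ^ (-s)) (riemannZeta s) := by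
    have h := LSeriesHasSum_one hs
    rw [LSeriesHasSum, ← hasSum_nat_add_iff' 1] at h
    simp only [Finset.range_one, Finset.sum_singleton, LSeries.term_zero, sub_zero] at h
    refine h.congr_fun ?_
    intro n
    rw [LSeries.term_of_ne_zero (by omega), Complex.cpow_neg]
    simp
  have hz1 : HasSum (fun n : ℕ => ((n + 1 + 1 : ℕ) : ℂ) ^ (-s)) (riemannZeta s - 1) := by
    have := (hasSum_nat_add_iff' 1).2 hz
    simpa using this
  have hlim : Tendsto (fun N : ℕ => ((N + 1 : ℕ) : ℂ) ^ (1 - s)) atTop (𝓝 0) := by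
    rw [tendsto_zero_iff_norm_tendsto_zero]
    have h1 : ∀ N : ℕ, ‖((N + 1 : ℕ) : ℂ) ^ (1 - s)‖ = ((N + 1 : ℕ) : ℝ) ^ (-(s.re - 1)) := by
      intro N
      rw [Complex.norm_natCast_cpow_of_pos (by omega)]
      simp
    simp_rw [h1]
    exact ((tendsto_rpow_neg_atTop (by linarith)).comp tendsto_natCast_atTop_atTop).comp
      (tendsto_add_atTop_nat 1)
  have hpart : ∀ N : ℕ, ∑ n ∈ Finset.range N, zetaTrapezoidError s (n + 1) =
      (∑ n ∈ Finset.range N, ((n + 1 : ℕ) : ℂ) ^ (-s) +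
        ∑ n ∈ Finset.range N, ((n + 1 + 1 : ℕ) : ℂ) ^ (-s)) / 2 -
      (((N + 1 : ℕ) : ℂ) ^ (1 - s) - 1) / (1 - s) := by
    intro N
    have htel := Finset.sum_range_sub (fun n : ℕ => ((n + 1 : ℕ) : ℂ) ^ (1 - s)) N
    simp only [zero_add, Nat.cast_one, Complex.one_cpow] at htel
    simp only [zetaTrapezoidError]
    rw [Finset.sum_sub_distrib, ← Finset.sum_div, ← Finset.sum_div, Finset.sum_add_distrib, htel]
  have h1 := hsum.hasSum.tendsto_sum_nat
  simp_rw [hpart] at h1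
  have h2 := ((hz.tendsto_sum_nat.add hz1.tendsto_sum_nat).div_const 2).sub
    ((hlim.sub_const 1).div_const (1 - s))
  rw [tendsto_nhds_unique h1 h2]
  rw [show s - 1 = -(1 - s) by ring]
  field_simp
  ring

theorem summable_nat_succ_rpow : Summable fun n : ℕ => ((n + 1 : ℕ) : ℝ) ^ (-(9 / 8) : ℝ) :=
  (summable_nat_add_iff 1).2 (Real.summable_nat_rpow.2 (by norm_num))

theorem norm_zetaTrapezoidError_succ_le {s : ℂ} (hs : -(7 / 8) ≤ s.re) (hs1 : s ≠ 1) (n : ℕ) :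
    ‖zetaTrapezoidError s (n + 1)‖ ≤ ‖s‖ * ‖s + 1‖ * ((n + 1 : ℕ) : ℝ) ^ (-(9 / 8) : ℝ) := by
  refine (norm_zetaTrapezoidError_le (by linarith) hs1 n.succ_pos).trans ?_
  gcongr
  · simp
  · linarith

/-- Identity theorem from Re s > 1. The upper half-plane keeps the domain convex while avoiding the
pole, and intersecting with a ball makes the majorant of the series uniform. -/
theorem riemannZeta_eq_tsum_zetaTrapezoidError {s : ℂ} (hs : -(7 / 8) < s.re) (him : 0 < s.im) :
    riemannZeta s = 1 / 2 + 1 / (s - 1) + ∑' n : ℕ, zetaTrapezoidError s (n + 1) := by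
  set B : ℝ := ‖s‖ + 4 with hB
  set U : Set ℂ := ({z : ℂ | -(7 / 8) < z.re} ∩ {z : ℂ | 0 < z.im}) ∩ Metric.ball 0 B with hU
  have hUo : IsOpen U := ((isOpen_lt continuous_const Complex.continuous_re).inter
    (isOpen_lt continuous_const Complex.continuous_im)).inter Metric.isOpen_ball
  have hUc : Convex ℝ U := ((convex_halfSpace_re_gt _).inter (convex_halfSpace_im_gt _)).inter
    (convex_ball _ _)
  have hne : ∀ z ∈ U, z ≠ 1 := by
    rintro z hz rfl
    have : (0 : ℝ) < (1 : ℂ).im := hz.1.2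
    simp at this
  have hbound : ∀ n : ℕ, ∀ z ∈ U, ‖zetaTrapezoidError z (n + 1)‖ ≤
      B * (B + 1) * ((n + 1 : ℕ) : ℝ) ^ (-(9 / 8) : ℝ) := by
    intro n z hz
    have hzB : ‖z‖ ≤ B := by simpa using (Metric.mem_ball.1 hz.2).le
    refine (norm_zetaTrapezoidError_succ_le hz.1.1.le (hne z hz) n).trans ?_
    have : ‖z + 1‖ ≤ B + 1 := (norm_add_le z 1).trans (by simpa using hzB)
    gcongr
  have hdiff : DifferentiableOn ℂ (fun z => ∑' n : ℕ, zetaTrapezoidError z (n + 1)) U := by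
    refine Complex.differentiableOn_tsum_of_summable_norm
      (summable_nat_succ_rpow.mul_left (B * (B + 1))) ?_ hUo hbound
    intro n z hz
    have h1 : ((n + 1 : ℕ) : ℂ) ≠ 0 := by exact_mod_cast n.succ_ne_zero
    have h2 : ((n + 1 + 1 : ℕ) : ℂ) ≠ 0 := by exact_mod_cast (n + 1).succ_ne_zero
    have h3 : 1 - z ≠ 0 := sub_ne_zero.2 (hne z hz).symm
    have hp : ∀ a : ℂ, a ≠ 0 → ∀ g : ℂ → ℂ, DifferentiableAt ℂ g z →
        DifferentiableAt ℂ (fun w => a ^ g w) z := fun a ha g hg => hg.const_cpow (Or.inl ha)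
    unfold zetaTrapezoidError
    exact ((((hp _ h1 _ (by fun_prop)).fun_add (hp _ h2 _ (by fun_prop))).div_const 2).fun_sub
      (((hp _ h2 _ (by fun_prop)).fun_sub (hp _ h1 _ (by fun_prop))).fun_div (by fun_prop)
        h3)).differentiableWithinAt
  have hz0 : (2 + Complex.I) ∈ U := by
    refine ⟨⟨?_, ?_⟩, ?_⟩
    · simp only [Set.mem_ofPred_eq]; norm_num
    · simp
    · rw [mem_ball_zero_iff, hB]
      have := norm_add_le (2 : ℂ) Complex.I
      simp at this
      linarith [norm_nonneg s]
  have heq : Set.EqOn riemannZeta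
      (fun z => 1 / 2 + 1 / (z - 1) + ∑' n : ℕ, zetaTrapezoidError z (n + 1)) U := by
    refine AnalyticOnNhd.eqOn_of_preconnected_of_eventuallyEq (𝕜 := ℂ) (z₀ := 2 + Complex.I)
      ?_ ?_ hUc.isPreconnected hz0 ?_
    · exact DifferentiableOn.analyticOnNhd (fun z hz =>
        (differentiableAt_riemannZeta (hne z hz)).differentiableWithinAt) hUo
    · refine DifferentiableOn.analyticOnNhd (DifferentiableOn.fun_add ?_ hdiff) hUo
      intro z hz
      have h3 : z - 1 ≠ 0 := sub_ne_zero.2 (hne z hz)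
      apply DifferentiableAt.differentiableWithinAt
      fun_prop (disch := assumption)
    · have h1 : ∀ᶠ z : ℂ in 𝓝 (2 + Complex.I), 1 < z.re := by
        apply (isOpen_lt continuous_const Complex.continuous_re).mem_nhds
        simp only [Set.mem_ofPred_eq]
        norm_num
      filter_upwards [h1, hUo.mem_nhds hz0] with z hz hzU
      rw [tsum_zetaTrapezoidError_of_one_lt hz]
      · ring
      · exact Summable.of_norm_bounded (summable_nat_succ_rpow.mul_left (B * (B + 1)))
          fun n => hbound n z hzU
  exact heq ⟨⟨hs, him⟩, by rw [mem_ball_zero_iff, hB]; linarith⟩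

theorem exists_norm_riemannZeta_le : ∃ C : ℝ, 0 < C ∧ ∀ s : ℂ, -(3 / 4) ≤ s.re → 1 ≤ |s.im| →
    ‖riemannZeta s‖ ≤ C * ‖s‖ ^ 2 := by
  set D := ∑' n : ℕ, ((n + 1 : ℕ) : ℝ) ^ (-(9 / 8) : ℝ) with hD
  have hD0 : 0 ≤ D := tsum_nonneg fun n => by positivity
  have key : ∀ s : ℂ, -(3 / 4) ≤ s.re → 1 ≤ s.im → ‖riemannZeta s‖ ≤ (2 + 2 * D) * ‖s‖ ^ 2 := by
    intro s hs him
    have hs1 : s ≠ 1 := by rintro rfl; norm_num at him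
    have hn1 : 1 ≤ ‖s‖ := him.trans ((le_abs_self _).trans (Complex.abs_im_le_norm s))
    have hn2 : 1 ≤ ‖s - 1‖ := by
      refine le_trans ?_ (Complex.abs_im_le_norm (s - 1))
      simpa using him.trans (le_abs_self _)
    have hn3 : ‖s + 1‖ ≤ 2 * ‖s‖ := by
      have := norm_add_le s 1
      simp at this
      linarith
    rw [riemannZeta_eq_tsum_zetaTrapezoidError (by linarith) (by linarith)]
    have hb := fun n => norm_zetaTrapezoidError_succ_le (s := s) (by linarith) hs1 n
    have h3 : ‖∑' n : ℕ, zetaTrapezoidError s (n + 1)‖ ≤ ‖s‖ * ‖s + 1‖ * D := by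
      rw [hD, ← tsum_mul_left]
      exact tsum_of_norm_bounded (summable_nat_succ_rpow.mul_left _).hasSum hb
    have h4 : ‖1 / (s - 1)‖ ≤ 1 := by
      rw [norm_div, norm_one]
      exact (div_le_one (by linarith)).2 hn2
    have h5 : ‖(1 / 2 : ℂ)‖ ≤ 1 := by norm_num
    calc _ ≤ ‖(1 / 2 : ℂ)‖ + ‖1 / (s - 1)‖ + ‖∑' n : ℕ, zetaTrapezoidError s (n + 1)‖ :=
          norm_add₃_le
      _ ≤ 1 + 1 + ‖s‖ * (2 * ‖s‖) * D := by
        have : ‖s‖ * ‖s + 1‖ * D ≤ ‖s‖ * (2 * ‖s‖) * D := by gcongr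
        linarith
      _ ≤ _ := by nlinarith [one_le_pow₀ hn1 (n := 2)]
  refine ⟨2 + 2 * D, by linarith, ?_⟩
  intro s hs him
  rcases le_total 0 s.im with h | h
  · exact key s hs (by rwa [abs_of_nonneg h] at him)
  · have := key ((starRingEnd ℂ) s) (by simpa using hs)
      (by rw [abs_of_nonpos h] at him; simpa using him)
    rwa [riemannZeta_conj, Complex.norm_conj, Complex.norm_conj] at this

/-- On this line |ζ(s) - 1| ≤ ζ(2) - 1 < 1, since π² < 12. It supplies the lower bound at the centre
of the discs. -/
theorem exists_le_norm_riemannZeta : ∃ c : ℝ, 0 < c ∧ ∀ s : ℂ, s.re = 2 → c ≤ ‖riemannZeta s‖ := by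
  refine ⟨2 - Real.pi ^ 2 / 6, ?_, ?_⟩
  · nlinarith [Real.pi_lt_d2, Real.pi_pos]
  intro s hs
  have h2 : HasSum (fun n : ℕ => 1 / ((n + 2 : ℕ) : ℝ) ^ 2) (Real.pi ^ 2 / 6 - 1) := by
    have := (hasSum_nat_add_iff' 2).2 hasSum_zeta_two
    simpa [Finset.sum_range_succ] using this
  have h3 : HasSum (fun n : ℕ => ((n + 2 : ℕ) : ℂ) ^ (-s)) (riemannZeta s - 1) := by
    have h := LSeriesHasSum_one (s := s) (by rw [hs]; norm_num)
    rw [LSeriesHasSum, ← hasSum_nat_add_iff' 2] at h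
    simp only [Finset.sum_range_succ, Finset.range_zero, Finset.sum_empty, LSeries.term_zero,
      zero_add] at h
    rw [LSeries.term_of_ne_zero one_ne_zero] at h
    simp only [Pi.one_apply, Nat.cast_one, Complex.one_cpow, div_one] at h
    refine h.congr_fun ?_
    intro n
    rw [LSeries.term_of_ne_zero (by omega), Complex.cpow_neg]
    simp
  have h4 : ‖riemannZeta s - 1‖ ≤ Real.pi ^ 2 / 6 - 1 := by
    rw [← h3.tsum_eq]
    refine tsum_of_norm_bounded h2 fun n => ?_
    rw [Complex.norm_natCast_cpow_of_pos (by omega), Complex.neg_re, hs, Real.rpow_neg (by positivity)]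
    simp
  have h5 := norm_sub_norm_le (1 : ℂ) (1 - riemannZeta s)
  rw [sub_sub_cancel, norm_one, norm_sub_rev] at h5
  linarith

/-- The zeros of `ζ` near `2 + it` number `O(log t)`, and they govern `ζ'/ζ` up to `O(log t)`. -/
theorem exists_riemannZeta_local_bound : ∃ C : ℝ, 0 < C ∧ ∀ (t : ℝ) (Z : Finset ℂ), 4 ≤ |t| →
    (∀ p, p ∈ Z ↔ p ∈ Metric.closedBall (2 + t * Complex.I) (21 / 8) ∧ riemannZeta p = 0) →
    (∑ p ∈ Z, (analyticOrderNatAt riemannZeta p : ℝ)) ≤ C * Real.log |t| ∧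
    ∀ s ∈ Metric.closedBall (2 + t * Complex.I : ℂ) (5 / 2), riemannZeta s ≠ 0 →
      ‖logDeriv riemannZeta s - ∑ p ∈ Z, analyticOrderNatAt riemannZeta p * (s - p)⁻¹‖ ≤
        C * Real.log |t| := by
  -- Around 2 + it, radius 5/2 reaches Re s = -1/2, beyond the critical strip, and radius 11/4 stays
  -- within Re s ≥ -3/4, where ζ has quadratic growth. As |t| ≥ 4, the discs avoid the pole.
  obtain ⟨C, hC, hloc⟩ := exists_local_logDeriv_bound (r₁ := 5 / 2) (r₂ := 21 / 8) (R := 11 / 4)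
    (by norm_num) (by norm_num) (by norm_num)
  obtain ⟨C₀, hC₀, hup⟩ := exists_norm_riemannZeta_le
  obtain ⟨c₀, hc₀, hlow⟩ := exists_le_norm_riemannZeta
  refine ⟨C * (|Real.log (16 * C₀ / c₀)| + 2), by positivity, ?_⟩
  intro t Z ht hZ
  have ht0 : 0 < |t| := by linarith
  set c : ℂ := 2 + t * Complex.I with hc
  have him : ∀ s ∈ Metric.closedBall c (11 / 4), 1 ≤ |s.im| := by
    intro s hs
    have h1 : ‖c - s‖ ≤ 11 / 4 := by rw [norm_sub_rev, ← dist_eq_norm]; exact hs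
    have h2 := (Complex.abs_im_le_norm (c - s)).trans h1
    have h3 : (c - s).im = t - s.im := by simp [hc]
    rw [h3] at h2
    have := abs_sub_abs_le_abs_sub t s.im
    linarith
  have hre : ∀ s ∈ Metric.closedBall c (11 / 4), -(3 / 4) ≤ s.re := by
    intro s hs
    have h1 : ‖c - s‖ ≤ 11 / 4 := by rw [norm_sub_rev, ← dist_eq_norm]; exact hs
    have h2 := (Complex.abs_re_le_norm (c - s)).trans h1
    have h3 : (c - s).re = 2 - s.re := by simp [hc]
    rw [h3] at h2
    linarith [(abs_le.1 h2).2]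
  have hnorm : ∀ s ∈ Metric.closedBall c (11 / 4), ‖s‖ ≤ 3 * |t| := by
    intro s hs
    have h1 : ‖s - c‖ ≤ 11 / 4 := by rw [← dist_eq_norm]; exact hs
    have h2 := norm_add_le (s - c) c
    have h3 : ‖c‖ ≤ 2 + |t| := by
      have := norm_add_le (2 : ℂ) (t * Complex.I)
      simpa [hc] using this
    rw [sub_add_cancel] at h2
    linarith
  have hle : ∀ s ∈ Metric.closedBall c (11 / 4), ‖riemannZeta s‖ ≤ 9 * C₀ * |t| ^ 2 := by
    intro s hs
    refine (hup s (hre s hs) (him s hs)).trans ?_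
    have := pow_le_pow_left₀ (norm_nonneg _) (hnorm s hs) 2
    nlinarith
  have hcm : c ∈ Metric.closedBall c (11 / 4) := Metric.mem_closedBall_self (by norm_num)
  have hcl : c₀ ≤ ‖riemannZeta c‖ := hlow c (by simp [hc])
  have hcp : 0 < ‖riemannZeta c‖ := hc₀.trans_le hcl
  have hlog1 : 1 ≤ Real.log |t| := by
    rw [Real.le_log_iff_exp_le ht0]
    linarith [Real.exp_one_lt_d9]
  have hlog : Real.log (16 * C₀ * |t| ^ 2 / ‖riemannZeta c‖) ≤
      (|Real.log (16 * C₀ / c₀)| + 2) * Real.log |t| := by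
    calc _ ≤ Real.log (16 * C₀ / c₀ * |t| ^ 2) := by
          apply Real.log_le_log (by positivity)
          rw [div_mul_eq_mul_div]
          gcongr
      _ = Real.log (16 * C₀ / c₀) + 2 * Real.log |t| := by
          rw [Real.log_mul (by positivity) (by positivity), Real.log_pow]
          norm_num
      _ ≤ |Real.log (16 * C₀ / c₀)| * Real.log |t| + 2 * Real.log |t| := by
          gcongr
          exact (le_abs_self _).trans (le_mul_of_one_le_right (abs_nonneg _) hlog1)
      _ = _ := by ring
  -- The growth bound gives 9 C₀ |t|²; the larger 16 makes the inequality at the centre strict.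
  obtain ⟨h1, h2⟩ := hloc riemannZeta c (16 * C₀ * |t| ^ 2) Z (by
      intro s hs
      have hs1 : s ≠ 1 := by
        rintro rfl
        have := him 1 hs
        norm_num at this
      exact analyticOn_riemannZeta s hs1) (norm_pos_iff.1 hcp) (by
      refine (hle c hcm).trans_lt ?_
      have : 0 < C₀ * |t| ^ 2 := by positivity
      linarith) (fun s hs => (hle s hs).trans (by
        have : 0 < C₀ * |t| ^ 2 := by positivity
        linarith)) hZ
  refine ⟨h1.trans ?_, fun s hs hs0 => (h2 s hs hs0).trans ?_⟩ <;>
  · simpa only [mul_assoc] using mul_le_mul_of_nonneg_left hlog hC.le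

/-! ### Growth of ζ'/ζ left of the strip: digamma, tangent and the functional equation. -/

theorem norm_exp_sub_one_le_of_re_nonpos {z : ℂ} (hz : z.re ≤ 0) : ‖Complex.exp z - 1‖ ≤ ‖z‖ := by
  have := (convex_halfSpace_re_le (0 : ℝ)).norm_image_sub_le_of_norm_hasDerivWithin_le
    (f := Complex.exp) (f' := Complex.exp) (C := 1) (x := 0) (y := z)
    (fun w _ => (Complex.hasDerivAt_exp w).hasDerivWithinAt)
    (fun w hw => by
      rw [Complex.norm_exp]
      exact Real.exp_le_one_iff.2 hw) (by simp) hz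
  simpa using this

/-- With z = s log u, |e^z - 1| is at most both 2 and |z|, hence at most √(2|z|), and |log u| ≤ (1 -
u)/u. The half power of 1 - u makes the singularity (1 - u)⁻¹ of the beta integral integrable. -/
theorem norm_ofReal_cpow_sub_one_le {s : ℂ} (hs : 0 ≤ s.re) {u : ℝ} (h0 : 0 < u) (h1 : u ≤ 1) :
    ‖(u : ℂ) ^ s - 1‖ ≤ √(2 * ‖s‖) * (u ^ (-(1 / 2) : ℝ) * (1 - u) ^ (1 / 2 : ℝ)) := by
  have hlog : Real.log u ≤ 0 := Real.log_nonpos h0.le h1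
  have hu : (u : ℂ) ≠ 0 := by exact_mod_cast h0.ne'
  rw [Complex.cpow_def_of_ne_zero hu, ← Complex.ofReal_log h0.le]
  set z : ℂ := (Real.log u : ℂ) * s with hz
  have hre : z.re ≤ 0 := by
    rw [hz, Complex.re_ofReal_mul]
    exact mul_nonpos_of_nonpos_of_nonneg hlog hs
  have b1 := norm_exp_sub_one_le_of_re_nonpos hre
  have b2 : ‖Complex.exp z - 1‖ ≤ 2 := by
    refine (norm_sub_le _ _).trans ?_
    rw [Complex.norm_exp, norm_one]
    linarith [Real.exp_le_one_iff.2 hre]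
  have b3 : ‖z‖ ≤ ‖s‖ * ((1 - u) / u) := by
    rw [hz, norm_mul, Complex.norm_real, Real.norm_of_nonpos hlog, mul_comm]
    gcongr
    have := Real.one_sub_inv_le_log_of_pos h0
    rw [sub_div, div_self h0.ne', one_div]
    linarith
  have b4 : u ^ (-(1 / 2) : ℝ) * (1 - u) ^ (1 / 2 : ℝ) = √((1 - u) / u) := by
    rw [Real.rpow_neg h0.le, ← Real.sqrt_eq_rpow, ← Real.sqrt_eq_rpow,
      Real.sqrt_div' _ h0.le, inv_mul_eq_div]
  rw [b4, ← Real.sqrt_mul (by positivity)]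
  apply Real.le_sqrt_of_sq_le
  calc _ = ‖Complex.exp z - 1‖ * ‖Complex.exp z - 1‖ := sq _
    _ ≤ 2 * ‖z‖ := by gcongr
    _ ≤ 2 * (‖s‖ * ((1 - u) / u)) := by gcongr
    _ = _ := by ring

theorem ne_neg_natCast_of_re_pos {s : ℂ} (hs : 0 < s.re) (m : ℕ) : s ≠ -m := by
  rintro rfl
  simp at hs
  linarith [Nat.cast_nonneg (α := ℝ) m]

/-- B(w, ε) = Γ(ε)Γ(w)/Γ(w + ε), so B(s, ε) - B(1, ε) tends to -(digamma s - digamma 1) as ε → 0⁺,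
while the beta integrals are bounded uniformly in ε. A square-root bound suffices, because the
Perron integrand carries a factor 1/s. -/
theorem exists_norm_digamma_sub_le : ∃ C : ℝ, 0 ≤ C ∧ ∀ s : ℂ, 1 ≤ s.re →
    ‖Complex.digamma s - Complex.digamma 1‖ ≤ C * √(2 * ‖s - 1‖) := by
  set K : ℝ → ℝ := fun u => ‖(u : ℂ) ^ ((1 / 2 : ℂ) - 1) * (1 - u : ℂ) ^ ((1 / 2 : ℂ) - 1)‖ with hK
  have hKi : IntervalIntegrable K MeasureTheory.volume 0 1 :=
    (Complex.betaIntegral_convergent (u := 1 / 2) (v := 1 / 2) (by norm_num) (by norm_num)).norm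
  have hKval : ∀ u : ℝ, 0 < u → u < 1 → K u = u ^ (-(1 / 2) : ℝ) * (1 - u) ^ (-(1 / 2) : ℝ) := by
    intro u h0 h1
    have e : (1 - u : ℂ) = ((1 - u : ℝ) : ℂ) := by push_cast; ring
    simp only [hK]
    rw [norm_mul, Complex.norm_cpow_eq_rpow_re_of_pos h0, e,
      Complex.norm_cpow_eq_rpow_re_of_pos (sub_pos.2 h1)]
    norm_num
  refine ⟨∫ u in (0 : ℝ)..1, K u, ?_, ?_⟩
  · exact intervalIntegral.integral_nonneg zero_le_one fun u _ => norm_nonneg _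
  intro s hs
  have hs0 : 0 < s.re := by linarith
  have hbeta : ∀ ε : ℝ, 0 < ε → ‖Complex.betaIntegral s ε - Complex.betaIntegral 1 ε‖ ≤
      (∫ u in (0 : ℝ)..1, K u) * √(2 * ‖s - 1‖) := by
    intro ε hε
    unfold Complex.betaIntegral
    rw [← intervalIntegral.integral_sub
      (Complex.betaIntegral_convergent hs0 (by simpa using hε))
      (Complex.betaIntegral_convergent (by simp) (by simpa using hε)), mul_comm,
      ← intervalIntegral.integral_const_mul]
    refine intervalIntegral.norm_integral_le_of_norm_le zero_le_one
      (Eventually.of_forall fun u hu => ?_) (hKi.const_mul _)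
    have hKn : 0 ≤ √(2 * ‖s - 1‖) * K u := mul_nonneg (Real.sqrt_nonneg _) (norm_nonneg _)
    rcases hu.2.eq_or_lt with h1 | h1
    · exact le_trans (le_of_eq (by simp [h1])) hKn
    have e : (1 - u : ℂ) = ((1 - u : ℝ) : ℂ) := by push_cast; ring
    have hu1 : 0 < 1 - u := sub_pos.2 h1
    rw [sub_self, Complex.cpow_zero, ← sub_mul, norm_mul, e,
      Complex.norm_cpow_eq_rpow_re_of_pos hu1, hKval u hu.1 h1]
    -- This removes the dependence on ε; multiplied by (1 - u)^(1/2) it leaves the integrable kernel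
    -- `K`.
    have h2 : (1 - u) ^ ((ε : ℂ) - 1).re ≤ (1 - u) ^ (-1 : ℝ) := by
      apply Real.rpow_le_rpow_of_exponent_ge hu1 (by linarith [hu.1])
      simp [hε.le]
    calc _ ≤ √(2 * ‖s - 1‖) * (u ^ (-(1 / 2) : ℝ) * (1 - u) ^ (1 / 2 : ℝ)) *
          (1 - u) ^ (-1 : ℝ) :=
          mul_le_mul (norm_ofReal_cpow_sub_one_le (by simpa using hs) hu.1 hu.2) h2
            (by positivity) (by have := hu.1; positivity)
      _ = √(2 * ‖s - 1‖) * (u ^ (-(1 / 2) : ℝ) * ((1 - u) ^ (1 / 2 : ℝ) * (1 - u) ^ (-1 : ℝ))) := by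
          ring
      _ = _ := by
          rw [← Real.rpow_add hu1]
          norm_num
  set q : ℂ → ℝ → ℂ := fun w ε => Complex.Gamma w / Complex.Gamma (w + ε) with hq
  have hqd : ∀ w : ℂ, 0 < w.re → HasDerivAt (q w) (-Complex.digamma w) 0 := by
    intro w hw
    have hw0 := Complex.Gamma_ne_zero (ne_neg_natCast_of_re_pos hw)
    have h1 : HasDerivAt Complex.Gamma (deriv Complex.Gamma w) (w + ((0 : ℝ) : ℂ)) := by
      simpa using (Complex.differentiableAt_Gamma w (ne_neg_natCast_of_re_pos hw)).hasDerivAt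
    have h2 : HasDerivAt (fun ε : ℝ => w + (ε : ℂ)) 1 0 :=
      (Complex.ofRealCLM.hasDerivAt (x := 0)).const_add w
    have h3 := h1.comp (0 : ℝ) h2
    have h4 := (hasDerivAt_const (0 : ℝ) (Complex.Gamma w)).fun_div h3 (by simpa using hw0)
    refine h4.congr_deriv ?_
    simp only [Function.comp, Complex.ofReal_zero, add_zero, Complex.digamma_def, logDeriv_apply]
    field_simp
    ring
  have hlim := ((hqd s hs0).fun_sub (hqd 1 (by simp))).tendsto_slope_zero_right
  have hΓ : Tendsto (fun ε : ℝ => Complex.Gamma (1 + ε)) (𝓝[>] 0) (𝓝 1) := by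
    have h1 : ContinuousAt (fun ε : ℝ => Complex.Gamma (1 + ε)) 0 := by
      apply ContinuousAt.comp (g := Complex.Gamma)
      · apply Complex.continuousAt_Gamma
        apply ne_neg_natCast_of_re_pos
        simp
      · fun_prop
    have h2 := h1.tendsto
    simp only [Complex.ofReal_zero, add_zero, Complex.Gamma_one] at h2
    exact h2.mono_left nhdsWithin_le_nhds
  have hlim2 := (hΓ.mul hlim).norm
  rw [one_mul, show -Complex.digamma s - -Complex.digamma 1 =
    -(Complex.digamma s - Complex.digamma 1) by ring, norm_neg] at hlim2
  refine le_of_tendsto hlim2 ?_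
  filter_upwards [self_mem_nhdsWithin] with ε hε
  have hε : 0 < ε := hε
  refine le_trans (le_of_eq ?_) (hbeta ε hε)
  congr 1
  have hε0 : (ε : ℂ) ≠ 0 := by exact_mod_cast hε.ne'
  have hb : ∀ w : ℂ, 0 < w.re → Complex.betaIntegral w ε = Complex.Gamma ε * q w ε := by
    intro w hw
    have hne := Complex.Gamma_ne_zero (s := w + ε)
      (ne_neg_natCast_of_re_pos (by simp; linarith))
    have := Complex.Gamma_mul_Gamma_eq_betaIntegral (s := w) (t := ε) hw (by simpa using hε)
    simp only [hq]
    field_simp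
    rw [mul_comm, ← this, mul_comm]
  rw [hb s hs0, hb 1 (by simp), add_comm (1 : ℂ), Complex.Gamma_add_one _ hε0]
  have hq0 : ∀ w : ℂ, 0 < w.re → q w 0 = 1 := by
    intro w hw
    simp [hq, div_self (Complex.Gamma_ne_zero (ne_neg_natCast_of_re_pos hw))]
  rw [zero_add, hq0 s hs0, hq0 1 (by simp), Complex.real_smul]
  push_cast
  field_simp
  ring

theorem norm_sin_le_two_mul_norm_cos {z : ℂ} (hz : 1 ≤ |z.im|) :
    ‖Complex.sin z‖ ≤ 2 * ‖Complex.cos z‖ ∧ Complex.cos z ≠ 0 := by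
  have key : ∀ w : ℂ, 1 ≤ w.im → ‖Complex.sin w‖ ≤ 2 * ‖Complex.cos w‖ ∧ Complex.cos w ≠ 0 := by
    intro w hw
    set a := Complex.exp (w * Complex.I) with ha
    set b := Complex.exp (-w * Complex.I) with hb
    have h1 : ‖a‖ ≤ Real.exp (-1) := by
      rw [ha, Complex.norm_exp]
      simpa using hw
    have h2 : Real.exp 1 ≤ ‖b‖ := by
      rw [hb, Complex.norm_exp]
      simpa using hw
    have h3 : Real.exp (-1) ≤ 1 / 2 := by
      rw [Real.exp_neg]
      have := Real.exp_one_gt_d9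
      rw [one_div]
      exact inv_anti₀ (by norm_num) (by linarith)
    have h4 := Real.exp_one_gt_d9
    have hc : Complex.cos w = (a + b) / 2 := rfl
    have hs : Complex.sin w = (b - a) * Complex.I / 2 := rfl
    have e1 : ‖Complex.cos w‖ = ‖a + b‖ / 2 := by rw [hc]; simp
    have e2 : ‖Complex.sin w‖ = ‖b - a‖ / 2 := by rw [hs]; simp
    have l1 : ‖b‖ - ‖a‖ ≤ ‖a + b‖ := by
      rw [add_comm]
      simpa using norm_sub_norm_le b (-a)
    have l2 := norm_sub_le b a
    refine ⟨by rw [e1, e2]; linarith, fun h => ?_⟩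
    rw [h, norm_zero] at e1
    linarith
  rcases le_total 0 z.im with h | h
  · exact key z (by rwa [abs_of_nonneg h] at hz)
  · have := key (-z) (by rw [abs_of_nonpos h] at hz; simpa using hz)
    simpa using this

/-- On the vertical line through nπ the quotient is |tanh y| in modulus. These lines correspond to
Re s a negative odd integer, between consecutive trivial zeros, where the left side of the contour
is placed. -/
theorem norm_sin_le_norm_cos_of_int_mul_pi (n : ℤ) (y : ℝ) :
    ‖Complex.sin (n * Real.pi + y * Complex.I)‖ ≤ ‖Complex.cos (n * Real.pi + y * Complex.I)‖ ∧
      Complex.cos (n * Real.pi + y * Complex.I) ≠ 0 := by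
  have hs : Complex.sin (n * Real.pi) = 0 := Complex.sin_int_mul_pi n
  have hc : ‖Complex.cos (n * Real.pi)‖ = 1 := by
    have h := Complex.sin_sq_add_cos_sq (n * Real.pi)
    rw [hs, zero_pow two_ne_zero, zero_add] at h
    have h2 := congrArg norm h
    rw [norm_pow, norm_one] at h2
    exact (pow_eq_one_iff_of_nonneg (norm_nonneg _) two_ne_zero).1 h2
  have e1 : ‖Complex.sin (n * Real.pi + y * Complex.I)‖ = |Real.sinh y| := by
    rw [Complex.sin_add, hs, zero_mul, zero_add, norm_mul, hc, one_mul, Complex.sin_mul_I,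
      norm_mul, Complex.norm_I, mul_one, ← Complex.ofReal_sinh, Complex.norm_real, Real.norm_eq_abs]
  have e2 : ‖Complex.cos (n * Real.pi + y * Complex.I)‖ = Real.cosh y := by
    rw [Complex.cos_add, hs, zero_mul, sub_zero, norm_mul, hc, one_mul, Complex.cos_mul_I,
      ← Complex.ofReal_cosh, Complex.norm_real, Real.norm_of_nonneg (Real.cosh_pos y).le]
  have e3 : |Real.sinh y| ≤ Real.cosh y := by
    have := Real.cosh_sq y
    exact abs_le_of_sq_le_sq (by linarith) (Real.cosh_pos y).le
  refine ⟨by rw [e1, e2]; exact e3, fun h => ?_⟩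
  rw [h, norm_zero] at e2
  exact (Real.cosh_pos y).ne e2

theorem riemannZeta_one_sub_eventuallyEq {s : ℂ} (hs : 1 < s.re) :
    (fun w => riemannZeta (1 - w)) =ᶠ[𝓝 s] fun w =>
      (2 * ((2 * Real.pi : ℂ) ^ (-w) * Complex.Gamma w * riemannZeta w)) *
        Complex.cos (Real.pi * w / 2) := by
  filter_upwards [(isOpen_lt continuous_const Complex.continuous_re).mem_nhds hs] with w hw
  have hw : 1 < w.re := hw
  rw [riemannZeta_one_sub (ne_neg_natCast_of_re_pos (by linarith))
    (by rintro rfl; simp at hw)]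
  ring

/-- Logarithmic differentiation of the functional equation: the growth of ζ'/ζ on the left is
reduced to digamma, a tangent and the bounded values of ζ'/ζ on the right. -/
theorem logDeriv_riemannZeta_one_sub {s : ℂ} (hs : 1 < s.re)
    (hcos : Complex.cos (Real.pi * s / 2) ≠ 0) :
    riemannZeta (1 - s) ≠ 0 ∧ logDeriv riemannZeta (1 - s) = Complex.log (2 * Real.pi) -
      Complex.digamma s + Real.pi / 2 * (Complex.sin (Real.pi * s / 2) /
        Complex.cos (Real.pi * s / 2)) - logDeriv riemannZeta s := by
  have hpi : (2 * Real.pi : ℂ) ≠ 0 := by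
    have := Real.pi_ne_zero
    simp [this]
  have hs1 : s ≠ 1 := by rintro rfl; simp at hs
  have h1s : 1 - s ≠ 1 := by
    intro h
    have : s = 0 := by linear_combination -h
    rw [this] at hs
    norm_num at hs
  have hΓ := Complex.Gamma_ne_zero (ne_neg_natCast_of_re_pos (by linarith : 0 < s.re))
  have hζ := riemannZeta_ne_zero_of_one_lt_re hs
  have hp : (2 * Real.pi : ℂ) ^ (-s) ≠ 0 := by simp [Complex.cpow_eq_zero_iff, hpi]
  have heq := riemannZeta_one_sub_eventuallyEq hs
  have hΓd := Complex.differentiableAt_Gamma s (ne_neg_natCast_of_re_pos (by linarith))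
  have hζd := differentiableAt_riemannZeta hs1
  have hpd : HasDerivAt (fun w : ℂ => (2 * Real.pi : ℂ) ^ (-w))
      ((2 * Real.pi : ℂ) ^ (-s) * Complex.log (2 * Real.pi) * -1) s :=
    (hasDerivAt_neg s).const_cpow (Or.inl hpi)
  have hcd : HasDerivAt (fun w : ℂ => Complex.cos (Real.pi * w / 2))
      (-Complex.sin (Real.pi * s / 2) * (Real.pi * 1 / 2)) s :=
    ((((hasDerivAt_id s).const_mul (Real.pi : ℂ)).div_const 2)).ccos
  have hA : (2 * Real.pi : ℂ) ^ (-s) * Complex.Gamma s ≠ 0 := mul_ne_zero hp hΓ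
  have hB : (2 * Real.pi : ℂ) ^ (-s) * Complex.Gamma s * riemannZeta s ≠ 0 := mul_ne_zero hA hζ
  have hval : riemannZeta (1 - s) = _ := heq.self_of_nhds
  refine ⟨by rw [hval]; exact mul_ne_zero (mul_ne_zero two_ne_zero hB) hcos, ?_⟩
  have hl : logDeriv (fun w => riemannZeta (1 - w)) s = -logDeriv riemannZeta (1 - s) := by
    have : HasDerivAt (fun w => riemannZeta (1 - w)) (deriv riemannZeta (1 - s) * -1) s :=
      (differentiableAt_riemannZeta h1s).hasDerivAt.comp s ((hasDerivAt_id s).const_sub 1)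
    rw [logDeriv_apply, this.deriv, logDeriv_apply]
    ring
  have hr : logDeriv (fun w => riemannZeta (1 - w)) s = -Complex.log (2 * Real.pi) +
      Complex.digamma s + logDeriv riemannZeta s - Real.pi / 2 * (Complex.sin (Real.pi * s / 2) /
        Complex.cos (Real.pi * s / 2)) := by
    have m1 := logDeriv_mul (f := fun w : ℂ => (2 * Real.pi : ℂ) ^ (-w)) (g := Complex.Gamma) s
      hp hΓ hpd.differentiableAt hΓd
    have m2 := logDeriv_mul (f := fun w : ℂ => (2 * Real.pi : ℂ) ^ (-w) * Complex.Gamma w)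
      (g := riemannZeta) s hA hζ (hpd.differentiableAt.fun_mul hΓd) hζd
    have m3 := logDeriv_const_mul
      (f := fun w : ℂ => (2 * Real.pi : ℂ) ^ (-w) * Complex.Gamma w * riemannZeta w) s 2 two_ne_zero
    have m4 := logDeriv_mul
      (f := fun w : ℂ => 2 * ((2 * Real.pi : ℂ) ^ (-w) * Complex.Gamma w * riemannZeta w))
      (g := fun w : ℂ => Complex.cos (Real.pi * w / 2)) s (mul_ne_zero two_ne_zero hB) hcos
      (((hpd.differentiableAt.fun_mul hΓd).fun_mul hζd).const_mul 2) hcd.differentiableAt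
    rw [(logDeriv_congr_nhds heq).self_of_nhds, m4, m3, m2, m1, Complex.digamma_def,
      logDeriv_apply (fun w : ℂ => (2 * Real.pi : ℂ) ^ (-w)), hpd.deriv,
      logDeriv_apply (fun w : ℂ => Complex.cos (Real.pi * w / 2)), hcd.deriv]
    field_simp
    ring
  rw [hl] at hr
  linear_combination -hr

theorem logDeriv_riemannZeta_eq {s : ℂ} (hs : 1 < s.re) :
    logDeriv riemannZeta s = -LSeries (fun n => (ArithmeticFunction.vonMangoldt n : ℂ)) s := by
  have := ArithmeticFunction.LSeries_vonMangoldt_eq_deriv_riemannZeta_div hs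
  rw [this, logDeriv_apply]
  ring

theorem exists_norm_logDeriv_riemannZeta_le : ∃ C : ℝ, 0 ≤ C ∧ ∀ s : ℂ, 3 / 2 ≤ s.re →
    ‖logDeriv riemannZeta s‖ ≤ C := by
  set Λ' : ℕ → ℂ := fun n => (ArithmeticFunction.vonMangoldt n : ℂ) with hΛ
  have hsum : LSeriesSummable Λ' (3 / 2 : ℂ) :=
    ArithmeticFunction.LSeriesSummable_vonMangoldt (by norm_num)
  refine ⟨∑' n, ‖LSeries.term Λ' (3 / 2) n‖, tsum_nonneg fun n => norm_nonneg _, fun s hs => ?_⟩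
  rw [logDeriv_riemannZeta_eq (by linarith), norm_neg]
  refine tsum_of_norm_bounded hsum.norm.hasSum fun n => ?_
  exact LSeries.norm_term_le_of_re_le_re _ (by norm_num; linarith) n

/-- Growth of `ζ'/ζ` to the left of the critical strip. -/
theorem exists_norm_logDeriv_riemannZeta_one_sub_le : ∃ C : ℝ, 0 ≤ C ∧ ∀ s : ℂ, 3 / 2 ≤ s.re →
    ‖Complex.sin (Real.pi * s / 2)‖ ≤ 2 * ‖Complex.cos (Real.pi * s / 2)‖ →
    Complex.cos (Real.pi * s / 2) ≠ 0 → ‖logDeriv riemannZeta (1 - s)‖ ≤ C * √‖s‖ := by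
  obtain ⟨C₁, hC₁, h1⟩ := exists_norm_logDeriv_riemannZeta_le
  obtain ⟨C₂, hC₂, h2⟩ := exists_norm_digamma_sub_le
  refine ⟨‖Complex.log (2 * Real.pi)‖ + (C₂ * 2 + ‖Complex.digamma 1‖) + Real.pi / 2 * 2 + C₁,
    by positivity, ?_⟩
  intro s hs hsc hc
  have hns : 3 / 2 ≤ ‖s‖ := hs.trans ((le_abs_self _).trans (Complex.abs_re_le_norm s))
  have hsq : 1 ≤ √‖s‖ := Real.one_le_sqrt.2 (by linarith)
  have hd : ‖Complex.digamma s‖ ≤ (C₂ * 2 + ‖Complex.digamma 1‖) * √‖s‖ := by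
    have h3 := norm_add_le (Complex.digamma s - Complex.digamma 1) (Complex.digamma 1)
    rw [sub_add_cancel] at h3
    have h4 : √(2 * ‖s - 1‖) ≤ 2 * √‖s‖ := by
      rw [show (2 : ℝ) = √4 by rw [show (4 : ℝ) = 2 ^ 2 by norm_num]; simp,
        ← Real.sqrt_mul (by norm_num)]
      apply Real.sqrt_le_sqrt
      have := norm_sub_le s 1
      rw [norm_one] at this
      rw [show √4 = (2 : ℝ) by rw [show (4 : ℝ) = 2 ^ 2 by norm_num]; simp]
      linarith
    calc _ ≤ C₂ * √(2 * ‖s - 1‖) + ‖Complex.digamma 1‖ * 1 := by linarith [h2 s (by linarith)]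
      _ ≤ C₂ * (2 * √‖s‖) + ‖Complex.digamma 1‖ * √‖s‖ := by gcongr
      _ = _ := by ring
  have ht : ‖(Real.pi / 2 : ℂ) * (Complex.sin (Real.pi * s / 2) / Complex.cos (Real.pi * s / 2))‖ ≤
      Real.pi / 2 * 2 := by
    rw [norm_mul, norm_div, norm_div, Complex.norm_real, Real.norm_of_nonneg Real.pi_pos.le,
      Complex.norm_ofNat]
    gcongr
    exact (div_le_iff₀ (norm_pos_iff.2 hc)).2 hsc
  rw [(logDeriv_riemannZeta_one_sub (by linarith) hc).2]
  calc _ ≤ ‖Complex.log (2 * Real.pi)‖ + ‖Complex.digamma s‖ +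
        ‖(Real.pi / 2 : ℂ) * (Complex.sin (Real.pi * s / 2) / Complex.cos (Real.pi * s / 2))‖ +
        ‖logDeriv riemannZeta s‖ := by
        refine (norm_sub_le _ _).trans ?_
        gcongr
        refine (norm_add_le _ _).trans ?_
        gcongr
        exact norm_sub_le _ _
    _ ≤ ‖Complex.log (2 * Real.pi)‖ * 1 + (C₂ * 2 + ‖Complex.digamma 1‖) * √‖s‖ +
        Real.pi / 2 * 2 * 1 + C₁ * 1 := by
        rw [mul_one, mul_one, mul_one]
        have := h1 s hs
        gcongr
    _ ≤ ‖Complex.log (2 * Real.pi)‖ * √‖s‖ + (C₂ * 2 + ‖Complex.digamma 1‖) * √‖s‖ +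
        Real.pi / 2 * 2 * √‖s‖ + C₁ * √‖s‖ := by gcongr
    _ = _ := by ring

/-! ### Trivial zeros, their simplicity, and finiteness of orders. -/

/-- With s = 1 - z, every factor of the functional equation except the cosine is nonzero, so s is an
odd integer; s = 1 is excluded by ζ(0) = -1/2. -/
theorem riemannZeta_eq_zero_of_re_nonpos {z : ℂ} (hz : riemannZeta z = 0) (hre : z.re ≤ 0) :
    ∃ k : ℕ, z = -2 * (k + 1) := by
  have hz0 : z ≠ 0 := by
    rintro rfl
    rw [riemannZeta_zero] at hz
    norm_num at hz
  set s := 1 - z with hs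
  have hsre : 1 ≤ s.re := by simp [hs, hre]
  have hs1 : s ≠ 1 := by
    intro h
    apply hz0
    linear_combination -h
  have hfe := riemannZeta_one_sub (ne_neg_natCast_of_re_pos (by linarith : 0 < s.re)) hs1
  have hpi : (2 * Real.pi : ℂ) ≠ 0 := by
    have := Real.pi_ne_zero
    simp [this]
  have hp : (2 * Real.pi : ℂ) ^ (-s) ≠ 0 := by simp [Complex.cpow_eq_zero_iff, hpi]
  rw [show 1 - s = z by rw [hs]; ring, hz] at hfe
  have hcos : Complex.cos (Real.pi * s / 2) = 0 := by
    by_contra h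
    refine mul_ne_zero (mul_ne_zero (mul_ne_zero (mul_ne_zero two_ne_zero hp)
      (Complex.Gamma_ne_zero (ne_neg_natCast_of_re_pos (by linarith)))) h)
      (riemannZeta_ne_zero_of_one_le_re hsre) hfe.symm
  obtain ⟨k, hk⟩ := Complex.cos_eq_zero_iff.1 hcos
  have hpi' : (Real.pi : ℂ) ≠ 0 := by exact_mod_cast Real.pi_ne_zero
  have hsk : s = 2 * k + 1 := by
    have : (Real.pi : ℂ) * s = Real.pi * (2 * k + 1) := by linear_combination 2 * hk
    exact mul_left_cancel₀ hpi' this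
  have hzk : z = -2 * k := by
    have : z = 1 - s := by rw [hs]; ring
    rw [this, hsk]; ring
  have hk0 : 1 ≤ k := by
    have h1 : z.re = -2 * k := by rw [hzk]; simp
    rw [h1] at hre
    have h2 : (0 : ℝ) ≤ k := by linarith
    have h3 : 0 ≤ k := by exact_mod_cast h2
    have h4 : k ≠ 0 := by
      rintro rfl
      apply hz0
      rw [hzk]; simp
    omega
  refine ⟨(k - 1).toNat, ?_⟩
  have : ((k - 1).toNat : ℤ) = k - 1 := Int.toNat_of_nonneg (by omega)
  have h5 : (((k - 1).toNat : ℕ) : ℂ) = k - 1 := by exact_mod_cast congrArg (Int.cast (R := ℂ)) this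
  rw [hzk, h5]
  ring

theorem re_mem_Ioo_of_riemannZeta_eq_zero {z : ℂ} (hz : riemannZeta z = 0) (him : z.im ≠ 0) :
    0 < z.re ∧ z.re < 1 := by
  constructor
  · by_contra! h
    obtain ⟨k, rfl⟩ := riemannZeta_eq_zero_of_re_nonpos hz h
    simp at him
  · by_contra! h
    exact riemannZeta_ne_zero_of_one_le_re h hz

/-- Differentiating the functional equation at s = 2k + 3 leaves only the term with the derivative
of the cosine, which is nonzero since sine and cosine have no common zero. -/
theorem analyticOrderNatAt_riemannZeta_trivial_zero (k : ℕ) :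
    analyticOrderNatAt riemannZeta (-2 * (k + 1)) = 1 := by
  set s : ℂ := 2 * k + 3 with hs
  have hsre : 1 < s.re := by simp [hs]; linarith [Nat.cast_nonneg (α := ℝ) k]
  have hz : 1 - s = -2 * (k + 1) := by rw [hs]; ring
  have hz1 : (1 - s) ≠ 1 := by
    intro h
    have := congrArg Complex.re h
    simp at this
    linarith
  have heq := riemannZeta_one_sub_eventuallyEq hsre
  set A : ℂ → ℂ := fun w => 2 * ((2 * Real.pi : ℂ) ^ (-w) * Complex.Gamma w * riemannZeta w)
  have hpi : (2 * Real.pi : ℂ) ≠ 0 := by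
    have := Real.pi_ne_zero
    simp [this]
  have hAs : A s ≠ 0 := by
    have hp : (2 * Real.pi : ℂ) ^ (-s) ≠ 0 := by simp [Complex.cpow_eq_zero_iff, hpi]
    exact mul_ne_zero two_ne_zero (mul_ne_zero (mul_ne_zero hp
      (Complex.Gamma_ne_zero (ne_neg_natCast_of_re_pos (by linarith))))
      (riemannZeta_ne_zero_of_one_lt_re hsre))
  have hAd : DifferentiableAt ℂ A s := by
    have h1 := Complex.differentiableAt_Gamma s (ne_neg_natCast_of_re_pos (by linarith))
    have h2 := differentiableAt_riemannZeta (s := s) (by rintro h; rw [h] at hsre; simp at hsre)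
    have h3 : DifferentiableAt ℂ (fun w : ℂ => (2 * Real.pi : ℂ) ^ (-w)) s :=
      ((hasDerivAt_neg s).const_cpow (Or.inl hpi)).differentiableAt
    exact ((h3.fun_mul h1).fun_mul h2).const_mul 2
  have harg : (Real.pi * s / 2 : ℂ) = (2 * ((k + 1 : ℤ) : ℂ) + 1) * Real.pi / 2 := by
    rw [hs]; push_cast; ring
  have hcos : Complex.cos (Real.pi * s / 2) = 0 :=
    Complex.cos_eq_zero_iff.2 ⟨k + 1, by rw [harg]⟩
  have hsin : Complex.sin (Real.pi * s / 2) ≠ 0 := by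
    intro h
    have := Complex.sin_sq_add_cos_sq (Real.pi * s / 2)
    rw [h, hcos] at this
    norm_num at this
  have hcd : HasDerivAt (fun w : ℂ => Complex.cos (Real.pi * w / 2))
      (-Complex.sin (Real.pi * s / 2) * (Real.pi * 1 / 2)) s :=
    ((((hasDerivAt_id s).const_mul (Real.pi : ℂ)).div_const 2)).ccos
  have hd1 := heq.deriv_eq
  rw [deriv_fun_mul hAd hcd.differentiableAt, hcos, mul_zero, zero_add, hcd.deriv] at hd1
  have hd2 : HasDerivAt (fun w => riemannZeta (1 - w)) (deriv riemannZeta (1 - s) * -1) s :=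
    (differentiableAt_riemannZeta hz1).hasDerivAt.comp s ((hasDerivAt_id s).const_sub 1)
  rw [hd2.deriv] at hd1
  have hpi' : (Real.pi : ℂ) ≠ 0 := by exact_mod_cast Real.pi_ne_zero
  have hd3 : deriv riemannZeta (1 - s) ≠ 0 := by
    intro h
    rw [h, zero_mul] at hd1
    refine mul_ne_zero hAs (mul_ne_zero (neg_ne_zero.2 hsin) ?_) hd1.symm
    simp [hpi']
  rw [hz] at hd3 hz1
  have := (analyticOn_riemannZeta _ hz1).analyticOrderAt_eq_one_of_zero_deriv_ne_zero
    (riemannZeta_neg_two_mul_nat_add_one k) hd3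
  rw [analyticOrderNatAt, this]
  rfl

theorem analyticOrderAt_riemannZeta_ne_top {z : ℂ} (hz : z ≠ 1) :
    analyticOrderAt riemannZeta z ≠ ⊤ := by
  have hconn : IsPreconnected ({1}ᶜ : Set ℂ) :=
    (isConnected_compl_singleton_of_one_lt_rank (by simp) 1).isPreconnected
  refine analyticOn_riemannZeta.analyticOrderAt_ne_top_of_isPreconnected hconn (x := 0)
    (by simp) hz ?_
  rw [(analyticOn_riemannZeta 0 (by simp)).analyticOrderAt_eq_zero.2 (by
    rw [riemannZeta_zero]; norm_num)]
  simp

/-! ### The Perron kernel and Perron's formula for ψ₀. -/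

theorem exists_analyticAt_mul_inv_sub {k : ℂ → ℂ} {p : ℂ} (hk : AnalyticAt ℂ k p) :
    ∃ g : ℂ → ℂ, AnalyticAt ℂ g p ∧ ∀ s, s ≠ p → k s * (s - p)⁻¹ = g s + k p * (s - p)⁻¹ := by
  obtain ⟨q, hq⟩ := hk
  refine ⟨dslope k p, ⟨_, hq.has_fpower_series_dslope_fslope⟩, fun s hs => ?_⟩
  rw [dslope_of_ne _ hs, slope_def_field]
  ring

theorem norm_exp_mul_div_le {L : ℝ} {s : ℂ} {r : ℝ} (hr : 0 < r) (hs : r ≤ ‖s‖) :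
    ‖Complex.exp (L * s) / s‖ ≤ Real.exp (L * s.re) / r := by
  rw [norm_div, Complex.norm_exp, Complex.re_ofReal_mul]
  gcongr

theorem integral_exp_mul_eq {L a b : ℝ} (hL : L ≠ 0) :
    ∫ x in a..b, Real.exp (L * x) = (Real.exp (L * b) - Real.exp (L * a)) / L := by
  rw [intervalIntegral.integral_comp_mul_left (fun x => Real.exp x) hL, integral_exp, smul_eq_mul]
  ring

theorem norm_integral_horizontal_le {L a b T c : ℝ} (hL : L ≠ 0) (hT : 0 < T) (hc : |c| = T)
    (hab : a ≤ b) : ‖∫ x : ℝ in a..b, Complex.exp (L * (x + c * Complex.I)) / (x + c * Complex.I)‖ ≤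
      (Real.exp (L * b) - Real.exp (L * a)) / L / T := by
  rw [← integral_exp_mul_eq hL, ← intervalIntegral.integral_div]
  refine intervalIntegral.norm_integral_le_of_norm_le hab
    (Eventually.of_forall fun x _ => ?_) (Continuous.intervalIntegrable (by fun_prop) _ _)
  have h := norm_exp_mul_div_le (L := L) (s := x + c * Complex.I) hT (by
    have := Complex.abs_im_le_norm (x + c * Complex.I)
    simpa [hc] using this)
  simpa using h

theorem norm_integral_vertical_le {L a T : ℝ} (hT : 0 ≤ T) (ha : 1 ≤ |a|) :
    ‖∫ y : ℝ in (-T)..T, Complex.exp (L * (a + y * Complex.I)) / (a + y * Complex.I)‖ ≤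
      2 * T * Real.exp (L * a) := by
  have := intervalIntegral.norm_integral_le_of_norm_le_const (a := -T) (b := T)
    (f := fun y : ℝ => Complex.exp (L * (a + y * Complex.I)) / (a + y * Complex.I))
    (C := Real.exp (L * a)) (fun y _ => by
      have h := norm_exp_mul_div_le (L := L) (s := a + y * Complex.I) one_pos (by
        have := Complex.abs_re_le_norm (a + y * Complex.I)
        simp at this
        linarith)
      simpa using h)
  rw [show T - -T = 2 * T by ring, abs_of_nonneg (by positivity)] at this
  linarith

/-- The truncated Perron integral of `exp (L s) / s` on the line `Re s = 2`. -/
noncomputable def perronKernel (L T : ℝ) : ℂ :=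
  ∫ t : ℝ in (-T)..T, Complex.exp (L * (2 + t * Complex.I)) / (2 + t * Complex.I)

/-- Close the contour to the left, across the simple pole at 0 with residue 1. The far side at Re s
= -N contributes at most 2T e^(-LN), which vanishes as N → ∞. -/
theorem norm_perronKernel_sub_le_of_pos {L T : ℝ} (hL : 0 < L) (hT : 0 < T) :
    ‖perronKernel L T - 2 * Real.pi‖ ≤ 2 * Real.exp (2 * L) / L / T := by
  set f : ℂ → ℂ := fun s => Complex.exp (L * s) / s with hf
  have hkey : ∀ N : ℝ, 1 ≤ N → ‖perronKernel L T - 2 * Real.pi‖ ≤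
      2 * Real.exp (2 * L) / L / T + 2 * T * Real.exp (L * -N) := by
    intro N hN
    have hres := rectIntegral_eq_sum_residues (a := -N) (b := 2) (c := -T) (d := T) (by linarith)
      (by linarith) (fun _ => 1) {0} f (by
        intro p hp
        rw [Finset.mem_singleton] at hp
        rw [hp]
        simp only [Complex.zero_re, Complex.zero_im]
        refine ⟨?_, ?_, ?_, ?_⟩ <;> linarith) (by
        intro s _ _ _ _ hs
        rw [Finset.mem_singleton] at hs
        simp only [hf]
        fun_prop (disch := assumption)) (by
        intro p hp
        rw [Finset.mem_singleton] at hp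
        rw [hp]
        obtain ⟨g, hg, hg'⟩ := exists_analyticAt_mul_inv_sub (p := 0)
          (k := fun s : ℂ => Complex.exp (L * s)) (by fun_prop)
        refine ⟨g, hg, ?_⟩
        filter_upwards [self_mem_nhdsWithin] with s hs
        have := hg' s hs
        simp only [sub_zero, mul_zero, Complex.exp_zero, one_mul] at this ⊢
        rw [← this]
        exact div_eq_mul_inv _ _)
    rw [Finset.sum_singleton, mul_one] at hres
    have h1 := norm_integral_horizontal_le (L := L) (a := -N) (b := 2) (c := -T) hL.ne' hT
      (by rw [abs_neg, abs_of_pos hT]) (by linarith)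
    have h2 := norm_integral_horizontal_le (L := L) (a := -N) (b := 2) (c := T) hL.ne' hT
      (abs_of_pos hT) (by linarith)
    have h3 := norm_integral_vertical_le (L := L) (a := -N) hT.le (by
      rw [abs_neg]; exact hN.trans (le_abs_self _))
    set A := ∫ x : ℝ in (-N)..2, f (x + (-T : ℝ) * Complex.I) with hA
    set B := ∫ x : ℝ in (-N)..2, f (x + T * Complex.I) with hB
    set D := ∫ y : ℝ in (-T)..T, f ((-N : ℝ) + y * Complex.I) with hD
    have hE : perronKernel L T = ∫ y : ℝ in (-T)..T, f ((2 : ℝ) + y * Complex.I) := by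
      simp [perronKernel, hf]
    have h4 : rectIntegral f (-N) 2 (-T) T = A - B + Complex.I * perronKernel L T -
        Complex.I * D := by
      rw [hE]; rfl
    rw [h4] at hres
    have h5 : perronKernel L T - 2 * Real.pi = Complex.I * A - Complex.I * B + D := by
      linear_combination -Complex.I * hres + (perronKernel L T - D - 2 * Real.pi) * Complex.I_sq
    have h6 : (Real.exp (L * 2) - Real.exp (L * -N)) / L / T ≤ Real.exp (2 * L) / L / T := by
      rw [mul_comm L 2]
      gcongr
      linarith [Real.exp_pos (L * -N)]
    rw [h5]
    calc _ ≤ ‖Complex.I * A‖ + ‖Complex.I * B‖ + ‖D‖ := by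
          refine (norm_add_le _ _).trans ?_
          gcongr
          exact norm_sub_le _ _
      _ = ‖A‖ + ‖B‖ + ‖D‖ := by simp
      _ ≤ Real.exp (2 * L) / L / T + Real.exp (2 * L) / L / T + 2 * T * Real.exp (L * -N) :=
          add_le_add (add_le_add (h1.trans h6) (h2.trans h6)) h3
      _ = _ := by ring
  have hlim : Tendsto (fun N : ℝ => 2 * Real.exp (2 * L) / L / T + 2 * T * Real.exp (L * -N)) atTop
      (𝓝 (2 * Real.exp (2 * L) / L / T + 2 * T * 0)) := by
    refine ((Real.tendsto_exp_atBot.comp ?_).const_mul _).const_add _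
    exact Tendsto.const_mul_atBot hL tendsto_neg_atTop_atBot
  rw [mul_zero, add_zero] at hlim
  exact ge_of_tendsto hlim (by filter_upwards [eventually_ge_atTop 1] with N hN using hkey N hN)

/-- For L < 0 the exponential decays to the right, where there is no pole. -/
theorem norm_perronKernel_le_of_neg {L T : ℝ} (hL : L < 0) (hT : 0 < T) :
    ‖perronKernel L T‖ ≤ 2 * Real.exp (2 * L) / |L| / T := by
  set f : ℂ → ℂ := fun s => Complex.exp (L * s) / s with hf
  have hkey : ∀ N : ℝ, 2 ≤ N → ‖perronKernel L T‖ ≤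
      2 * Real.exp (2 * L) / |L| / T + 2 * T * Real.exp (L * N) := by
    intro N hN
    have hres := rectIntegral_eq_zero (f := f) (a := 2) (b := N) (c := -T) (d := T) hN
      (by linarith) (by
        intro s hs _ _ _
        have : s ≠ 0 := by rintro rfl; simp at hs; linarith
        simp only [hf]
        fun_prop (disch := assumption))
    have h1 := norm_integral_horizontal_le (L := L) (a := 2) (b := N) (c := -T) hL.ne hT
      (by rw [abs_neg, abs_of_pos hT]) hN
    have h2 := norm_integral_horizontal_le (L := L) (a := 2) (b := N) (c := T) hL.ne hT
      (abs_of_pos hT) hN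
    have h3 := norm_integral_vertical_le (L := L) (a := N) hT.le
      (le_trans (by linarith) (le_abs_self _))
    set A := ∫ x : ℝ in (2 : ℝ)..N, f (x + (-T : ℝ) * Complex.I) with hA
    set B := ∫ x : ℝ in (2 : ℝ)..N, f (x + T * Complex.I) with hB
    set D := ∫ y : ℝ in (-T)..T, f (N + y * Complex.I) with hD
    have hE : perronKernel L T = ∫ y : ℝ in (-T)..T, f ((2 : ℝ) + y * Complex.I) := by
      simp [perronKernel, hf]
    have h4 : rectIntegral f 2 N (-T) T = A - B + Complex.I * D -
        Complex.I * perronKernel L T := by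
      rw [hE]; rfl
    rw [h4] at hres
    have h5 : perronKernel L T = -(Complex.I * A) + Complex.I * B + D := by
      linear_combination Complex.I * hres + (perronKernel L T - D) * Complex.I_sq
    have h6 : (Real.exp (L * N) - Real.exp (L * 2)) / L / T ≤ Real.exp (2 * L) / |L| / T := by
      rw [abs_of_neg hL, mul_comm L 2, ← neg_sub, neg_div, ← div_neg]
      have : 0 < -L := by linarith
      gcongr
      linarith [Real.exp_pos (L * N)]
    rw [h5]
    calc _ ≤ ‖-(Complex.I * A)‖ + ‖Complex.I * B‖ + ‖D‖ := norm_add₃_le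
      _ = ‖A‖ + ‖B‖ + ‖D‖ := by simp
      _ ≤ Real.exp (2 * L) / |L| / T + Real.exp (2 * L) / |L| / T + 2 * T * Real.exp (L * N) :=
          add_le_add (add_le_add (h1.trans h6) (h2.trans h6)) h3
      _ = _ := by ring
  have hlim : Tendsto (fun N : ℝ => 2 * Real.exp (2 * L) / |L| / T + 2 * T * Real.exp (L * N)) atTop
      (𝓝 (2 * Real.exp (2 * L) / |L| / T + 2 * T * 0)) := by
    refine ((Real.tendsto_exp_atBot.comp ?_).const_mul _).const_add _
    exact Tendsto.const_mul_atTop_of_neg hL tendsto_id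
  rw [mul_zero, add_zero] at hlim
  exact ge_of_tendsto hlim (by filter_upwards [eventually_ge_atTop 2] with N hN using hkey N hN)

/-- An antiderivative is -i log(2 + it). After rescaling by T the endpoints tend to ±i, so half of
2π survives: this is the weight 1/2 at n = x. -/
theorem tendsto_perronKernel_zero : Tendsto (perronKernel 0) atTop (𝓝 Real.pi) := by
  have hsl : ∀ t : ℝ, (2 + t * Complex.I : ℂ) ∈ Complex.slitPlane := fun t => Or.inl (by simp)
  have hval : ∀ T : ℝ, 0 < T → perronKernel 0 T = -Complex.I *
      (Complex.log ((2 / T : ℝ) + Complex.I) - Complex.log ((2 / T : ℝ) - Complex.I)) := by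
    intro T hT
    have h1 : perronKernel 0 T = -Complex.I * Complex.log (2 + T * Complex.I) -
        -Complex.I * Complex.log (2 + (-T : ℝ) * Complex.I) := by
      unfold perronKernel
      apply intervalIntegral.integral_eq_sub_of_hasDerivAt
        (f := fun t : ℝ => -Complex.I * Complex.log (2 + t * Complex.I))
      · intro t _
        have h1 : HasDerivAt (fun t : ℝ => (2 + t * Complex.I : ℂ)) (1 * Complex.I) t :=
          ((Complex.ofRealCLM.hasDerivAt (x := t)).mul_const _).const_add _
        refine ((h1.clog_real (hsl t)).const_mul (-Complex.I)).congr_deriv ?_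
        simp [mul_div_assoc', ← sq]
      · apply Continuous.intervalIntegrable
        exact Continuous.div (by fun_prop) (by fun_prop) fun t => Complex.slitPlane_ne_zero (hsl t)
    have h2 : ∀ w : ℂ, w ≠ 0 → Complex.log (T * w) = Real.log T + Complex.log w := fun w hw =>
      Complex.log_ofReal_mul hT hw
    have hT0 : (T : ℂ) ≠ 0 := by exact_mod_cast hT.ne'
    have h3 : (2 + T * Complex.I : ℂ) = T * ((2 / T : ℝ) + Complex.I) := by
      push_cast; field_simp
    have h4 : (2 + (-T : ℝ) * Complex.I : ℂ) = T * ((2 / T : ℝ) - Complex.I) := by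
      push_cast; field_simp; ring
    have n1 : ((2 / T : ℝ) + Complex.I : ℂ) ≠ 0 := by
      intro h
      have := congrArg Complex.im h
      simp at this
    have n2 : ((2 / T : ℝ) - Complex.I : ℂ) ≠ 0 := by
      intro h
      have := congrArg Complex.im h
      simp at this
    rw [h1, h3, h4, h2 _ n1, h2 _ n2]
    ring
  have hlim0 : Tendsto (fun T : ℝ => ((2 / T : ℝ) : ℂ)) atTop (𝓝 0) := by
    have := (tendsto_const_nhds (x := (2 : ℝ))).div_atTop (tendsto_id (α := ℝ) (x := atTop))
    exact_mod_cast (Complex.continuous_ofReal.tendsto _).comp this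
  have hI : ∀ w : ℂ, w ∈ Complex.slitPlane → Tendsto (fun T : ℝ =>
      Complex.log ((2 / T : ℝ) + w)) atTop (𝓝 (Complex.log w)) := by
    intro w hw
    have := hlim0.add_const w
    rw [zero_add] at this
    exact this.clog hw
  have h1 := ((hI Complex.I (Or.inr (by simp))).sub
    (hI (-Complex.I) (Or.inr (by simp)))).const_mul (-Complex.I)
  have h2 : -Complex.I * (Complex.log Complex.I - Complex.log (-Complex.I)) = Real.pi := by
    rw [Complex.log_I, Complex.log_neg_I]
    linear_combination -(Real.pi : ℂ) * Complex.I_sq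
  rw [h2] at h1
  refine h1.congr' ?_
  filter_upwards [eventually_gt_atTop 0] with T hT
  rw [hval T hT, sub_eq_add_neg ((2 / T : ℝ) : ℂ)]

/-- The weight of `n` in the normalised Chebyshev function `ψ₀(x)`. -/
noncomputable def chebyshevWeight (x : ℝ) (n : ℕ) : ℝ :=
  if (n : ℝ) < x then 1 else if (n : ℝ) = x then 1 / 2 else 0

theorem tendsto_perronKernel_log_sub {x : ℝ} (hx : 0 < x) {n : ℕ} (hn : 0 < n) :
    Tendsto (perronKernel (Real.log x - Real.log n)) atTop
      (𝓝 (2 * Real.pi * chebyshevWeight x n)) := by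
  have hn' : (0 : ℝ) < n := by exact_mod_cast hn
  have hsq : ∀ C : ℝ, Tendsto (fun T : ℝ => C / T) atTop (𝓝 0) := fun C =>
    tendsto_const_nhds.div_atTop tendsto_id
  rcases lt_trichotomy (n : ℝ) x with h | h | h
  · have hL : 0 < Real.log x - Real.log n := sub_pos.2 (Real.log_lt_log hn' h)
    simp only [chebyshevWeight, h, if_true, Complex.ofReal_one, mul_one]
    rw [tendsto_iff_norm_sub_tendsto_zero]
    refine squeeze_zero' (Eventually.of_forall fun _ => norm_nonneg _) ?_
      (hsq (2 * Real.exp (2 * (Real.log x - Real.log n)) / (Real.log x - Real.log n)))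
    filter_upwards [eventually_gt_atTop 0] with T hT using norm_perronKernel_sub_le_of_pos hL hT
  · have hL : Real.log x - Real.log n = 0 := by rw [h, sub_self]
    rw [hL]
    have : (2 * Real.pi * chebyshevWeight x n : ℂ) = Real.pi := by
      simp [chebyshevWeight, h]
      ring
    rw [this]
    exact tendsto_perronKernel_zero
  · have hL : Real.log x - Real.log n < 0 := sub_neg.2 (Real.log_lt_log hx h)
    have : (2 * Real.pi * chebyshevWeight x n : ℂ) = 0 := by
      simp [chebyshevWeight, h.not_gt, h.ne']
    rw [this, tendsto_zero_iff_norm_tendsto_zero]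
    refine squeeze_zero' (Eventually.of_forall fun _ => norm_nonneg _) ?_
      (hsq (2 * Real.exp (2 * (Real.log x - Real.log n)) / |Real.log x - Real.log n|))
    filter_upwards [eventually_gt_atTop 0] with T hT using norm_perronKernel_le_of_neg hL hT

/-- `ψ₀(x)`: the sum of `Λ(n)` over `n ≤ x`, with weight `1 / 2` if `n = x`. -/
noncomputable def chebyshevPsiNormalized (x : ℝ) : ℝ :=
  ∑' n : ℕ, ArithmeticFunction.vonMangoldt n * chebyshevWeight x n

/-- Domination uniform in n, for exchanging the limit in T with the sum over n: e^(2L) = x²/n², and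
Λ(n)/n² is summable. -/
theorem exists_norm_perronKernel_le {x : ℝ} (hx : 0 < x) : ∃ C : ℝ, ∀ᶠ T : ℝ in atTop,
    ∀ n : ℕ, 0 < n → ‖perronKernel (Real.log x - Real.log n) T‖ ≤ C * ((n : ℝ) ^ 2)⁻¹ := by
  -- A null sequence is bounded, so log n keeps a fixed distance from log x unless they are equal.
  -- In that case the inverse is 0 by convention, and `h0` below supplies the bound.
  have hDlim : Tendsto (fun n : ℕ => |Real.log x - Real.log n|⁻¹) atTop (𝓝 0) := by
    apply Tendsto.inv_tendsto_atTop
    refine tendsto_abs_atBot_atTop.comp ?_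
    exact tendsto_atBot_add_const_left _ _ (tendsto_neg_atTop_atBot.comp
      (Real.tendsto_log_atTop.comp tendsto_natCast_atTop_atTop))
  obtain ⟨D, hD⟩ := hDlim.bddAbove_range
  have hD : ∀ n : ℕ, |Real.log x - Real.log n|⁻¹ ≤ D := fun n => hD ⟨n, rfl⟩
  have hD0 : 0 ≤ D := le_trans (by positivity) (hD 0)
  have h0 : ∀ᶠ T : ℝ in atTop, ‖perronKernel 0 T‖ ≤ 4 := by
    have := tendsto_perronKernel_zero.norm
    rw [Complex.norm_real, Real.norm_of_nonneg Real.pi_pos.le] at this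
    exact (this.eventually_le_const Real.pi_lt_four)
  -- The summands serve, respectively, the main term 2π when L > 0 (there e^(2L) ≥ 1), the case L =
  -- 0, and the error terms.
  refine ⟨(2 * Real.pi + 4 + 2 * D) * x ^ 2, ?_⟩
  filter_upwards [h0, eventually_ge_atTop 1] with T h0 hT n hn
  have hn' : (0 : ℝ) < n := by exact_mod_cast hn
  have hexp : Real.exp (2 * (Real.log x - Real.log n)) = x ^ 2 * ((n : ℝ) ^ 2)⁻¹ := by
    rw [← Real.log_div hx.ne' hn'.ne', mul_comm, Real.exp_mul, Real.exp_log (by positivity)]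
    norm_cast
    rw [div_pow]
    push_cast
    ring
  have hpi := Real.pi_pos
  set L := Real.log x - Real.log n with hL
  rw [mul_assoc, ← hexp]
  have hE : 0 < Real.exp (2 * L) := Real.exp_pos _
  have hdiv : 2 * Real.exp (2 * L) / |L| / T ≤ 2 * D * Real.exp (2 * L) := by
    have h1 : 2 * Real.exp (2 * L) / |L| / T ≤ 2 * Real.exp (2 * L) / |L| :=
      div_le_self (by positivity) hT
    refine h1.trans ?_
    rw [div_eq_mul_inv]
    have := hD n
    nlinarith
  rcases lt_trichotomy 0 L with h | h | h
  · have h1 := norm_perronKernel_sub_le_of_pos h (by linarith : 0 < T)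
    have h2 := norm_add_le (perronKernel L T - 2 * Real.pi) (2 * Real.pi)
    rw [sub_add_cancel] at h2
    have h3 : ‖(2 * Real.pi : ℂ)‖ = 2 * Real.pi := by
      rw [norm_mul, Complex.norm_real, Real.norm_of_nonneg hpi.le]; simp
    have h4 : 1 ≤ Real.exp (2 * L) := Real.one_le_exp (by linarith)
    rw [abs_of_pos h] at hdiv
    rw [h3] at h2
    nlinarith
  · rw [← h] at hE ⊢
    simp only [mul_zero, Real.exp_zero, mul_one]
    linarith
  · have h1 := norm_perronKernel_le_of_neg h (by linarith : 0 < T)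
    nlinarith

theorem norm_LSeries_term_vonMangoldt_two (n : ℕ) :
    ‖LSeries.term (fun n => (ArithmeticFunction.vonMangoldt n : ℂ)) 2 n‖ =
      ArithmeticFunction.vonMangoldt n * ((n : ℝ) ^ 2)⁻¹ := by
  rcases Nat.eq_zero_or_pos n with rfl | hn
  · simp
  · rw [LSeries.term_of_ne_zero hn.ne', norm_div, Complex.norm_real,
      Real.norm_of_nonneg ArithmeticFunction.vonMangoldt_nonneg,
      Complex.norm_natCast_cpow_of_pos hn, div_eq_mul_inv]
    norm_num

theorem summable_vonMangoldt_mul_inv_sq :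
    Summable fun n : ℕ => ArithmeticFunction.vonMangoldt n * ((n : ℝ) ^ 2)⁻¹ := by
  have := (ArithmeticFunction.LSeriesSummable_vonMangoldt (s := 2) (by norm_num)).norm
  simpa only [norm_LSeries_term_vonMangoldt_two] using this

/-- Perron's formula for `-ζ'/ζ`, on the line `Re s = 2`. -/
theorem tendsto_perron_logDeriv_riemannZeta {x : ℝ} (hx : 0 < x) :
    Tendsto (fun T : ℝ => ∫ t : ℝ in (-T)..T, -logDeriv riemannZeta (2 + t * Complex.I) *
      ((x : ℂ) ^ (2 + t * Complex.I) / (2 + t * Complex.I))) atTop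
      (𝓝 (2 * Real.pi * chebyshevPsiNormalized x)) := by
  have hx0 : (x : ℂ) ≠ 0 := by exact_mod_cast hx.ne'
  set Λ' : ℕ → ℂ := fun n => (ArithmeticFunction.vonMangoldt n : ℂ) with hΛ
  have hterm : ∀ (n : ℕ) (s : ℂ), LSeries.term Λ' s n * ((x : ℂ) ^ s / s) =
      Λ' n * (Complex.exp ((Real.log x - Real.log n : ℝ) * s) / s) := by
    intro n s
    rcases Nat.eq_zero_or_pos n with rfl | hn
    · simp [hΛ]
    · have hn0 : (n : ℂ) ≠ 0 := by exact_mod_cast hn.ne'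
      rw [LSeries.term_of_ne_zero hn.ne', Complex.cpow_def_of_ne_zero hn0,
        Complex.cpow_def_of_ne_zero hx0, Complex.ofReal_sub, sub_mul, Complex.exp_sub,
        Complex.ofReal_log hx.le, Complex.ofReal_log (Nat.cast_nonneg n), Complex.ofReal_natCast]
      ring
  have hswap : ∀ T : ℝ, 0 ≤ T → ∫ t : ℝ in (-T)..T, -logDeriv riemannZeta (2 + t * Complex.I) *
      ((x : ℂ) ^ (2 + t * Complex.I) / (2 + t * Complex.I)) =
      ∑' n : ℕ, Λ' n * perronKernel (Real.log x - Real.log n) T := by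
    intro T hT
    have h2 : ∀ t : ℝ, (2 : ℝ) ≤ ‖(2 + t * Complex.I : ℂ)‖ := by
      intro t
      have := Complex.abs_re_le_norm (2 + t * Complex.I)
      simpa using this
    have hne : ∀ t : ℝ, (2 + t * Complex.I : ℂ) ≠ 0 := fun t =>
      norm_pos_iff.1 (by linarith [h2 t])
    have hs := intervalIntegral.hasSum_integral_of_dominated_convergence (a := -T) (b := T)
      (μ := MeasureTheory.volume)
      (F := fun (n : ℕ) (t : ℝ) => LSeries.term Λ' (2 + t * Complex.I) n *
        ((x : ℂ) ^ (2 + t * Complex.I) / (2 + t * Complex.I)))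
      (f := fun t : ℝ => -logDeriv riemannZeta (2 + t * Complex.I) *
        ((x : ℂ) ^ (2 + t * Complex.I) / (2 + t * Complex.I)))
      (fun n _ => ‖LSeries.term Λ' 2 n‖ * (x ^ 2 / 2)) (by
        intro n
        simp only [hterm]
        apply Continuous.aestronglyMeasurable
        exact continuous_const.mul (Continuous.div (by fun_prop) (by fun_prop) hne)) (by
        intro n
        refine Eventually.of_forall fun t _ => ?_
        rw [norm_mul]
        have h3 : ‖LSeries.term Λ' (2 + t * Complex.I) n‖ ≤ ‖LSeries.term Λ' 2 n‖ :=
          LSeries.norm_term_le_of_re_le_re _ (by simp) n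
        have h4 : ‖(x : ℂ) ^ (2 + t * Complex.I) / (2 + t * Complex.I)‖ ≤ x ^ 2 / 2 := by
          rw [norm_div, Complex.norm_cpow_eq_rpow_re_of_pos hx]
          have : (2 + t * Complex.I : ℂ).re = 2 := by simp
          rw [this, Real.rpow_two]
          have := h2 t
          gcongr
        gcongr) (by
        refine Eventually.of_forall fun t _ => ?_
        exact (summable_vonMangoldt_mul_inv_sq.mul_right _).congr fun n => by
          rw [norm_LSeries_term_vonMangoldt_two]) (by
        exact intervalIntegrable_const) (by
        refine Eventually.of_forall fun t _ => ?_
        have hre : 1 < (2 + t * Complex.I : ℂ).re := by simp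
        rw [logDeriv_riemannZeta_eq hre, neg_neg]
        exact (ArithmeticFunction.LSeriesSummable_vonMangoldt hre).hasSum.mul_right _)
    rw [← hs.tsum_eq]
    refine tsum_congr fun n => ?_
    simp only [hterm]
    rw [intervalIntegral.integral_const_mul]
    rfl
  obtain ⟨C, hC⟩ := exists_norm_perronKernel_le hx
  have hlim : Tendsto (fun T : ℝ => ∑' n : ℕ, Λ' n * perronKernel (Real.log x - Real.log n) T) atTop
      (𝓝 (∑' n : ℕ, Λ' n * (2 * Real.pi * chebyshevWeight x n))) := by
    refine tendsto_tsum_of_dominated_convergence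
      (bound := fun n => C * (ArithmeticFunction.vonMangoldt n * ((n : ℝ) ^ 2)⁻¹))
      (summable_vonMangoldt_mul_inv_sq.mul_left C) ?_ ?_
    · intro n
      rcases Nat.eq_zero_or_pos n with rfl | hn
      · simp [hΛ]
      · exact (tendsto_perronKernel_log_sub hx hn).const_mul _
    · filter_upwards [hC] with T hT n
      rcases Nat.eq_zero_or_pos n with rfl | hn
      · simp [hΛ]
      · have h0 : 0 ≤ ArithmeticFunction.vonMangoldt n := ArithmeticFunction.vonMangoldt_nonneg
        rw [norm_mul, hΛ, Complex.norm_real, Real.norm_of_nonneg h0]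
        have := mul_le_mul_of_nonneg_left (hT n hn) h0
        linarith
  have hval : ∑' n : ℕ, Λ' n * (2 * Real.pi * chebyshevWeight x n) =
      2 * Real.pi * chebyshevPsiNormalized x := by
    rw [chebyshevPsiNormalized, Complex.ofReal_tsum, ← tsum_mul_left]
    refine tsum_congr fun n => ?_
    rw [hΛ]
    push_cast
    ring
  rw [hval] at hlim
  refine hlim.congr' ?_
  filter_upwards [eventually_ge_atTop 0] with T hT using (hswap T hT).symm

/-! ### Zeros near a given height and good heights. -/

/-- The zeros of `ζ` in the closed disc of radius `21 / 8` centred at `2 + it`. -/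
noncomputable def zetaZerosNear (t : ℝ) : Finset ℂ :=
  ((isCompact_closedBall (2 + t * Complex.I : ℂ) (21 / 8)).inter_riemannZetaZeros_finite).toFinset

theorem mem_zetaZerosNear {t : ℝ} {p : ℂ} : p ∈ zetaZerosNear t ↔
    p ∈ Metric.closedBall (2 + t * Complex.I : ℂ) (21 / 8) ∧ riemannZeta p = 0 := by
  simp [zetaZerosNear, mem_riemannZetaZeros]

theorem mem_zetaZerosNear_of_im {t : ℝ} {p : ℂ} (hp : riemannZeta p = 0) (h0 : 0 < p.re)
    (h1 : p.re < 1) (him : |p.im - t| ≤ 3 / 2) : p ∈ zetaZerosNear t := by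
  refine mem_zetaZerosNear.2 ⟨?_, hp⟩
  rw [Metric.mem_closedBall, Complex.dist_eq_re_im]
  apply Real.sqrt_le_iff.2 ⟨by norm_num, ?_⟩
  have h2 : (p.im - t) ^ 2 ≤ (3 / 2) ^ 2 := sq_le_sq' (by linarith [(abs_le.1 him).1])
    (abs_le.1 him).2
  simp only [Complex.add_re, Complex.re_ofNat, Complex.mul_re, Complex.ofReal_re, Complex.I_re,
    mul_zero, Complex.ofReal_im, Complex.I_im, mul_one, sub_self, add_zero, Complex.add_im,
    Complex.im_ofNat, Complex.mul_im, zero_add]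
  nlinarith

theorem one_le_analyticOrderNatAt_riemannZeta {p : ℂ} (hp : riemannZeta p = 0) :
    1 ≤ analyticOrderNatAt riemannZeta p := by
  have hp1 : p ≠ 1 := by
    rintro rfl
    exact riemannZeta_one_ne_zero hp
  have h1 := Nat.cast_analyticOrderNatAt (analyticOrderAt_riemannZeta_ne_top hp1)
  have h2 : analyticOrderAt riemannZeta p ≠ 0 :=
    (analyticOn_riemannZeta p hp1).analyticOrderAt_ne_zero.2 hp
  rw [← h1] at h2
  exact Nat.one_le_iff_ne_zero.2 (by exact_mod_cast h2)

/-- Pigeonhole on the midpoints of N + 1 equal subintervals, N being the size of `A`. Otherwise two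
of them would be less than half a subinterval from the same point of `A`, yet they differ by at
least a full subinterval. -/
theorem exists_mem_Icc_gap (A : Finset ℝ) (T : ℝ) :
    ∃ t ∈ Set.Icc T (T + 1), ∀ a ∈ A, 1 / (2 * (A.card + 1) : ℝ) ≤ |t - a| := by
  by_contra! hcon
  set N := A.card with hN
  have hNp : (0 : ℝ) < N + 1 := by positivity
  have hpt : ∀ k ∈ Finset.range (N + 1), ∃ a ∈ A,
      |T + (k + 1 / 2) / (N + 1) - a| < 1 / (2 * (N + 1) : ℝ) := by
    intro k hk
    have hk' : (k : ℝ) + 1 ≤ N + 1 := by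
      have := Finset.mem_range.1 hk
      exact_mod_cast this
    apply hcon
    constructor
    · have : (0 : ℝ) ≤ (k + 1 / 2) / (N + 1) := by positivity
      linarith
    · have : ((k : ℝ) + 1 / 2) / (N + 1) ≤ 1 := by
        rw [div_le_one hNp]
        linarith
      linarith
  choose! g hgA hg using hpt
  obtain ⟨k, hk, l, hl, hkl, hgkl⟩ := Finset.exists_ne_map_eq_of_card_lt_of_maps_to
    (s := Finset.range (N + 1)) (t := A) (by simp [hN]) (f := g) (fun k hk => hgA k hk)
  have h1 := hg k hk
  have h2 := hg l hl
  rw [← hgkl] at h2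
  have h3 : |((k : ℝ) - l) / (N + 1)| < 1 / (N + 1) := by
    have e : ((k : ℝ) - l) / (N + 1) = (T + (k + 1 / 2) / (N + 1) - g k) -
        (T + (l + 1 / 2) / (N + 1) - g k) := by
      field_simp
      ring
    rw [e]
    refine (abs_sub _ _).trans_lt ((add_lt_add h1 h2).trans_eq ?_)
    field_simp
    norm_num
  rw [abs_div, abs_of_pos hNp, div_lt_div_iff_of_pos_right hNp] at h3
  have h4 : |(k : ℤ) - l| < 1 := by exact_mod_cast h3
  rw [Int.abs_lt_one_iff, sub_eq_zero] at h4
  exact hkl (by exact_mod_cast h4)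

theorem logDeriv_riemannZeta_conj (s : ℂ) :
    logDeriv riemannZeta ((starRingEnd ℂ) s) = (starRingEnd ℂ) (logDeriv riemannZeta s) := by
  have h : riemannZeta = (starRingEnd ℂ) ∘ riemannZeta ∘ (starRingEnd ℂ) := by
    funext z
    simp [riemannZeta_conj]
  rw [logDeriv_apply, logDeriv_apply, map_div₀, ← riemannZeta_conj]
  congr 1
  have h2 := congrFun (deriv_conj_conj (f := riemannZeta)) ((starRingEnd ℂ) s)
  rw [← h] at h2
  simpa using h2

theorem log_add_one_le_two_mul_log {T : ℝ} (hT : 2 ≤ T) : Real.log (T + 1) ≤ 2 * Real.log T := by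
  have : (2 : ℝ) * Real.log T = Real.log (T ^ 2) := by rw [Real.log_pow]; norm_num
  rw [this]
  exact Real.log_le_log (by linarith) (by nlinarith)

/-- Zeros near height `±T` number `O(log T)`. -/
theorem exists_sum_zetaZerosNear_le : ∃ C : ℝ, 0 < C ∧ ∀ t : ℝ, 4 ≤ |t| →
    ∑ p ∈ zetaZerosNear t, (analyticOrderNatAt riemannZeta p : ℝ) ≤ C * Real.log |t| := by
  obtain ⟨C, hC, h⟩ := exists_riemannZeta_local_bound
  exact ⟨C, hC, fun t ht => (h t _ ht fun p => mem_zetaZerosNear).1⟩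

/-- Every unit interval contains a height on which `ζ'/ζ` is `O(log² T)`. -/
theorem exists_good_height : ∃ C : ℝ, 0 < C ∧ ∀ T : ℝ, 6 ≤ T → ∃ t ∈ Set.Icc T (T + 1),
    (∀ p, riemannZeta p = 0 → |p.im| ≠ t) ∧ ∀ s : ℂ, -(1 / 2) ≤ s.re → s.re ≤ 2 → |s.im| = t →
      ‖logDeriv riemannZeta s‖ ≤ C * Real.log t ^ 2 := by
  obtain ⟨C, hC, hloc⟩ := exists_riemannZeta_local_bound
  refine ⟨C * (2 * (C * 2 + 1)) + C, by positivity, fun T hT => ?_⟩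
  -- There are O(log T) zeros nearby, so some height has distance ≫ 1/log T from all of them. A sum
  -- of O(log T) terms, each O(log T), then gives log².
  obtain ⟨t, ht, hgap⟩ := exists_mem_Icc_gap ((zetaZerosNear (T + 1 / 2)).image Complex.im) T
  set N := ((zetaZerosNear (T + 1 / 2)).image Complex.im).card with hN
  have ht1 := ht.1
  have ht2 := ht.2
  have htpos : 0 < t := by linarith
  have hlog1 : 1 ≤ Real.log t := by
    rw [Real.le_log_iff_exp_le htpos]
    linarith [Real.exp_one_lt_d9]
  have hNle : (N : ℝ) ≤ C * 2 * Real.log t := by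
    have h1 : (N : ℝ) ≤ (zetaZerosNear (T + 1 / 2)).card := by
      exact_mod_cast Finset.card_image_le
    have h2 : ((zetaZerosNear (T + 1 / 2)).card : ℝ) ≤
        ∑ p ∈ zetaZerosNear (T + 1 / 2), (analyticOrderNatAt riemannZeta p : ℝ) := by
      rw [← nsmul_one, ← Finset.sum_const]
      refine Finset.sum_le_sum fun p hp => ?_
      exact_mod_cast one_le_analyticOrderNatAt_riemannZeta (mem_zetaZerosNear.1 hp).2
    have h3 := (hloc (T + 1 / 2) (zetaZerosNear (T + 1 / 2))
      (by rw [abs_of_pos (by linarith)]; linarith) fun p => mem_zetaZerosNear).1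
    rw [abs_of_pos (by linarith : 0 < T + 1 / 2)] at h3
    have h4 : Real.log (T + 1 / 2) ≤ 2 * Real.log t :=
      (Real.log_le_log (by linarith) (by linarith : T + 1 / 2 ≤ t + 1)).trans
        (log_add_one_le_two_mul_log (by linarith))
    calc (N : ℝ) ≤ C * Real.log (T + 1 / 2) := h1.trans (h2.trans h3)
      _ ≤ C * (2 * Real.log t) := by gcongr
      _ = _ := by ring
  have hNp : (0 : ℝ) < 2 * (N + 1) := by positivity
  -- A zero within 1 of height t lies within 3/2 of T + 1/2, so it was among those avoided; all
  -- others are farther than the gap, which is at most 1.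
  have hsep : ∀ p, riemannZeta p = 0 → 1 / (2 * (N + 1) : ℝ) ≤ |t - p.im| := by
    intro p hp
    by_contra! hlt
    have h1 : |t - p.im| < 1 := by
      refine hlt.trans_le ?_
      rw [div_le_one hNp]
      linarith [Nat.cast_nonneg (α := ℝ) N]
    obtain ⟨h2, h3⟩ := abs_lt.1 h1
    obtain ⟨h4, h5⟩ := re_mem_Ioo_of_riemannZeta_eq_zero hp (by intro h; rw [h] at h3; linarith)
    have h6 := mem_zetaZerosNear_of_im (t := T + 1 / 2) hp h4 h5
      (abs_le.2 ⟨by linarith, by linarith⟩)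
    exact absurd (hgap p.im (Finset.mem_image_of_mem _ h6)) (not_le.2 hlt)
  have hgp : (0 : ℝ) < 1 / (2 * (N + 1) : ℝ) := by positivity
  have hup : ∀ s : ℂ, -(1 / 2) ≤ s.re → s.re ≤ 2 → s.im = t →
      ‖logDeriv riemannZeta s‖ ≤ (C * (2 * (C * 2 + 1)) + C) * Real.log t ^ 2 := by
    intro s hs1 hs2 hst
    have hs0 : riemannZeta s ≠ 0 := by
      intro h
      have := hsep s h
      rw [hst, sub_self, abs_zero] at this
      linarith
    obtain ⟨h1, h2⟩ := hloc t (zetaZerosNear t) (by rw [abs_of_pos htpos]; linarith)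
      fun p => mem_zetaZerosNear
    have hball : s ∈ Metric.closedBall (2 + t * Complex.I : ℂ) (5 / 2) := by
      rw [Metric.mem_closedBall, Complex.dist_eq_re_im]
      apply Real.sqrt_le_iff.2 ⟨by norm_num, ?_⟩
      simp [hst]
      nlinarith
    have h3 := h2 s hball hs0
    rw [abs_of_pos htpos] at h1 h3
    have h4 : ‖∑ p ∈ zetaZerosNear t, (analyticOrderNatAt riemannZeta p : ℂ) * (s - p)⁻¹‖ ≤
        C * Real.log t * (2 * (N + 1)) := by
      calc _ ≤ ∑ p ∈ zetaZerosNear t, ‖(analyticOrderNatAt riemannZeta p : ℂ) * (s - p)⁻¹‖ :=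
            norm_sum_le _ _
        _ ≤ ∑ p ∈ zetaZerosNear t, (analyticOrderNatAt riemannZeta p : ℝ) * (2 * (N + 1)) := by
            refine Finset.sum_le_sum fun p hp => ?_
            rw [norm_mul, Complex.norm_natCast, norm_inv]
            have h5 := hsep p (mem_zetaZerosNear.1 hp).2
            have h6 : 1 / (2 * (N + 1) : ℝ) ≤ ‖s - p‖ := by
              refine h5.trans ?_
              rw [← hst, ← Complex.sub_im]
              exact Complex.abs_im_le_norm _
            gcongr
            rw [one_div] at h6
            exact inv_le_of_inv_le₀ hNp h6
        _ = (∑ p ∈ zetaZerosNear t, (analyticOrderNatAt riemannZeta p : ℝ)) * (2 * (N + 1)) := by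
            rw [Finset.sum_mul]
        _ ≤ _ := by gcongr
    have h5 := norm_add_le (logDeriv riemannZeta s -
      ∑ p ∈ zetaZerosNear t, (analyticOrderNatAt riemannZeta p : ℂ) * (s - p)⁻¹)
      (∑ p ∈ zetaZerosNear t, (analyticOrderNatAt riemannZeta p : ℂ) * (s - p)⁻¹)
    rw [sub_add_cancel] at h5
    set l := Real.log t with hl
    have h6 : (2 * (N + 1) : ℝ) ≤ 2 * (C * 2 + 1) * l := by nlinarith
    have h7 : C * l * (2 * (N + 1)) ≤ C * l * (2 * (C * 2 + 1) * l) := by gcongr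
    have h8 : C * l ≤ C * (l * l) := by
      gcongr
      nlinarith
    calc _ ≤ C * l + C * l * (2 * (C * 2 + 1) * l) := by linarith
      _ ≤ C * (l * l) + C * l * (2 * (C * 2 + 1) * l) := by linarith
      _ = _ := by ring
  refine ⟨t, ht, ?_, ?_⟩
  · intro p hp hpt
    rcases abs_eq htpos.le |>.1 hpt with h | h
    · have := hsep p hp
      rw [h, sub_self, abs_zero] at this
      linarith
    · have := hsep ((starRingEnd ℂ) p) (by rw [riemannZeta_conj, hp, map_zero])
      rw [Complex.conj_im, h, neg_neg, sub_self, abs_zero] at this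
      linarith
  · intro s hs1 hs2 hst
    rcases abs_eq htpos.le |>.1 hst with h | h
    · exact hup s hs1 hs2 h
    · have := hup ((starRingEnd ℂ) s) (by simpa using hs1) (by simpa using hs2) (by simp [h])
      rwa [logDeriv_riemannZeta_conj, Complex.norm_conj] at this

/-- The tangent at π(1 - s)/2 is bounded away from the real axis, which covers the horizontal sides,
and on the lines Re s = -(2K + 1), where the argument has real part (K + 1)π; these cover the left
side. -/
theorem exists_norm_logDeriv_riemannZeta_left_le : ∃ C : ℝ, 0 ≤ C ∧ ∀ s : ℂ, s.re ≤ -(1 / 2) →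
    (1 ≤ |s.im| ∨ ∃ K : ℕ, s.re = -(2 * K + 1)) →
    ‖logDeriv riemannZeta s‖ ≤ C * √‖1 - s‖ := by
  obtain ⟨C, hC, h⟩ := exists_norm_logDeriv_riemannZeta_one_sub_le
  refine ⟨C, hC, fun s hs hor => ?_⟩
  have hsub : 1 - (1 - s) = s := by ring
  have key : ‖Complex.sin (Real.pi * (1 - s) / 2)‖ ≤ 2 * ‖Complex.cos (Real.pi * (1 - s) / 2)‖ ∧
      Complex.cos (Real.pi * (1 - s) / 2) ≠ 0 := by
    rcases hor with him | ⟨K, hK⟩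
    · apply norm_sin_le_two_mul_norm_cos
      have : (Real.pi * (1 - s) / 2 : ℂ).im = -(Real.pi / 2 * s.im) := by
        rw [show (Real.pi * (1 - s) / 2 : ℂ) = ((Real.pi / 2 : ℝ) : ℂ) * (1 - s) by push_cast; ring,
          Complex.im_ofReal_mul]
        simp
      rw [this, abs_neg, abs_mul, abs_of_pos (by positivity)]
      nlinarith [Real.pi_gt_three]
    · have : (Real.pi * (1 - s) / 2 : ℂ) =
          ((K + 1 : ℤ) : ℂ) * Real.pi + ((-(Real.pi / 2 * s.im) : ℝ) : ℂ) * Complex.I := by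
        have e : s = (-(2 * K + 1) : ℝ) + s.im * Complex.I := by
          rw [← hK]; exact (Complex.re_add_im s).symm
        conv_lhs => rw [e]
        push_cast
        ring
      rw [this]
      obtain ⟨h1, h2⟩ := norm_sin_le_norm_cos_of_int_mul_pi (K + 1) (-(Real.pi / 2 * s.im))
      exact ⟨by linarith [norm_nonneg (Complex.cos (((K + 1 : ℤ) : ℂ) * Real.pi +
        ((-(Real.pi / 2 * s.im) : ℝ) : ℂ) * Complex.I))], h2⟩
  have := h (1 - s) (by simp; linarith) key.1 key.2
  rwa [hsub] at this

/-! ### Residues and the explicit formula. -/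

/-- The integrand of Perron's formula for `ψ₀`. -/
noncomputable def perronIntegrand (x : ℝ) (s : ℂ) : ℂ :=
  -logDeriv riemannZeta s * ((x : ℂ) ^ s / s)

/-- The residues of `perronIntegrand`. -/
noncomputable def perronResidue (x : ℝ) (p : ℂ) : ℂ :=
  if p = 0 then -Complex.log (2 * Real.pi) else if p = 1 then x else
    -(analyticOrderNatAt riemannZeta p * ((x : ℂ) ^ p / p))

theorem analyticAt_ofReal_cpow {x : ℝ} (hx : 0 < x) (p : ℂ) :
    AnalyticAt ℂ (fun s : ℂ => (x : ℂ) ^ s) p := by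
  have hd : Differentiable ℂ (fun s : ℂ => (x : ℂ) ^ s) := fun s =>
    differentiableAt_id.const_cpow (Or.inl (by exact_mod_cast hx.ne'))
  exact hd.analyticAt p

theorem analyticAt_logDeriv_riemannZeta {p : ℂ} (hp1 : p ≠ 1) (hp : riemannZeta p ≠ 0) :
    AnalyticAt ℂ (logDeriv riemannZeta) p :=
  (analyticOn_riemannZeta p hp1).deriv.div (analyticOn_riemannZeta p hp1) hp

theorem differentiableAt_perronIntegrand {x : ℝ} (hx : 0 < x) {s : ℂ} (h0 : s ≠ 0) (h1 : s ≠ 1)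
    (hs : riemannZeta s ≠ 0) : DifferentiableAt ℂ (perronIntegrand x) s :=
  ((analyticAt_logDeriv_riemannZeta h1 hs).neg.mul
    ((analyticAt_ofReal_cpow hx s).div analyticAt_id h0)).differentiableAt

/-- At 0 the pole is that of 1/s, weighted by ζ'/ζ(0) = log(2π); at 1 it comes from the simple pole
of ζ; elsewhere from the order of vanishing, which is 0 at a nonzero value of ζ. -/
theorem exists_perronIntegrand_eq {x : ℝ} (hx : 0 < x) (p : ℂ) :
    ∃ g : ℂ → ℂ, AnalyticAt ℂ g p ∧
      ∀ᶠ s in 𝓝[≠] p, perronIntegrand x s = g s + perronResidue x p * (s - p)⁻¹ := by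
  by_cases hp0 : p = 0
  · rw [hp0]
    have hζ0 : riemannZeta 0 ≠ 0 := by rw [riemannZeta_zero]; norm_num
    obtain ⟨g, hg, hgs⟩ := exists_analyticAt_mul_inv_sub
      (k := fun s => -logDeriv riemannZeta s * (x : ℂ) ^ s) (p := 0)
      ((analyticAt_logDeriv_riemannZeta (by simp) hζ0).neg.mul (analyticAt_ofReal_cpow hx 0))
    refine ⟨g, hg, ?_⟩
    filter_upwards [self_mem_nhdsWithin] with s hs
    have h := hgs s hs
    have hval : logDeriv riemannZeta 0 = Complex.log (2 * Real.pi) := by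
      rw [logDeriv_apply, deriv_riemannZeta_zero, riemannZeta_zero]
      ring
    rw [Complex.cpow_zero, mul_one, hval] at h
    simp only [perronResidue, if_true]
    rw [← h, perronIntegrand, sub_zero]
    ring
  by_cases hp1 : p = 1
  · rw [hp1]
    obtain ⟨g, hg, hgs⟩ := exists_analyticAt_mul_inv_sub
      (k := fun s => (x : ℂ) ^ s / s) (p := 1)
      ((analyticAt_ofReal_cpow hx 1).div analyticAt_id one_ne_zero)
    have h₁ : AnalyticAt ℂ riemannZeta₁ 1 := differentiable_riemannZeta₁.analyticAt 1
    have hl₁ : AnalyticAt ℂ (logDeriv riemannZeta₁) 1 := h₁.deriv.div h₁ (by simp)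
    refine ⟨fun s => -logDeriv riemannZeta₁ s * ((x : ℂ) ^ s / s) + g s,
      (hl₁.neg.mul ((analyticAt_ofReal_cpow hx 1).div analyticAt_id one_ne_zero)).add hg, ?_⟩
    filter_upwards [self_mem_nhdsWithin,
      riemannZeta₁_ne_zero_of_near_one.filter_mono nhdsWithin_le_nhds] with s hs hs1
    have hs : s ≠ 1 := hs
    have hs' : s - 1 ≠ 0 := sub_ne_zero.2 hs
    have h := hgs s hs
    have hlog : logDeriv riemannZeta s = -(s - 1)⁻¹ + logDeriv riemannZeta₁ s := by
      have e : riemannZeta =ᶠ[𝓝 s] fun z => (z - 1)⁻¹ * riemannZeta₁ z := by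
        filter_upwards [isOpen_ne.mem_nhds hs] with z hz using riemannZeta_eq_inv_sub_mul hz
      have m := logDeriv_mul (f := fun z : ℂ => (z - 1)⁻¹) (g := riemannZeta₁) s
        (inv_ne_zero hs') hs1 (by fun_prop (disch := assumption))
        (differentiable_riemannZeta₁ s)
      rw [(logDeriv_congr_nhds e).self_of_nhds, m]
      congr 1
      have hd : HasDerivAt (fun z : ℂ => (z - 1)⁻¹) (-1 / (s - 1) ^ 2) s :=
        ((hasDerivAt_id s).sub_const 1).fun_inv hs'
      rw [logDeriv_apply, hd.deriv]
      field_simp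
    simp only [perronResidue, one_ne_zero, if_false, if_true]
    rw [Complex.cpow_one, div_one] at h
    rw [perronIntegrand, hlog]
    linear_combination h
  · have hza := analyticOn_riemannZeta p hp1
    obtain ⟨g, hg, hgs⟩ := hza.exists_logDeriv_eq (analyticOrderAt_riemannZeta_ne_top hp1)
    have hk : AnalyticAt ℂ (fun s : ℂ => (x : ℂ) ^ s / s) p :=
      (analyticAt_ofReal_cpow hx p).div analyticAt_id hp0
    obtain ⟨g', hg', hgs'⟩ := exists_analyticAt_mul_inv_sub hk
    refine ⟨fun s => -(g s * ((x : ℂ) ^ s / s)) - analyticOrderNatAt riemannZeta p * g' s,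
      (hg.mul hk).neg.sub (analyticAt_const.mul hg'), ?_⟩
    filter_upwards [self_mem_nhdsWithin, hgs] with s hs h
    have h' := hgs' s hs
    simp only [perronResidue, hp0, hp1, if_false]
    rw [perronIntegrand, h.2]
    linear_combination -(analyticOrderNatAt riemannZeta p : ℂ) * h'

theorem mem_nontrivialZetaZeros_toFinset {T : ℝ} {p : ℂ} :
    p ∈ (finite_nontrivialZetaZeros T).toFinset ↔
      riemannZeta p = 0 ∧ 0 < p.re ∧ p.re < 1 ∧ |p.im| < T := by
  rw [Set.Finite.mem_toFinset]
  rfl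

/-- The explicit formula on the rectangle `[-(2K + 1), 2] × [-T, T]`. -/
theorem rectIntegral_perronIntegrand {x T : ℝ} (hx : 0 < x) (hT : 0 < T)
    (hgood : ∀ p, riemannZeta p = 0 → |p.im| ≠ T) (K : ℕ) :
    rectIntegral (perronIntegrand x) (-(2 * K + 1)) 2 (-T) T = 2 * Real.pi * Complex.I *
      (x - Complex.log (2 * Real.pi) - zetaZeroPartialSum x T +
        ∑ k ∈ Finset.range K, ((x : ℂ) ^ (2 * (k + 1)))⁻¹ / (2 * (k + 1))) := by
  classical
  set Z := (finite_nontrivialZetaZeros T).toFinset with hZ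
  set tz : ℕ → ℂ := fun k => -2 * (k + 1) with htz
  set W := (Finset.range K).image tz with hW
  have htzre : ∀ k, (tz k).re = -2 * (k + 1) := by intro k; simp [htz]
  have htzim : ∀ k, (tz k).im = 0 := by intro k; simp [htz]
  have htz0 : ∀ k, tz k ≠ 0 ∧ tz k ≠ 1 := by
    intro k
    have h := htzre k
    have hk := Nat.cast_nonneg (α := ℝ) k
    constructor
    · intro h0
      rw [h0] at h
      simp at h
      linarith
    · intro h0
      rw [h0] at h
      simp at h
      linarith
  have htzinj : Function.Injective tz := by
    intro k l hkl
    have h := congrArg Complex.re hkl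
    rw [htzre, htzre] at h
    have : (k : ℝ) = l := by linarith
    exact_mod_cast this
  have hdisj : Disjoint Z W := by
    rw [Finset.disjoint_left]
    intro p hp hpW
    obtain ⟨k, _, rfl⟩ := Finset.mem_image.1 hpW
    have := (mem_nontrivialZetaZeros_toFinset.1 hp).2.1
    rw [htzre] at this
    have hk := Nat.cast_nonneg (α := ℝ) k
    linarith
  have h1 : (1 : ℂ) ∉ Z ∪ W := by
    rw [Finset.mem_union, not_or]
    constructor
    · intro h
      have := (mem_nontrivialZetaZeros_toFinset.1 h).2.2.1
      simp at this
    · intro h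
      obtain ⟨k, _, hk⟩ := Finset.mem_image.1 h
      exact (htz0 k).2 hk
  have h0 : (0 : ℂ) ∉ insert 1 (Z ∪ W) := by
    rw [Finset.mem_insert, Finset.mem_union, not_or, not_or]
    refine ⟨by simp, ?_, ?_⟩
    · intro h
      have := (mem_nontrivialZetaZeros_toFinset.1 h).2.1
      simp at this
    · intro h
      obtain ⟨k, _, hk⟩ := Finset.mem_image.1 h
      exact (htz0 k).1 hk
  have hsum : ∑ p ∈ insert 0 (insert 1 (Z ∪ W)), perronResidue x p =
      x - Complex.log (2 * Real.pi) - zetaZeroPartialSum x T +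
        ∑ k ∈ Finset.range K, ((x : ℂ) ^ (2 * (k + 1)))⁻¹ / (2 * (k + 1)) := by
    rw [Finset.sum_insert h0, Finset.sum_insert h1, Finset.sum_union hdisj,
      Finset.sum_image htzinj.injOn]
    have e1 : perronResidue x 0 = -Complex.log (2 * Real.pi) := by simp [perronResidue]
    have e2 : perronResidue x 1 = x := by simp [perronResidue]
    have e3 : ∑ p ∈ Z, perronResidue x p = -zetaZeroPartialSum x T := by
      rw [zetaZeroPartialSum, ← Finset.sum_neg_distrib]
      refine Finset.sum_congr rfl fun p hp => ?_
      have hpm := mem_nontrivialZetaZeros_toFinset.1 hp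
      have hp0 : p ≠ 0 := by
        rintro rfl
        simpa using hpm.2.1
      have hp1 : p ≠ 1 := by
        rintro rfl
        simpa using hpm.2.2.1
      simp [perronResidue, hp0, hp1]
    have e4 : ∀ k, perronResidue x (tz k) = ((x : ℂ) ^ (2 * (k + 1)))⁻¹ / (2 * (k + 1)) := by
      intro k
      simp only [perronResidue, (htz0 k).1, (htz0 k).2, if_false]
      have e5 : (x : ℂ) ^ (tz k) = ((x : ℂ) ^ (2 * (k + 1)))⁻¹ := by
        rw [← Complex.cpow_natCast, ← Complex.cpow_neg]
        congr 1
        simp only [htz]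
        push_cast
        ring
      have e6 : analyticOrderNatAt riemannZeta (tz k) = 1 :=
        analyticOrderNatAt_riemannZeta_trivial_zero k
      rw [e5, e6]
      simp only [htz]
      rw [neg_mul, div_neg, Nat.cast_one, one_mul, neg_neg]
    rw [e1, e2, e3, Finset.sum_congr rfl fun k _ => e4 k]
    ring
  rw [← hsum]
  have hK := Nat.cast_nonneg (α := ℝ) K
  refine rectIntegral_eq_sum_residues (by linarith) (by linarith) _ _ _ ?_ ?_
    fun p _ => exists_perronIntegrand_eq hx p
  · intro p hp
    rw [Finset.mem_insert, Finset.mem_insert, Finset.mem_union] at hp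
    rcases hp with rfl | rfl | hp | hp
    · simp only [Complex.zero_re, Complex.zero_im]
      refine ⟨?_, ?_, ?_, ?_⟩ <;> linarith
    · simp only [Complex.one_re, Complex.one_im]
      refine ⟨?_, ?_, ?_, ?_⟩ <;> linarith
    · obtain ⟨_, h2, h3, h4⟩ := mem_nontrivialZetaZeros_toFinset.1 hp
      obtain ⟨h5, h6⟩ := abs_lt.1 h4
      refine ⟨?_, ?_, ?_, ?_⟩ <;> linarith
    · obtain ⟨k, hk, rfl⟩ := Finset.mem_image.1 hp
      have hk1 : (k : ℝ) + 1 ≤ K := by exact_mod_cast Finset.mem_range.1 hk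
      have hk0 := Nat.cast_nonneg (α := ℝ) k
      rw [htzre, htzim]
      refine ⟨?_, ?_, ?_, ?_⟩ <;> linarith
  · intro s hs1 hs2 hs3 hs4 hs
    rw [Finset.mem_insert, Finset.mem_insert, Finset.mem_union, not_or, not_or, not_or] at hs
    obtain ⟨hs0, hs1', hsZ, hsW⟩ := hs
    refine differentiableAt_perronIntegrand hx hs0 hs1' fun hz => ?_
    rcases le_or_gt s.re 0 with hre | hre
    · obtain ⟨k, rfl⟩ := riemannZeta_eq_zero_of_re_nonpos hz hre
      apply hsW
      refine Finset.mem_image.2 ⟨k, ?_, rfl⟩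
      have h := htzre k
      simp only [htz] at h
      rw [h] at hs1
      have : (2 * k : ℝ) < 2 * K := by linarith
      rw [Finset.mem_range]
      exact_mod_cast (by linarith : (k : ℝ) < K)
    · apply hsZ
      refine mem_nontrivialZetaZeros_toFinset.2 ⟨hz, hre, ?_, ?_⟩
      · by_contra! h
        exact riemannZeta_ne_zero_of_one_le_re h hz
      · exact lt_of_le_of_ne (abs_le.2 ⟨hs3, hs4⟩) (hgood s hz)

/-- The heights `t` at which no zero of `ζ` lies and `ζ'/ζ` is `O(log² t)` near the strip. -/
def goodHeights (C : ℝ) : Set ℝ :=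
  {t | (∀ p, riemannZeta p = 0 → |p.im| ≠ t) ∧ ∀ s : ℂ, -(1 / 2) ≤ s.re → s.re ≤ 2 → |s.im| = t →
    ‖logDeriv riemannZeta s‖ ≤ C * Real.log t ^ 2}

theorem norm_perronIntegrand {x : ℝ} (hx : 0 < x) (s : ℂ) :
    ‖perronIntegrand x s‖ = ‖logDeriv riemannZeta s‖ * (Real.exp (Real.log x * s.re) / ‖s‖) := by
  rw [perronIntegrand, norm_mul, norm_neg, norm_div, Complex.norm_cpow_eq_rpow_re_of_pos hx,
    Real.rpow_def_of_pos hx]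

/-- One bound for a whole horizontal side, with decay t^(-1/2) and integrable as Re s → -∞: near the
strip it uses log² t ≤ 16√t, farther left the square-root bound from the functional equation. -/
theorem exists_norm_perronIntegrand_le {x C : ℝ} (hx : 1 < x) (hC : 0 < C) :
    ∃ B : ℝ, 0 ≤ B ∧ ∀ t ∈ goodHeights C, 1 ≤ t → ∀ s : ℂ, s.re ≤ 2 → |s.im| = t →
      ‖perronIntegrand x s‖ ≤ B * (√t / t) * Real.exp (Real.log x / 2 * s.re) := by
  obtain ⟨C', hC', hleft⟩ := exists_norm_logDeriv_riemannZeta_left_le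
  set L := Real.log x with hL
  have hLp : 0 < L := Real.log_pos hx
  refine ⟨C * 16 * Real.exp L + C' * 2 * (1 + 2 / L), by positivity, ?_⟩
  intro t ht ht1 s hs2 hst
  have ht0 : 0 < t := by linarith
  have hns : t ≤ ‖s‖ := hst ▸ Complex.abs_im_le_norm s
  -- Half of the exponential decay absorbs the linear factor 1 - Re s (or is bounded, near the
  -- strip); the other half is kept for integration.
  have hsplit : Real.exp (L * s.re) = Real.exp (L / 2 * s.re) * Real.exp (L / 2 * s.re) := by
    rw [← Real.exp_add]
    congr 1
    ring
  set E := Real.exp (L / 2 * s.re) with hE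
  have hEp : 0 < E := Real.exp_pos _
  rw [norm_perronIntegrand (by linarith), hsplit]
  rcases le_total (-(1 / 2)) s.re with hre | hre
  · have h1 := ht.2 s hre hs2 hst
    have h2 : Real.log t ^ 2 ≤ 16 * √t := by
      have h3 := Real.log_le_rpow_div ht0.le (show (0 : ℝ) < 1 / 4 by norm_num)
      have h4 : 0 ≤ Real.log t := Real.log_nonneg ht1
      have h5 : (t ^ (1 / 4 : ℝ)) ^ 2 = √t := by
        rw [Real.sqrt_eq_rpow, ← Real.rpow_natCast, ← Real.rpow_mul ht0.le]
        norm_num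
      calc Real.log t ^ 2 ≤ (t ^ (1 / 4 : ℝ) / (1 / 4)) ^ 2 := pow_le_pow_left₀ h4 h3 2
        _ = 16 * (t ^ (1 / 4 : ℝ)) ^ 2 := by ring
        _ = _ := by rw [h5]
    have h3 : E ≤ Real.exp L := Real.exp_le_exp.2 (by nlinarith)
    calc _ ≤ C * (16 * √t) * (E * Real.exp L / t) := by
          have := h1.trans (mul_le_mul_of_nonneg_left h2 hC.le)
          gcongr
      _ = C * 16 * Real.exp L * (√t / t) * E := by ring
      _ ≤ _ := by
          gcongr
          have : 0 ≤ C' * 2 * (1 + 2 / L) := by positivity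
          linarith
  · have h1 := hleft s hre (Or.inl (hst.symm ▸ ht1))
    have h2 : ‖1 - s‖ ≤ 2 * t * (1 - s.re) := by
      have h3 := Complex.norm_le_abs_re_add_abs_im (1 - s)
      simp only [Complex.sub_re, Complex.one_re, Complex.sub_im, Complex.one_im, zero_sub,
        abs_neg, hst] at h3
      rw [abs_of_pos (by linarith)] at h3
      nlinarith
    have h3 : √‖1 - s‖ ≤ 2 * √t * (1 - s.re) := by
      apply Real.sqrt_le_iff.2
      have hst0 := Real.sqrt_nonneg t
      refine ⟨by nlinarith, h2.trans ?_⟩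
      rw [mul_pow, mul_pow, Real.sq_sqrt ht0.le]
      have h4 : 1 ≤ 1 - s.re := by linarith
      have h5 : 1 - s.re ≤ (1 - s.re) ^ 2 := by nlinarith
      have h6 : t * (1 - s.re) ≤ t * (1 - s.re) ^ 2 := by gcongr
      nlinarith
    have h4 : (1 - s.re) * E ≤ 1 + 2 / L := by
      have h5 : E ≤ 1 := Real.exp_le_one_iff.2 (by nlinarith)
      have h6 : -s.re * E ≤ 2 / L := by
        have h7 := Real.add_one_le_exp (-(L / 2 * s.re))
        have h8 : E * Real.exp (-(L / 2 * s.re)) = 1 := by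
          rw [hE, ← Real.exp_add]; simp
        rw [le_div_iff₀ hLp]
        have h9 : E * (-(L / 2 * s.re)) ≤ 1 := by
          rw [← h8]
          exact mul_le_mul_of_nonneg_left (by linarith) hEp.le
        linarith
      linarith
    calc _ ≤ C' * (2 * √t * (1 - s.re)) * (E * E / t) := by
          have := h1.trans (mul_le_mul_of_nonneg_left h3 hC')
          have h9 : 0 ≤ 1 - s.re := by linarith
          gcongr
      _ = C' * 2 * ((1 - s.re) * E) * (√t / t) * E := by ring
      _ ≤ C' * 2 * (1 + 2 / L) * (√t / t) * E := by gcongr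
      _ ≤ _ := by
          gcongr
          have : 0 ≤ C * 16 * Real.exp L := by positivity
          linarith

theorem norm_integral_perronIntegrand_horizontal_le {x t B c : ℝ} (hx : 1 < x)
    (hF : ∀ s : ℂ, s.re ≤ 2 → s.im = c →
      ‖perronIntegrand x s‖ ≤ B * (√t / t) * Real.exp (Real.log x / 2 * s.re))
    (hB : 0 ≤ B) (ht : 0 < t) {a : ℝ} (ha : a ≤ 2) :
    ‖∫ u : ℝ in a..2, perronIntegrand x (u + c * Complex.I)‖ ≤
      B * (√t / t) * (Real.exp (Real.log x) / (Real.log x / 2)) := by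
  have hL : 0 < Real.log x := Real.log_pos hx
  have h1 : ‖∫ u : ℝ in a..2, perronIntegrand x (u + c * Complex.I)‖ ≤
      ∫ u in a..2, B * (√t / t) * Real.exp (Real.log x / 2 * u) := by
    refine intervalIntegral.norm_integral_le_of_norm_le ha
      ((Eventually.of_forall fun u hu => ?_)) (Continuous.intervalIntegrable (by fun_prop) _ _)
    have := hF (u + c * Complex.I) (by simpa using hu.2) (by simp)
    simpa using this
  refine h1.trans ?_
  rw [intervalIntegral.integral_const_mul, integral_exp_mul_eq (by positivity)]
  gcongr
  rw [div_mul_cancel₀ _ two_ne_zero]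
  linarith [Real.exp_pos (Real.log x / 2 * a)]

/-- Tying the left side to K = ⌈t⌉ makes x^s exponentially small in t there, so a single limit t → ∞
suffices. -/
theorem exists_norm_integral_perronIntegrand_vertical_le {x : ℝ} (hx : 1 < x) :
    ∃ B : ℝ, ∀ t : ℝ, 0 < t → ‖∫ y : ℝ in (-t)..t,
      perronIntegrand x ((-(2 * ⌈t⌉₊ + 1) : ℝ) + y * Complex.I)‖ ≤
        B * (t * Real.exp (-Real.log x * t)) := by
  obtain ⟨C, hC, hleft⟩ := exists_norm_logDeriv_riemannZeta_left_le
  have hL : 0 < Real.log x := Real.log_pos hx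
  refine ⟨2 * (2 * C), fun t ht => ?_⟩
  have hK0 := Nat.cast_nonneg (α := ℝ) ⌈t⌉₊
  have hKt := Nat.le_ceil t
  have := intervalIntegral.norm_integral_le_of_norm_le_const (a := -t) (b := t)
    (f := fun y : ℝ => perronIntegrand x ((-(2 * ⌈t⌉₊ + 1) : ℝ) + y * Complex.I))
    (C := 2 * C * Real.exp (-Real.log x * t)) (fun y _ => by
      set s : ℂ := (-(2 * ⌈t⌉₊ + 1) : ℝ) + y * Complex.I with hs
      have hre : s.re = -(2 * ⌈t⌉₊ + 1) := by simp [hs]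
      have h1 := hleft s (by rw [hre]; linarith) (Or.inr ⟨_, hre⟩)
      have hns : 1 ≤ ‖s‖ := by
        refine le_trans ?_ (Complex.abs_re_le_norm s)
        rw [hre, abs_neg, abs_of_pos (by linarith)]
        linarith
      have h2 : √‖1 - s‖ ≤ 2 * ‖s‖ := by
        have h3 := norm_sub_le 1 s
        rw [norm_one] at h3
        apply Real.sqrt_le_iff.2 ⟨by linarith, ?_⟩
        nlinarith
      have h4 : Real.exp (Real.log x * s.re) ≤ Real.exp (-Real.log x * t) := by
        apply Real.exp_le_exp.2
        rw [hre]
        nlinarith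
      rw [norm_perronIntegrand (by linarith)]
      calc _ ≤ C * (2 * ‖s‖) * (Real.exp (-Real.log x * t) / ‖s‖) := by
            have := h1.trans (mul_le_mul_of_nonneg_left h2 hC)
            gcongr
        _ = _ := by field_simp)
  refine this.trans (le_of_eq ?_)
  rw [show t - -t = 2 * t by ring, abs_of_pos (by linarith)]
  ring

theorem tendsto_sum_trivial_zeros {x : ℝ} (hx : 1 < x) :
    Tendsto (fun K : ℕ => ∑ k ∈ Finset.range K, ((x : ℂ) ^ (2 * (k + 1)))⁻¹ / (2 * (k + 1))) atTop
      (𝓝 ((-(1 / 2) * Real.log (1 - (x ^ 2)⁻¹) : ℝ) : ℂ)) := by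
  have hx2 : 1 < x ^ 2 := by nlinarith
  have h0 : 0 < (x ^ 2)⁻¹ := by positivity
  have habs : |(x ^ 2)⁻¹| < 1 := by
    rw [abs_of_pos h0]
    exact inv_lt_one_of_one_lt₀ hx2
  have h1 := ((Real.hasSum_pow_div_log_of_abs_lt_one habs).mul_left (1 / 2)).tendsto_sum_nat
  have h2 := (Complex.continuous_ofReal.tendsto _).comp h1
  rw [show (1 / 2 * -Real.log (1 - (x ^ 2)⁻¹)) = -(1 / 2) * Real.log (1 - (x ^ 2)⁻¹) by ring] at h2
  refine h2.congr fun K => ?_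
  simp only [Function.comp, Complex.ofReal_sum]
  refine Finset.sum_congr rfl fun k _ => ?_
  push_cast
  rw [pow_mul, inv_pow]
  field_simp

/-- The value of the explicit formula. -/
noncomputable def explicitFormulaValue (x : ℝ) : ℝ :=
  x - Real.log (2 * Real.pi) - 1 / 2 * Real.log (1 - (x ^ 2)⁻¹) - chebyshevPsiNormalized x

/-- Solve the residue identity for the sum over zeros: the horizontal and left sides tend to 0, the
right side gives ψ₀, and the trivial zeros sum to the logarithmic series at x⁻². -/
theorem tendsto_zetaZeroPartialSum_goodHeights {x C : ℝ} (hx : 1 < x) (hC : 0 < C) :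
    Tendsto (fun T => zetaZeroPartialSum x T) (atTop ⊓ 𝓟 (goodHeights C))
      (𝓝 (explicitFormulaValue x : ℂ)) := by
  have hx0 : 0 < x := by linarith
  have hL : 0 < Real.log x := Real.log_pos hx
  set l : Filter ℝ := atTop ⊓ 𝓟 (goodHeights C) with hl
  have hlt : l ≤ atTop := inf_le_left
  set F := perronIntegrand x with hF
  set a : ℝ → ℝ := fun t => -(2 * ⌈t⌉₊ + 1) with ha
  set A₁ : ℝ → ℂ := fun t => ∫ u : ℝ in (a t)..2, F (u + (-t : ℝ) * Complex.I) with hA₁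
  set A₂ : ℝ → ℂ := fun t => ∫ u : ℝ in (a t)..2, F (u + t * Complex.I) with hA₂
  set D : ℝ → ℂ := fun t => ∫ y : ℝ in (-t)..t, F (a t + y * Complex.I) with hD
  set V : ℝ → ℂ := fun t => ∫ y : ℝ in (-t)..t, F ((2 : ℝ) + y * Complex.I) with hV
  set S₁ : ℕ → ℂ := fun K =>
    ∑ k ∈ Finset.range K, ((x : ℂ) ^ (2 * (k + 1)))⁻¹ / (2 * (k + 1)) with hS₁
  obtain ⟨B, hB, hBF⟩ := exists_norm_perronIntegrand_le hx hC
  have hgood : ∀ᶠ t in l, t ∈ goodHeights C ∧ 1 ≤ t :=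
    ((eventually_principal.2 fun t ht => ht).filter_mono inf_le_right).and
      ((eventually_ge_atTop 1).filter_mono hlt)
  have ha2 : ∀ t, a t ≤ 2 := by
    intro t
    have := Nat.cast_nonneg (α := ℝ) ⌈t⌉₊
    simp only [ha]
    linarith
  have hsq : Tendsto (fun t : ℝ => B * (√t / t) * (Real.exp (Real.log x) / (Real.log x / 2))) l
      (𝓝 0) := by
    have h1 : Tendsto (fun t : ℝ => √t / t) atTop (𝓝 0) := by
      have : Tendsto (fun t : ℝ => (√t)⁻¹) atTop (𝓝 0) :=
        tendsto_inv_atTop_zero.comp Real.tendsto_sqrt_atTop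
      exact this.congr fun t => by rw [Real.sqrt_div_self', one_div]
    have := ((h1.const_mul B).mul_const (Real.exp (Real.log x) / (Real.log x / 2))).mono_left hlt
    simpa using this
  have hA₁0 : Tendsto A₁ l (𝓝 0) := by
    refine squeeze_zero_norm' ?_ hsq
    filter_upwards [hgood] with t ht
    refine norm_integral_perronIntegrand_horizontal_le hx (fun s hs hst => ?_) hB
      (by linarith [ht.2]) (ha2 t)
    exact hBF t ht.1 ht.2 s hs (by rw [hst, abs_neg, abs_of_pos (by linarith [ht.2])])
  have hA₂0 : Tendsto A₂ l (𝓝 0) := by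
    refine squeeze_zero_norm' ?_ hsq
    filter_upwards [hgood] with t ht
    refine norm_integral_perronIntegrand_horizontal_le hx (fun s hs hst => ?_) hB
      (by linarith [ht.2]) (ha2 t)
    exact hBF t ht.1 ht.2 s hs (by rw [hst, abs_of_pos (by linarith [ht.2])])
  have hD0 : Tendsto D l (𝓝 0) := by
    obtain ⟨B', hB'⟩ := exists_norm_integral_perronIntegrand_vertical_le hx
    have h1 : Tendsto (fun t : ℝ => B' * (t * Real.exp (-Real.log x * t))) atTop (𝓝 0) := by
      have := (tendsto_rpow_mul_exp_neg_mul_atTop_nhds_zero 1 (Real.log x) hL).const_mul B'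
      simpa using this
    refine squeeze_zero_norm' ?_ (h1.mono_left hlt)
    filter_upwards [hgood] with t ht using hB' t (by linarith [ht.2])
  have hV0 : Tendsto V l (𝓝 (2 * Real.pi * chebyshevPsiNormalized x)) := by
    refine ((tendsto_perron_logDeriv_riemannZeta hx0).mono_left hlt).congr fun t => ?_
    simp [hV, hF, perronIntegrand]
  have hS₁0 : Tendsto (fun t : ℝ => S₁ ⌈t⌉₊) l
      (𝓝 ((-(1 / 2) * Real.log (1 - (x ^ 2)⁻¹) : ℝ) : ℂ)) :=
    ((tendsto_sum_trivial_zeros hx).comp tendsto_nat_ceil_atTop).mono_left hlt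
  have hpi : (Real.pi : ℂ) ≠ 0 := by exact_mod_cast Real.pi_ne_zero
  have hS : ∀ᶠ t in l, zetaZeroPartialSum x t = x - Complex.log (2 * Real.pi) + S₁ ⌈t⌉₊ -
      (V t - D t - Complex.I * A₁ t + Complex.I * A₂ t) / (2 * Real.pi) := by
    filter_upwards [hgood] with t ht
    have h := rectIntegral_perronIntegrand hx0 (by linarith [ht.2]) ht.1.1 ⌈t⌉₊
    have h2 : rectIntegral (perronIntegrand x) (-(2 * ⌈t⌉₊ + 1)) 2 (-t) t =
        A₁ t - A₂ t + Complex.I * V t - Complex.I * D t := rfl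
    rw [h2] at h
    field_simp
    linear_combination -Complex.I * h + (V t - D t - 2 * Real.pi * (x - Complex.log (2 * Real.pi) -
      zetaZeroPartialSum x t + S₁ ⌈t⌉₊)) * Complex.I_sq
  have hlim := (hS₁0.const_add ((x : ℂ) - Complex.log (2 * Real.pi))).sub
    ((((hV0.sub hD0).sub (hA₁0.const_mul Complex.I)).add (hA₂0.const_mul Complex.I)).div_const
      (2 * Real.pi : ℂ))
  have hval : (x : ℂ) - Complex.log (2 * Real.pi) +
      ((-(1 / 2) * Real.log (1 - (x ^ 2)⁻¹) : ℝ) : ℂ) -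
      (2 * Real.pi * chebyshevPsiNormalized x - 0 - Complex.I * 0 + Complex.I * 0) /
        (2 * Real.pi) = (explicitFormulaValue x : ℂ) := by
    have h2pi : Complex.log (2 * Real.pi) = ((Real.log (2 * Real.pi) : ℝ) : ℂ) := by
      rw [Complex.ofReal_log (by positivity)]
      push_cast
      rfl
    rw [h2pi, explicitFormulaValue]
    push_cast
    field_simp
    ring
  rw [hval] at hlim
  exact hlim.congr' (hS.mono fun t ht => ht.symm)

/-- Each zero gained has |x^ρ| ≤ x and |ρ| ≥ T, and lies near height T + 1/2 or -(T + 1/2). With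
O(log T) such zeros, the limit along good heights passes to all T. -/
theorem norm_zetaZeroPartialSum_sub_le {x : ℝ} (hx : 1 < x) {T t : ℝ} (hT : 6 ≤ T) (hTt : T ≤ t)
    (ht : t ≤ T + 1) : ‖zetaZeroPartialSum x t - zetaZeroPartialSum x T‖ ≤
      x / T * (∑ p ∈ zetaZerosNear (T + 1 / 2), (analyticOrderNatAt riemannZeta p : ℝ) +
        ∑ p ∈ zetaZerosNear (-(T + 1 / 2)), (analyticOrderNatAt riemannZeta p : ℝ)) := by
  classical
  have hx0 : 0 < x := by linarith
  have hsub : (finite_nontrivialZetaZeros T).toFinset ⊆ (finite_nontrivialZetaZeros t).toFinset := by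
    intro p hp
    obtain ⟨h1, h2, h3, h4⟩ := mem_nontrivialZetaZeros_toFinset.1 hp
    exact mem_nontrivialZetaZeros_toFinset.2 ⟨h1, h2, h3, h4.trans_le hTt⟩
  rw [zetaZeroPartialSum, zetaZeroPartialSum, ← Finset.sum_sdiff hsub, add_sub_cancel_right]
  set Z := (finite_nontrivialZetaZeros t).toFinset \ (finite_nontrivialZetaZeros T).toFinset
    with hZ
  have hmem : ∀ p ∈ Z, riemannZeta p = 0 ∧ 0 < p.re ∧ p.re < 1 ∧ T ≤ |p.im| ∧ |p.im| < t := by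
    intro p hp
    obtain ⟨hp1, hp2⟩ := Finset.mem_sdiff.1 hp
    obtain ⟨h1, h2, h3, h4⟩ := mem_nontrivialZetaZeros_toFinset.1 hp1
    refine ⟨h1, h2, h3, ?_, h4⟩
    by_contra! h
    exact hp2 (mem_nontrivialZetaZeros_toFinset.2 ⟨h1, h2, h3, h⟩)
  have hZsub : Z ⊆ zetaZerosNear (T + 1 / 2) ∪ zetaZerosNear (-(T + 1 / 2)) := by
    intro p hp
    obtain ⟨h1, h2, h3, h4, h5⟩ := hmem p hp
    rw [Finset.mem_union]
    rcases le_total 0 p.im with h | h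
    · left
      rw [abs_of_nonneg h] at h4 h5
      exact mem_zetaZerosNear_of_im h1 h2 h3 (abs_le.2 ⟨by linarith, by linarith⟩)
    · right
      rw [abs_of_nonpos h] at h4 h5
      exact mem_zetaZerosNear_of_im h1 h2 h3 (abs_le.2 ⟨by linarith, by linarith⟩)
  have hterm : ∀ p ∈ Z, ‖(analyticOrderNatAt riemannZeta p : ℂ) * ((x : ℂ) ^ p / p)‖ ≤
      x / T * (analyticOrderNatAt riemannZeta p : ℝ) := by
    intro p hp
    obtain ⟨_, h2, h3, h4, _⟩ := hmem p hp
    have h5 : T ≤ ‖p‖ := h4.trans (Complex.abs_im_le_norm p)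
    have h6 : x ^ p.re ≤ x := by
      calc x ^ p.re ≤ x ^ (1 : ℝ) := Real.rpow_le_rpow_of_exponent_le hx.le h3.le
        _ = x := Real.rpow_one x
    rw [norm_mul, Complex.norm_natCast, norm_div, Complex.norm_cpow_eq_rpow_re_of_pos hx0, mul_comm]
    gcongr
  calc _ ≤ ∑ p ∈ Z, ‖(analyticOrderNatAt riemannZeta p : ℂ) * ((x : ℂ) ^ p / p)‖ :=
        norm_sum_le _ _
    _ ≤ ∑ p ∈ Z, x / T * (analyticOrderNatAt riemannZeta p : ℝ) := Finset.sum_le_sum hterm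
    _ = x / T * ∑ p ∈ Z, (analyticOrderNatAt riemannZeta p : ℝ) := by rw [Finset.mul_sum]
    _ ≤ _ := by
        gcongr
        refine (Finset.sum_le_sum_of_subset_of_nonneg hZsub fun _ _ _ => Nat.cast_nonneg _).trans ?_
        rw [← Finset.sum_union_inter]
        exact le_add_of_nonneg_right (Finset.sum_nonneg fun _ _ => Nat.cast_nonneg _)

/-- The von Mangoldt explicit formula. -/
theorem tendsto_zetaZeroPartialSum {x : ℝ} (hx : 1 < x) :
    Tendsto (fun T => zetaZeroPartialSum x T) atTop (𝓝 (explicitFormulaValue x : ℂ)) := by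
  obtain ⟨C, hC, hgood⟩ := exists_good_height
  obtain ⟨C', hC', hcount⟩ := exists_sum_zetaZerosNear_le
  choose! g hg using hgood
  have hgt : Tendsto g atTop (atTop ⊓ 𝓟 (goodHeights C)) := by
    refine tendsto_inf.2 ⟨?_, ?_⟩
    · refine tendsto_atTop_mono' _ ?_ tendsto_id
      filter_upwards [eventually_ge_atTop 6] with T hT using (hg T hT).1.1
    · rw [tendsto_principal]
      filter_upwards [eventually_ge_atTop 6] with T hT using (hg T hT).2
  have h1 := (tendsto_zetaZeroPartialSum_goodHeights hx hC).comp hgt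
  have h2 : Tendsto (fun T => zetaZeroPartialSum x (g T) - zetaZeroPartialSum x T) atTop (𝓝 0) := by
    have hlog : Tendsto (fun T : ℝ => x * (2 * C' * 2) * (Real.log T / T)) atTop (𝓝 0) := by
      have h3 : Tendsto (fun T : ℝ => Real.log T / T) atTop (𝓝 0) := by
        simpa using Real.isLittleO_log_id_atTop.tendsto_div_nhds_zero
      simpa using h3.const_mul (x * (2 * C' * 2))
    refine squeeze_zero_norm' ?_ hlog
    filter_upwards [eventually_ge_atTop 6] with T hT
    refine (norm_zetaZeroPartialSum_sub_le hx hT (hg T hT).1.1 (hg T hT).1.2).trans ?_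
    have h3 := hcount (T + 1 / 2) (by rw [abs_of_pos (by linarith)]; linarith)
    have h4 := hcount (-(T + 1 / 2)) (by rw [abs_neg, abs_of_pos (by linarith)]; linarith)
    rw [abs_neg] at h4
    rw [abs_of_pos (by linarith)] at h3 h4
    have h5 : Real.log (T + 1 / 2) ≤ 2 * Real.log T :=
      (Real.log_le_log (by linarith) (by linarith)).trans (log_add_one_le_two_mul_log (by linarith))
    have h6 : C' * Real.log (T + 1 / 2) ≤ C' * (2 * Real.log T) := by gcongr
    calc _ ≤ x / T * (C' * (2 * Real.log T) + C' * (2 * Real.log T)) := by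
          have : 0 < x := by linarith
          gcongr
          · exact h3.trans h6
          · exact h4.trans h6
      _ = _ := by ring
  have h3 := h1.sub h2
  rw [sub_zero] at h3
  exact h3.congr fun T => by simp

-- Transcendence degree, Schanuel's conjecture and the conclusion.

universe u in
theorem Algebra.trdeg_eq_of_isAlgebraic (R : Type*) (S A : Type u) [CommRing R] [CommRing S] [Field A]
    [Algebra R S] [Algebra R A] [Algebra S A] [IsScalarTower R S A] [Nontrivial R]
    [FaithfulSMul R S] [FaithfulSMul S A] [Algebra.IsAlgebraic S A] :
    trdeg R S = trdeg R A := by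
  rw [← trdeg_add_eq R S (A := A), trdeg_eq_zero (R := S) (A := A), add_zero]

open scoped IntermediateField.algebraAdjoinAdjoin in
-- F[t] is a quotient of a polynomial ring in one variable, so its transcendence degree is at most
-- 1; passing to its fraction field and to algebraic elements over that does not raise it.
theorem IntermediateField.trdeg_adjoin_le_one {F E : Type*} [Field F] [Field E] [Algebra F E]
    {t : E} {S : Set E} (hS : ∀ s ∈ S, IsAlgebraic (IntermediateField.adjoin F {t}) s) :
    Algebra.trdeg F (IntermediateField.adjoin F S) ≤ 1 := by
  set K := algebraicClosure (IntermediateField.adjoin F {t}) E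
  have h1 : IntermediateField.adjoin F S ≤ K.restrictScalars F :=
    IntermediateField.adjoin_le_iff.2 fun s hs => mem_algebraicClosure_iff.2 (hS s hs)
  refine (trdeg_le_of_injective (IntermediateField.inclusion h1)
    (IntermediateField.inclusion_injective h1)).trans ?_
  change Algebra.trdeg F K ≤ 1
  have h2 : Algebra.trdeg F (IntermediateField.adjoin F {t}) ≤ 1 := by
    rw [← Algebra.trdeg_eq_of_isAlgebraic F (Algebra.adjoin F {t}) (IntermediateField.adjoin F {t})]
    have h3 : ∀ A : Subalgebra F E, A = (Polynomial.aeval t).range → Algebra.trdeg F A ≤ 1 := by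
      rintro _ rfl
      simpa [Polynomial.trdeg_of_isDomain] using
        lift_trdeg_le_of_surjective _ (Polynomial.aeval (R := F) t).rangeRestrict_surjective
    exact h3 _ (Algebra.adjoin_singleton_eq_range_aeval F t)
  have : FaithfulSMul (IntermediateField.adjoin F {t}) K :=
    (faithfulSMul_iff_algebraMap_injective _ _).2 fun _ _ h =>
      Subtype.ext (congrArg ((↑) : K → E) h)
  exact (Algebra.trdeg_eq_of_isAlgebraic F (IntermediateField.adjoin F {t}) K).ge.trans h2

theorem Complex.isAlgebraic_ofReal_iff {x : ℝ} : IsAlgebraic ℚ (x : ℂ) ↔ IsAlgebraic ℚ x :=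
  isAlgebraic_algebraMap_iff (R := ℚ) (S := ℝ) (A := ℂ) Complex.ofReal_injective

/-- exp(Λ(n)) is a prime or 1, and doubling clears the half weight at n = x, which would otherwise
leave a square root. -/
theorem exists_nat_exp_two_mul_vonMangoldt_mul_chebyshevWeight (x : ℝ) (n : ℕ) :
    ∃ m : ℕ, Real.exp (2 * (ArithmeticFunction.vonMangoldt n * chebyshevWeight x n)) = m := by
  obtain ⟨k, hk⟩ : ∃ k : ℕ, Real.exp (ArithmeticFunction.vonMangoldt n) = k := by
    rw [ArithmeticFunction.vonMangoldt_apply]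
    split_ifs with h
    · refine ⟨n.minFac, Real.exp_log ?_⟩
      exact_mod_cast n.minFac_pos
    · exact ⟨1, by simp⟩
  obtain ⟨j, hj⟩ : ∃ j : ℕ, 2 * chebyshevWeight x n = j := by
    unfold chebyshevWeight
    split_ifs
    · exact ⟨2, by norm_num⟩
    · exact ⟨1, by norm_num⟩
    · exact ⟨0, by norm_num⟩
  refine ⟨k ^ j, ?_⟩
  rw [show 2 * (ArithmeticFunction.vonMangoldt n * chebyshevWeight x n) =
    j * ArithmeticFunction.vonMangoldt n by rw [← hj]; ring, Real.exp_nat_mul, hk]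
  push_cast
  rfl

theorem exists_nat_exp_two_mul_chebyshevPsiNormalized (x : ℝ) :
    ∃ m : ℕ, Real.exp (2 * chebyshevPsiNormalized x) = m := by
  choose m hm using exists_nat_exp_two_mul_vonMangoldt_mul_chebyshevWeight x
  refine ⟨∏ n ∈ Finset.range (⌊x⌋₊ + 1), m n, ?_⟩
  rw [chebyshevPsiNormalized, tsum_eq_sum (s := Finset.range (⌊x⌋₊ + 1)), Finset.mul_sum,
    Real.exp_sum]
  · push_cast
    exact Finset.prod_congr rfl fun n _ => hm n
  · intro n hn
    have h1 : x < n := Nat.lt_of_floor_lt (by simpa [Nat.lt_succ_iff] using hn)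
    simp [chebyshevWeight, h1.not_gt, h1.ne']

theorem exp_two_mul_sub_explicitFormulaValue {x : ℝ} (hx : 1 < x) :
    Real.exp (2 * (x - explicitFormulaValue x)) = 4 * (1 - (x ^ 2)⁻¹) *
      Real.exp (2 * chebyshevPsiNormalized x) * Real.pi ^ 2 := by
  have h1 : 0 < 1 - (x ^ 2)⁻¹ := sub_pos.2 (inv_lt_one_of_one_lt₀ (one_lt_pow₀ hx two_ne_zero))
  have h2 : 2 * (x - explicitFormulaValue x) = (2 : ℕ) * Real.log (2 * Real.pi) +
      Real.log (1 - (x ^ 2)⁻¹) + 2 * chebyshevPsiNormalized x := by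
    unfold explicitFormulaValue
    push_cast
    ring
  rw [h2, Real.exp_add, Real.exp_add, Real.exp_nat_mul, Real.exp_log (by positivity),
    Real.exp_log h1]
  ring

theorem Complex.linearIndependent_ofReal_mul_I {a b : ℝ} (ha : a ≠ 0) (hb : b ≠ 0) :
    LinearIndependent ℚ ![(a : ℂ), b * Complex.I] := by
  rw [LinearIndependent.pair_iff]
  intro s t h
  have h1 := congrArg Complex.re h
  have h2 := congrArg Complex.im h
  simp [Rat.smul_def] at h1 h2
  exact ⟨h1.resolve_right ha, h2.resolve_right hb⟩

/-- Were π algebraic, πi and e^{πi} = -1 would both be algebraic, giving transcendence degree 0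
where the case n = 1 demands 1. -/
theorem SchanuelConjecture.transcendental_pi (h : SchanuelConjecture) :
    Transcendental ℚ Real.pi := by
  intro hpi
  have hI : IsAlgebraic ℚ Complex.I := (Complex.isIntegral_rat_I).isAlgebraic
  have h1 := h 1 (fun _ => Real.pi * Complex.I) (LinearIndependent.of_subsingleton 0
    (by simp [Real.pi_ne_zero]))
  have h2 : Algebra.IsAlgebraic ℚ (IntermediateField.adjoin ℚ
      (Set.range (fun _ : Fin 1 => Real.pi * Complex.I) ∪
        Set.range fun _ : Fin 1 => Complex.exp (Real.pi * Complex.I))) := by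
    refine IntermediateField.isAlgebraic_adjoin_iff_isAlgebraic ℚ ℂ |>.2 ?_
    rintro _ (⟨_, rfl⟩ | ⟨_, rfl⟩)
    · exact (Complex.isAlgebraic_ofReal_iff.2 hpi).mul hI
    · simp only [Complex.exp_pi_mul_I]
      exact isAlgebraic_one.neg
  rw [trdeg_eq_zero] at h1
  simp at h1

/-- Under Schanuel's conjecture the exponential of an algebraic number is never an algebraic
multiple of `π ^ 2`. -/
theorem SchanuelConjecture.exp_ne_mul_pi_sq (h : SchanuelConjecture) {γ β : ℝ}
    (hγ : IsAlgebraic ℚ γ) (hβ : IsAlgebraic ℚ β) :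
    Real.exp γ ≠ β * Real.pi ^ 2 := by
  intro he
  -- Independence of γ and πi needs γ ≠ 0; if γ = 0 the relation reads 1 = βπ².
  rcases eq_or_ne γ 0 with rfl | hγ0
  · refine h.transcendental_pi (IsAlgebraic.of_pow two_pos ?_)
    rw [Real.exp_zero] at he
    have : Real.pi ^ 2 = β⁻¹ := (inv_eq_of_mul_eq_one_right he.symm).symm
    rw [this]
    exact hβ.inv
  have h1 := h 2 _ (Complex.linearIndependent_ofReal_mul_I hγ0 Real.pi_ne_zero)
  set F := IntermediateField.adjoin ℚ {(Real.pi : ℂ)}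
  have hpi : IsAlgebraic F (Real.pi : ℂ) :=
    isAlgebraic_algebraMap (⟨Real.pi, IntermediateField.mem_adjoin_simple_self ℚ _⟩ : F)
  have halg : ∀ {y : ℝ}, IsAlgebraic ℚ y → IsAlgebraic F (y : ℂ) := fun hy =>
    (Complex.isAlgebraic_ofReal_iff.2 hy).tower_top F
  have hI : IsAlgebraic F Complex.I := ((Complex.isIntegral_rat_I).isAlgebraic).tower_top F
  have h2 := h1.trans (IntermediateField.trdeg_adjoin_le_one (t := (Real.pi : ℂ)) ?_)
  · norm_num at h2
  rintro _ (⟨i, rfl⟩ | ⟨i, rfl⟩) <;> fin_cases i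
  · exact halg hγ
  · exact hpi.mul hI
  · change IsAlgebraic F (Complex.exp γ)
    rw [← Complex.ofReal_exp, he]
    push_cast
    exact (halg hβ).mul (hpi.pow 2)
  · change IsAlgebraic F (Complex.exp (Real.pi * Complex.I))
    rw [Complex.exp_pi_mul_I]
    exact isAlgebraic_one.neg

theorem zetaZeroSum_eq {x : ℝ} (hx : 1 < x) : zetaZeroSum x = explicitFormulaValue x :=
  (tendsto_zetaZeroPartialSum hx).limUnder_eq

theorem mainTheorem4 :
    (∀ x : ℝ, 1 < x → IsAlgebraic ℚ x →
      Tendsto (fun T : ℝ => zetaZeroPartialSum x T) atTop (𝓝 (zetaZeroSum x))) ∧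
    (SchanuelConjecture → ∀ z ∈ zetaZeroSumValues, Transcendental ℚ z) := by
  refine ⟨fun x hx _ => zetaZeroSum_eq hx ▸ tendsto_zetaZeroPartialSum hx, ?_⟩
  rintro h _ ⟨x, hx, hxa, rfl⟩ hz
  rw [zetaZeroSum_eq hx, Complex.isAlgebraic_ofReal_iff] at hz
  obtain ⟨m, hm⟩ := exists_nat_exp_two_mul_chebyshevPsiNormalized x
  -- Here γ = 2(x - f(x)) and β = 4(1 - x⁻²)m with m = exp(2ψ₀(x)).
  refine h.exp_ne_mul_pi_sq (((isAlgebraic_natCast 2).mul (hxa.sub hz))) ?_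
    (exp_two_mul_sub_explicitFormulaValue hx)
  rw [hm]
  exact ((isAlgebraic_natCast 4).mul (isAlgebraic_one.sub (hxa.pow 2).inv)).mul (isAlgebraic_natCast m)
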